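/- Let $N$ be a smooth $6$-dimensional manifold (without boundary) with an $SU(3)$-structure $(g,J,\psi)$: a smooth Riemannian metric $g$, a smooth $g$-orthogonal almost complex structure $J$, and a smooth complex volume form $\psi=\psi_++i\psi_-$ of type $(3,0)$ and of unit norm (that is, $|\psi(u,v,w)|=1$ on every unitary frame $u,v,w$ of a tangent space). Let $\omega(X,Y)=g(JX,Y)$ be its fundamental form. Suppose that the structure is in the class $\mathcal W_2^+$, i.e. $$d\omega=0,\qquad d\psi_+=-\pi_2\wedge\omega,\qquad d\psi_-=0,$$ where the torsion form $\pi_2$ is a smooth $2$-form satisfying $\pi_2(JX,JY)=\pi_2(X,Y)$ and $\pi_2\wedge\omega^2=0$. (a) If $d\pi_2=0$, then $\pi_2=0$, the $SU(3)$-structure is integrable (its intrinsic torsion vanishes, i.e. $\nabla\omega=0$ and $\nabla\psi=0$ for the Levi-Civita connection $\nabla$ of $g$), and in particular $g$ is Ricci-flat. (b) Consequently, let $\alpha$ be a smooth $1$-form on $S^1$ that is not identically zero (for instance $\alpha=dt$; such a form is automatically closed). If the $3$-form $H=\pi_2\wedge\alpha$ on $N\times S^1$ (pullbacks understood) is closed,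 then the $SU(3)$-structure is integrable. -/

import Mathlib

open scoped Manifold ContDiff

noncomputable section

namespace SU3Geometry

section Algebra

variable {V : Type*} [AddCommGroup V] [Module ℝ V] [TopologicalSpace V]

/-- The multilinear map `(v₁, …, v_{k+l}) ↦ a(v₁, …, v_k) b(v_{k+1}, …, v_{k+l})`. -/
def mulForms {k l : ℕ} (a : V [⋀^Fin k]→L[ℝ] ℝ) (b : V [⋀^Fin l]→L[ℝ] ℝ) :
    ContinuousMultilinearMap ℝ (fun _ : Fin (k + l) => V) ℝ where
  toMultilinearMap :=
    ((LinearMap.mul' ℝ ℝ).compMultilinearMap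
      (a.toMultilinearMap.domCoprod b.toMultilinearMap)).domDomCongr finSumFinEquiv
  cont := by
    change Continuous fun v : Fin (k + l) → V =>
      a (fun i => v (finSumFinEquiv (Sum.inl i))) * b (fun i => v (finSumFinEquiv (Sum.inr i)))
    exact (a.cont.comp (by fun_prop)).mul (b.cont.comp (by fun_prop))

theorem mulForms_apply {k l : ℕ} (a : V [⋀^Fin k]→L[ℝ] ℝ) (b : V [⋀^Fin l]→L[ℝ] ℝ)
    (v : Fin (k + l) → V) :
    mulForms a b v = a (fun i => v (Fin.castAdd l i)) * b (fun i => v (Fin.natAdd k i)) := rfl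

/-- The wedge product
`(a ∧ b)(v) = 1/(k! l!) ∑_σ sign(σ) a(v_{σ(1)}, …, v_{σ(k)}) b(v_{σ(k+1)}, …, v_{σ(k+l)})`,
normalised so that `e¹ ∧ e²` takes the value `1` on `(e₁, e₂)`. -/
def wedge {k l : ℕ} (a : V [⋀^Fin k]→L[ℝ] ℝ) (b : V [⋀^Fin l]→L[ℝ] ℝ) :
    V [⋀^Fin (k + l)]→L[ℝ] ℝ :=
  ((Nat.factorial k * Nat.factorial l : ℕ) : ℝ)⁻¹ •
    ContinuousMultilinearMap.alternatization (mulForms a b)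

theorem wedge_apply {k l : ℕ} (a : V [⋀^Fin k]→L[ℝ] ℝ) (b : V [⋀^Fin l]→L[ℝ] ℝ)
    (v : Fin (k + l) → V) :
    wedge a b v = ((Nat.factorial k * Nat.factorial l : ℕ) : ℝ)⁻¹ *
      ∑ σ : Equiv.Perm (Fin (k + l)), Equiv.Perm.sign σ •
        (a (fun i => v (σ (Fin.castAdd l i))) * b (fun i => v (σ (Fin.natAdd k i)))) := by
  simp [wedge, ContinuousMultilinearMap.alternatization_apply_apply, mulForms_apply]

end Algebra

section Forms

variable {E : Type*} [NormedAddCommGroup E] [NormedSpace ℝ E]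
  {H : Type*} [TopologicalSpace H] (I : ModelWithCorners ℝ E H)
  (M : Type*) [TopologicalSpace M] [ChartedSpace H M]
  {E' : Type*} [NormedAddCommGroup E'] [NormedSpace ℝ E']
  {H' : Type*} [TopologicalSpace H'] (I' : ModelWithCorners ℝ E' H')
  {M' : Type*} [TopologicalSpace M'] [ChartedSpace H' M']
  {F : Type*} [NormedAddCommGroup F] [NormedSpace ℝ F]

/-- (Not necessarily smooth) differential `k`-forms on `M` with values in `F`. Manifolds are
without boundary throughout. -/
abbrev DForm (k : ℕ) (F : Type*) [NormedAddCommGroup F] [NormedSpace ℝ F] :=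
  ∀ x : M, TangentSpace I x [⋀^Fin k]→L[ℝ] F

variable {M}

/-- The local expression of a form in the chart `e`: its pullback under the inverse
`E ⊇ target → M` of the chart. -/
def DForm.inChart {k : ℕ} (η : DForm I M k F) (e : OpenPartialHomeomorph M H) (y : E) :
    E [⋀^Fin k]→L[ℝ] F :=
  (η ((e.extend I).symm y)).compContinuousLinearMap
    (mfderiv 𝓘(ℝ, E) I (e.extend I).symm y : E →L[ℝ] TangentSpace I ((e.extend I).symm y))

/-- A form is smooth if its local expression in every chart of the smooth structure is. -/
def DForm.IsSmooth {k : ℕ} (η : DForm I M k F) : Prop :=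
  ∀ e ∈ IsManifold.maximalAtlas I ∞ M, ContDiffOn ℝ ∞ (η.inChart I e) (e.extend I).target

/-- `dη = θ`: in every chart of the smooth structure the local expression of `θ` is the exterior
derivative of the local expression of `η`. -/
def DForm.HasExtDeriv {k : ℕ} (η : DForm I M k F) (θ : DForm I M (k + 1) F) : Prop :=
  ∀ e ∈ IsManifold.maximalAtlas I ∞ M, ∀ y ∈ (e.extend I).target,
    extDeriv (η.inChart I e) y = θ.inChart I e y

/-- `dη = 0`. -/
def DForm.IsClosed {k : ℕ} (η : DForm I M k F) : Prop :=
  η.HasExtDeriv I 0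

variable {I} in
/-- The wedge product of forms on a manifold. -/
def DForm.wedge {k l : ℕ} (η : DForm I M k ℝ) (θ : DForm I M l ℝ) : DForm I M (k + l) ℝ :=
  fun x => SU3Geometry.wedge (η x) (θ x)

/-- The pullback `f^* η` of a form under a map `f`. -/
def DForm.pullback {k : ℕ} (f : M → M') (η : DForm I' M' k F) : DForm I M k F :=
  fun x => (η (f x)).compContinuousLinearMap (mfderiv I I' f x)

end Forms

section LeviCivita

variable {n : ℕ} {N : Type*} [TopologicalSpace N]
  [ChartedSpace (EuclideanSpace ℝ (Fin n)) N] [IsManifold (𝓡 n) ∞ N]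
  {F : Type*} [NormedAddCommGroup F] [NormedSpace ℝ F]

/-- Smooth Riemannian metrics on a smooth `n`-manifold. -/
abbrev SmoothMetric (n : ℕ) (N : Type*) [TopologicalSpace N]
    [ChartedSpace (EuclideanSpace ℝ (Fin n)) N] [IsManifold (𝓡 n) ∞ N] :=
  Bundle.ContMDiffRiemannianMetric (𝓡 n) ∞ (EuclideanSpace ℝ (Fin n))
    (fun x : N => TangentSpace (𝓡 n) x)

/-- The partial derivative `∂ᵢ f`. -/
def pd (i : Fin n) (f : EuclideanSpace ℝ (Fin n) → F) (y : EuclideanSpace ℝ (Fin n)) : F :=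
  fderiv ℝ f y (EuclideanSpace.single i 1)

/-- The coordinate vector field `∂ᵢ` of the chart `e`, at the point with coordinates `y`. -/
def coordField (e : OpenPartialHomeomorph N (EuclideanSpace ℝ (Fin n)))
    (y : EuclideanSpace ℝ (Fin n)) (i : Fin n) :
    TangentSpace (𝓡 n) ((e.extend (𝓡 n)).symm y) :=
  mfderiv 𝓘(ℝ, EuclideanSpace ℝ (Fin n)) (𝓡 n) (e.extend (𝓡 n)).symm y
    (EuclideanSpace.single i (1 : ℝ) : EuclideanSpace ℝ (Fin n))

/-- The matrix `g_{ij}` of the metric in the chart `e`. -/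
def gram (g : SmoothMetric n N) (e : OpenPartialHomeomorph N (EuclideanSpace ℝ (Fin n)))
    (y : EuclideanSpace ℝ (Fin n)) : Matrix (Fin n) (Fin n) ℝ :=
  Matrix.of fun i j =>
    g.inner ((e.extend (𝓡 n)).symm y) (coordField e y i) (coordField e y j)

/-- The Christoffel symbols `Γ^k_{ij} = ½ g^{kl} (∂ᵢ g_{jl} + ∂ⱼ g_{il} - ∂ₗ g_{ij})` of the
Levi-Civita connection, so that `∇_{∂ᵢ} ∂ⱼ = Γ^k_{ij} ∂ₖ`. -/
def christoffel (g : SmoothMetric n N) (e : OpenPartialHomeomorph N (EuclideanSpace ℝ (Fin n)))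
    (k i j : Fin n) (y : EuclideanSpace ℝ (Fin n)) : ℝ :=
  (1 / 2) * ∑ l : Fin n, (gram g e y)⁻¹ k l *
    (pd i (fun z => gram g e z j l) y + pd j (fun z => gram g e z i l) y
      - pd l (fun z => gram g e z i j) y)

/-- The curvature components `R^l_{ijk}`, defined by `R(∂ᵢ, ∂ⱼ) ∂ₖ = R^l_{ijk} ∂ₗ`, where
`R(X, Y) = ∇_X ∇_Y - ∇_Y ∇_X - ∇_{[X, Y]}`. -/
def riemann (g : SmoothMetric n N) (e : OpenPartialHomeomorph N (EuclideanSpace ℝ (Fin n)))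
    (l i j k : Fin n) (y : EuclideanSpace ℝ (Fin n)) : ℝ :=
  pd i (christoffel g e l j k) y - pd j (christoffel g e l i k) y
    + ∑ p : Fin n, (christoffel g e l i p y * christoffel g e p j k y
        - christoffel g e l j p y * christoffel g e p i k y)

/-- The Ricci components `Ric_{jk} = R^i_{ijk}`. -/
def ricci (g : SmoothMetric n N) (e : OpenPartialHomeomorph N (EuclideanSpace ℝ (Fin n)))
    (j k : Fin n) (y : EuclideanSpace ℝ (Fin n)) : ℝ :=
  ∑ i : Fin n, riemann g e i i j k y

/-- The Ricci tensor of `g` vanishes identically. -/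
def IsRicciFlat (g : SmoothMetric n N) : Prop :=
  ∀ e ∈ IsManifold.maximalAtlas (𝓡 n) ∞ N, ∀ y ∈ (e.extend (𝓡 n)).target,
    ∀ j k : Fin n, ricci g e j k y = 0

/-- The component `(∇_{∂ᵢ} η)(∂_{a₁}, …, ∂_{aₖ})` of the Levi-Civita covariant derivative of a
form, `∂ᵢ η_{a₁…aₖ} - ∑ₛ ∑ₗ Γ^l_{i aₛ} η_{a₁…l…aₖ}` with `l` in the place `s`. -/
def covDeriv (g : SmoothMetric n N) {k : ℕ} (η : DForm (𝓡 n) N k F)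
    (e : OpenPartialHomeomorph N (EuclideanSpace ℝ (Fin n)))
    (i : Fin n) (a : Fin k → Fin n) (y : EuclideanSpace ℝ (Fin n)) : F :=
  pd i (fun z => η ((e.extend (𝓡 n)).symm z) (fun s => coordField e z (a s))) y
    - ∑ s : Fin k, ∑ l : Fin n, christoffel g e l i (a s) y •
        η ((e.extend (𝓡 n)).symm y) (fun t => coordField e y (Function.update a s l t))

/-- `∇η = 0` for the Levi-Civita connection `∇` of `g`. -/
def IsParallel (g : SmoothMetric n N) {k : ℕ} (η : DForm (𝓡 n) N k F) : Prop :=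
  ∀ e ∈ IsManifold.maximalAtlas (𝓡 n) ∞ N, ∀ y ∈ (e.extend (𝓡 n)).target,
    ∀ (i : Fin n) (a : Fin k → Fin n), covDeriv g η e i a y = 0

end LeviCivita

section SU3

/-- An `SU(3)`-structure on a smooth `6`-manifold: a Riemannian metric `g`, a `g`-orthogonal almost
complex structure `J`, and a complex volume form `ψ` (a complex `3`-form of type `(3,0)`) of unit
norm, all smooth. -/
structure SU3Structure (N : Type*) [TopologicalSpace N]
    [ChartedSpace (EuclideanSpace ℝ (Fin 6)) N] [IsManifold (𝓡 6) ∞ N] where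
  /-- the Riemannian metric -/
  g : SmoothMetric 6 N
  /-- the almost complex structure -/
  J : ∀ x : N, TangentSpace (𝓡 6) x →L[ℝ] TangentSpace (𝓡 6) x
  smooth_J : ContMDiff (𝓡 6)
    ((𝓡 6).prod 𝓘(ℝ, EuclideanSpace ℝ (Fin 6) →L[ℝ] EuclideanSpace ℝ (Fin 6))) ∞
    (fun x => Bundle.TotalSpace.mk' (EuclideanSpace ℝ (Fin 6) →L[ℝ] EuclideanSpace ℝ (Fin 6))
      (E := fun x : N => TangentSpace (𝓡 6) x →L[ℝ] TangentSpace (𝓡 6) x) x (J x))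
  J_J : ∀ (x : N) (u : TangentSpace (𝓡 6) x), J x (J x u) = -u
  inner_J_J : ∀ (x : N) (u v : TangentSpace (𝓡 6) x),
    g.inner x (J x u) (J x v) = g.inner x u v
  /-- the complex volume form -/
  psi : DForm (𝓡 6) N 3 ℂ
  smooth_psi : psi.IsSmooth (𝓡 6)
  /-- `ψ` is of type `(3,0)`, that is, complex trilinear with respect to `J` -/
  psi_J : ∀ (x : N) (u v w : TangentSpace (𝓡 6) x),
    psi x ![J x u, v, w] = Complex.I * psi x ![u, v, w]
  /-- unit norm: `|ψ(u, v, w)| = 1` on every unitary frame `u, v, w` of `(T_x N, g, J)` -/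
  norm_psi : ∀ (x : N) (u v w : TangentSpace (𝓡 6) x),
    g.inner x u u = 1 → g.inner x v v = 1 → g.inner x w w = 1 →
    g.inner x u v = 0 → g.inner x u w = 0 → g.inner x v w = 0 →
    g.inner x (J x u) v = 0 → g.inner x (J x u) w = 0 → g.inner x (J x v) w = 0 →
    ‖psi x ![u, v, w]‖ = 1

namespace SU3Structure

variable {N : Type*} [TopologicalSpace N]
  [ChartedSpace (EuclideanSpace ℝ (Fin 6)) N] [IsManifold (𝓡 6) ∞ N] (S : SU3Structure N)

theorem inner_J_self (x : N) (u : TangentSpace (𝓡 6) x) : S.g.inner x (S.J x u) u = 0 := by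
  have h := S.inner_J_J x (S.J x u) u
  rw [S.J_J, S.g.symm x (S.J x u) u] at h
  simp only [map_neg, neg_apply] at h
  rw [S.g.symm x (S.J x u) u]
  linarith

/-- The fundamental form `ω(X, Y) = g(JX, Y)`. -/
def omega : DForm (𝓡 6) N 2 ℝ := fun x =>
  { toFun := fun v => S.g.inner x (S.J x (v 0)) (v 1)
    map_update_add' := by
      intro _ v i a b
      fin_cases i <;> simp
    map_update_smul' := by
      intro _ v i c a
      fin_cases i <;> simp
    cont := by
      let B : EuclideanSpace ℝ (Fin 6) →L[ℝ] EuclideanSpace ℝ (Fin 6) →L[ℝ] ℝ :=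
        (S.g.inner x).comp (S.J x)
      change Continuous fun v : Fin 2 → EuclideanSpace ℝ (Fin 6) => B (v 0) (v 1)
      fun_prop
    map_eq_zero_of_eq' := by
      intro v i j hv hij
      have h : v 0 = v 1 := by
        fin_cases i <;> fin_cases j <;> simp_all
      change S.g.inner x (S.J x (v 0)) (v 1) = 0
      rw [h]
      exact S.inner_J_self x (v 1) }

theorem omega_apply (x : N) (v : Fin 2 → TangentSpace (𝓡 6) x) :
    S.omega x v = S.g.inner x (S.J x (v 0)) (v 1) := rfl

/-- `ψ₊`, the real part of `ψ`. -/
def psiPlus : DForm (𝓡 6) N 3 ℝ := fun x =>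
  Complex.reCLM.compContinuousAlternatingMap (S.psi x)

/-- `ψ₋`, the imaginary part of `ψ`. -/
def psiMinus : DForm (𝓡 6) N 3 ℝ := fun x =>
  Complex.imCLM.compContinuousAlternatingMap (S.psi x)

/-- The structure belongs to the class `𝒲₂⁺` with torsion form `π₂`: `dω = 0`,
`dψ₊ = -π₂ ∧ ω`, `dψ₋ = 0`, where `π₂` is a smooth `2`-form with values in
`{γ | Jγ = γ, γ ∧ ω² = 0}` and `(Jγ)(X, Y) = γ(JX, JY)`. -/
structure IsClassW2Plus (π₂ : DForm (𝓡 6) N 2 ℝ) : Prop where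
  smooth : π₂.IsSmooth (𝓡 6)
  J_invariant : ∀ (x : N) (u v : TangentSpace (𝓡 6) x),
    π₂ x ![S.J x u, S.J x v] = π₂ x ![u, v]
  primitive : π₂.wedge (S.omega.wedge S.omega) = 0
  d_omega : S.omega.IsClosed (𝓡 6)
  d_psiPlus : S.psiPlus.HasExtDeriv (𝓡 6) (-(π₂.wedge S.omega))
  d_psiMinus : S.psiMinus.IsClosed (𝓡 6)

/-- The `SU(3)`-structure is integrable: its intrinsic torsion vanishes, that is, the Levi-Civita
connection of `g` preserves the `SU(3)`-structure, `∇ω = 0` and `∇ψ = 0`. (As `∇g = 0`, the first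
condition is the same as `∇J = 0`.) -/
def IsIntegrable : Prop :=
  IsParallel S.g S.omega ∧ IsParallel S.g S.psi

end SU3Structure

/-- The `3`-form `π₂ ∧ α` on `N × S¹`, for a `2`-form `π₂` on `N` and a `1`-form `α` on `S¹`. -/
def fluxForm {N : Type*} [TopologicalSpace N] [ChartedSpace (EuclideanSpace ℝ (Fin 6)) N]
    (π₂ : DForm (𝓡 6) N 2 ℝ) (α : DForm (𝓡 1) Circle 1 ℝ) :
    DForm ((𝓡 6).prod (𝓡 1)) (N × Circle) 3 ℝ :=
  (DForm.pullback ((𝓡 6).prod (𝓡 1)) (𝓡 6) Prod.fst π₂).wedge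
    (DForm.pullback ((𝓡 6).prod (𝓡 1)) (𝓡 1) Prod.snd α)

end SU3

end SU3Geometry

end

/-! Everything is local. In a chart the data are a metric, an almost complex structure and a
(3,0)-form on an open subset of ℝ⁶, exterior derivatives are alternating sums of directional
derivatives, and the argument becomes linear algebra on first derivatives at one point.

The Nijenhuis tensor N of J is seen in two ways. Since ψ has type (3,0), inserting two (0,1)-vectors
into dψ leaves only a term ψ(N(X, Y), ·, ·) (`psi_nij`); with dψ = -π₂ ∧ ω this expresses N linearly
through π₂. Since π₂ has type (1,1), the (3,0)+(0,3) part of dπ₂ is a cyclic contraction of π₂ with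
N (`cyclic_nij`), which vanishes if dπ₂ = 0. Substituting the first expression into the second gives
a quadratic identity in π₂; for primitive π₂ it says |π₂|² = 0 (`torsionForm_eq_zero`).

Once π₂ = 0, both ω and ψ are closed. Then N = 0, and together with dω = 0 this gives ∇J = 0
(`covDeriv_J_eq_zero`). Hence ∇_X ψ is again of type (3,0), so a multiple of ψ. The multiple is
complex linear in X because dψ = 0 and purely imaginary because |ψ| is constant, so it is zero
(`covDeriv_psi_eq_zero`). The curvature therefore annihilates g, ω and ψ, and an algebraic curvature
tensor with values in 𝔰𝔲(3) is Ricci-flat by the Bianchi identity and the vanishing of complex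
traces (`ricci_eq_zero_of_su3`).

For (b), dH evaluated on three vectors tangent to N and one tangent to the circle is the product of
dπ₂ and α (`extDeriv_fluxForm_apply`). At a point of the circle where α ≠ 0 this forces dπ₂ = 0 on
all of N, which reduces (b) to (a). -/

noncomputable section

set_option maxSynthPendingDepth 5

namespace SU3Geometry

/-! ### Linear SU(3)-structures and adapted unitary frames -/

section LinearAlgebra

variable {V : Type*} [NormedAddCommGroup V] [NormedSpace ℝ V]

/-- `φ` is an alternating trilinear form of type `(3,0)` for the endomorphism `J`. -/
structure IsComplexVolume (J : V →L[ℝ] V) (φ : V →L[ℝ] V →L[ℝ] V →L[ℝ] ℂ) : Prop where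
  self_left : ∀ u w, φ u u w = 0
  self_right : ∀ u v, φ u v v = 0
  J_left : ∀ u v w, φ (J u) v w = Complex.I * φ u v w

/-- `(g, J, ψ)` is a linear `SU(3)`-structure on `V`. -/
structure IsLinearSU3 (g : V →L[ℝ] V →L[ℝ] ℝ) (J : V →L[ℝ] V)
    (ψ : V →L[ℝ] V →L[ℝ] V →L[ℝ] ℂ) : Prop extends IsComplexVolume J ψ where
  symm : ∀ u v, g u v = g v u
  pos : ∀ u, u ≠ 0 → 0 < g u u
  J_J : ∀ u, J (J u) = -u
  g_J_J : ∀ u v, g (J u) (J v) = g u v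
  norm_frame : ∀ u v w, g u u = 1 → g v v = 1 → g w w = 1 →
    g u v = 0 → g u w = 0 → g v w = 0 → g (J u) v = 0 → g (J u) w = 0 → g (J v) w = 0 →
    ‖ψ u v w‖ = 1

/-- A unitary frame `e` with `ψ(e₀, e₁, e₂) = 1`. -/
structure IsAdaptedFrame (g : V →L[ℝ] V →L[ℝ] ℝ) (J : V →L[ℝ] V)
    (ψ : V →L[ℝ] V →L[ℝ] V →L[ℝ] ℂ) (e : Fin 3 → V) : Prop where
  g_e_e : ∀ i j, g (e i) (e j) = if i = j then 1 else 0
  g_Je_e : ∀ i j, g (J (e i)) (e j) = 0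
  psi_e : ψ (e 0) (e 1) (e 2) = 1
  expand : ∀ v, v = ∑ i, (g v (e i) • e i + g v (J (e i)) • J (e i))

namespace IsComplexVolume

variable {J : V →L[ℝ] V} {φ : V →L[ℝ] V →L[ℝ] V →L[ℝ] ℂ}

theorem swap_left (h : IsComplexVolume J φ) (u v w : V) : φ u v w = -φ v u w := by
  have := h.self_left (u + v) w
  simp only [map_add, add_apply, h.self_left] at this
  linear_combination this

theorem swap_right (h : IsComplexVolume J φ) (u v w : V) : φ u v w = -φ u w v := by
  have := h.self_right u (v + w)
  simp only [map_add, add_apply, h.self_right] at this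
  linear_combination this

theorem J_mid (h : IsComplexVolume J φ) (u v w : V) : φ u (J v) w = Complex.I * φ u v w := by
  rw [h.swap_left, h.J_left, h.swap_left v u]; ring

theorem J_right (h : IsComplexVolume J φ) (u v w : V) : φ u v (J w) = Complex.I * φ u v w := by
  rw [h.swap_right, h.J_mid, h.swap_right u w]; ring

end IsComplexVolume

namespace IsLinearSU3

variable {g : V →L[ℝ] V →L[ℝ] ℝ} {J : V →L[ℝ] V} {ψ : V →L[ℝ] V →L[ℝ] V →L[ℝ] ℂ}

theorem g_J_left (h : IsLinearSU3 g J ψ) (u v : V) : g (J u) v = -g u (J v) := by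
  have := h.g_J_J u (J v)
  rw [h.J_J] at this
  simp only [map_neg] at this
  linarith

theorem g_J_self (h : IsLinearSU3 g J ψ) (u : V) : g (J u) u = 0 := by
  have := h.g_J_left u u
  rw [h.symm u] at this
  linarith

theorem ext_g (h : IsLinearSU3 g J ψ) {u v : V} (H : ∀ w, g u w = g v w) : u = v := by
  by_contra hne
  have := h.pos (u - v) (sub_ne_zero.2 hne)
  simp [H] at this

/-- Fewer than dim V linear equations have a common nonzero solution, which is then normalised. With
0, 2 and 4 equations this produces the successive vectors of a unitary frame. -/
theorem exists_orthogonal [FiniteDimensional ℝ V] (h : IsLinearSU3 g J ψ) {k : ℕ} (w : Fin k → V)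
    (hk : k < Module.finrank ℝ V) : ∃ u, g u u = 1 ∧ ∀ i, g (w i) u = 0 := by
  let L : V →ₗ[ℝ] (Fin k → ℝ) := LinearMap.pi fun i => (g (w i)).toLinearMap
  have hL : LinearMap.ker L ≠ ⊥ := LinearMap.ker_ne_bot_of_finrank_lt (by simpa using hk)
  obtain ⟨x, hx, hx0⟩ := Submodule.exists_mem_ne_zero_of_ne_bot hL
  have hp := h.pos x hx0
  refine ⟨(Real.sqrt (g x x))⁻¹ • x, ?_, fun i => ?_⟩
  · have := Real.mul_self_sqrt hp.le
    have h0 : Real.sqrt (g x x) ≠ 0 := (Real.sqrt_pos.2 hp).ne'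
    simp only [map_smul, smul_apply, smul_eq_mul]
    field_simp
    nlinarith
  · have : g (w i) x = 0 := congrFun (LinearMap.mem_ker.1 hx) i
    simp [this]

/-- The real frame `e₀, e₁, e₂, Je₀, Je₁, Je₂` of a unitary frame. -/
def realFrame (J : V →L[ℝ] V) (e : Fin 3 → V) : Fin 3 ⊕ Fin 3 → V :=
  Sum.elim e (fun i => J (e i))

theorem g_realFrame (h : IsLinearSU3 g J ψ) {e : Fin 3 → V}
    (h1 : ∀ i j, g (e i) (e j) = if i = j then 1 else 0) (h2 : ∀ i j, g (J (e i)) (e j) = 0)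
    (a b : Fin 3 ⊕ Fin 3) :
    g (realFrame J e a) (realFrame J e b) = if a = b then 1 else 0 := by
  rcases a with i | i <;> rcases b with j | j
  · simp [realFrame, h1]
  · simp [realFrame, h.symm (e i), h2]
  · simp [realFrame, h2]
  · simp [realFrame, h.g_J_J, h1]

theorem linearIndependent_realFrame (h : IsLinearSU3 g J ψ) {e : Fin 3 → V}
    (h1 : ∀ i j, g (e i) (e j) = if i = j then 1 else 0) (h2 : ∀ i j, g (J (e i)) (e j) = 0) :
    LinearIndependent ℝ (realFrame J e) := by
  rw [Fintype.linearIndependent_iff]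
  intro c hc a
  have := congrArg (fun x => g x (realFrame J e a)) hc
  simpa [-Fintype.sum_sum_type, map_sum, sum_apply,
    h.g_realFrame h1 h2] using this

/-- The basis `e₀, e₁, e₂, Je₀, Je₁, Je₂` of a unitary frame. -/
def unitaryBasis (h : IsLinearSU3 g J ψ) (hV : Module.finrank ℝ V = 6) {e : Fin 3 → V}
    (h1 : ∀ i j, g (e i) (e j) = if i = j then 1 else 0) (h2 : ∀ i j, g (J (e i)) (e j) = 0) :
    Module.Basis (Fin 3 ⊕ Fin 3) ℝ V :=
  basisOfLinearIndependentOfCardEqFinrank (h.linearIndependent_realFrame h1 h2) (by simp [hV])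

theorem coe_unitaryBasis (h : IsLinearSU3 g J ψ) (hV : Module.finrank ℝ V = 6) {e : Fin 3 → V}
    (h1 : ∀ i j, g (e i) (e j) = if i = j then 1 else 0) (h2 : ∀ i j, g (J (e i)) (e j) = 0) :
    ⇑(h.unitaryBasis hV h1 h2) = realFrame J e :=
  coe_basisOfLinearIndependentOfCardEqFinrank _ _

theorem repr_unitaryBasis (h : IsLinearSU3 g J ψ) (hV : Module.finrank ℝ V = 6) {e : Fin 3 → V}
    (h1 : ∀ i j, g (e i) (e j) = if i = j then 1 else 0) (h2 : ∀ i j, g (J (e i)) (e j) = 0)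
    (v : V) (a : Fin 3 ⊕ Fin 3) :
    (h.unitaryBasis hV h1 h2).repr v a = g v (realFrame J e a) := by
  conv_rhs => rw [← (h.unitaryBasis hV h1 h2).sum_repr v]
  simp [-Fintype.sum_sum_type, -Module.Basis.sum_repr, map_sum,
    coe_unitaryBasis, h.g_realFrame h1 h2]

theorem expand_unitary (h : IsLinearSU3 g J ψ) (hV : Module.finrank ℝ V = 6) {e : Fin 3 → V}
    (h1 : ∀ i j, g (e i) (e j) = if i = j then 1 else 0) (h2 : ∀ i j, g (J (e i)) (e j) = 0)
    (v : V) : v = ∑ i, (g v (e i) • e i + g v (J (e i)) • J (e i)) := by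
  conv_lhs => rw [← (h.unitaryBasis hV h1 h2).sum_repr v]
  simp only [repr_unitaryBasis, coe_unitaryBasis]
  simp [realFrame, Finset.sum_add_distrib]

theorem exists_adaptedFrame [FiniteDimensional ℝ V] (h : IsLinearSU3 g J ψ)
    (hV : Module.finrank ℝ V = 6) :
    ∃ e, IsAdaptedFrame g J ψ e := by
  obtain ⟨a, ha, -⟩ := h.exists_orthogonal (Fin.elim0 : Fin 0 → V) (by omega)
  obtain ⟨b, hb, hab⟩ := h.exists_orthogonal ![a, J a] (by omega)
  obtain ⟨c, hc, hac⟩ := h.exists_orthogonal ![a, J a, b, J b] (by omega)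
  have ab : g a b = 0 := hab 0
  have Jab : g (J a) b = 0 := hab 1
  have ac : g a c = 0 := hac 0
  have Jac : g (J a) c = 0 := hac 1
  have bc : g b c = 0 := hac 2
  have Jbc : g (J b) c = 0 := hac 3
  have hn := h.norm_frame a b c ha hb hc ab ac bc Jab Jac Jbc
  set p : ℂ := ψ a b c with hp
  have hpp : p.re * p.re + p.im * p.im = 1 := by
    have := Complex.normSq_eq_norm_sq p
    rw [hn, Complex.normSq_apply] at this
    linarith
  -- `a'` is the conjugate of `p` times `a`, with `J` as multiplication by i, so that ψ(a', b, c) =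
  -- |p|² = 1.
  let a' : V := p.re • a - p.im • J a
  have hJa' : J a' = p.re • J a + p.im • a := by simp [a', h.J_J]
  have e1 : ∀ i j, g (![a', b, c] i) (![a', b, c] j) = if i = j then 1 else 0 := by
    have aJa := h.g_J_self a
    have haJ : g a (J a) = 0 := by rw [h.symm]; exact aJa
    have hJ := h.g_J_J a a
    have hba : g b a = 0 := by rw [h.symm]; exact ab
    have hbJa : g b (J a) = 0 := by rw [h.symm]; exact Jab
    have hca : g c a = 0 := by rw [h.symm]; exact ac
    have hcJa : g c (J a) = 0 := by rw [h.symm]; exact Jac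
    have hcb : g c b = 0 := by rw [h.symm]; exact bc
    intro i j
    fin_cases i <;> fin_cases j <;> simp [a', *] <;> linarith
  have e2 : ∀ i j, g (J (![a', b, c] i)) (![a', b, c] j) = 0 := by
    have aJa := h.g_J_self a
    have haJ : g a (J a) = 0 := by rw [h.symm]; exact aJa
    have hJ := h.g_J_J a a
    have hJb : g (J b) b = 0 := h.g_J_self b
    have hJc : g (J c) c = 0 := h.g_J_self c
    have hba : g (J b) a = 0 := by rw [h.symm, ← h.g_J_J, h.J_J]; simpa using Jab
    have hbJa : g (J b) (J a) = 0 := by rw [h.g_J_J, h.symm]; exact ab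
    have hca : g (J c) a = 0 := by rw [h.symm, ← h.g_J_J, h.J_J]; simpa using Jac
    have hcJa : g (J c) (J a) = 0 := by rw [h.g_J_J, h.symm]; exact ac
    have hcb : g (J c) b = 0 := by rw [h.symm, ← h.g_J_J, h.J_J]; simpa using Jbc
    intro i j
    fin_cases i <;> fin_cases j <;> simp [a', h.J_J, *] <;> ring
  refine ⟨![a', b, c], e1, e2, ?_, h.expand_unitary hV e1 e2⟩
  have : ψ a' b c = (p.re - p.im * Complex.I) * p := by
    simp only [a', map_sub, map_smul, sub_apply, smul_apply, h.J_left, ← hp, Complex.real_smul]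
    ring
  change ψ a' b c = 1
  rw [this]
  apply Complex.ext <;> simp <;> linarith

end IsLinearSU3

end LinearAlgebra

/-! ### Pointwise algebra: the torsion form, ∇J and ∇ψ -/

section PointwiseAlgebra

variable {V : Type*} [NormedAddCommGroup V] [NormedSpace ℝ V]
  {g : V →L[ℝ] V →L[ℝ] ℝ} {J : V →L[ℝ] V} {ψ : V →L[ℝ] V →L[ℝ] V →L[ℝ] ℂ}

/-- The Nijenhuis-type expression of a derivative `A` of `J`. -/
def nij (J : V →L[ℝ] V) (A : V → V →L[ℝ] V) (X Y : V) : V :=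
  A X Y + J (A (J X) Y) - A Y X - J (A (J Y) X)

/-- The right side is i Θ(X + iJX, Y + iJY, Z, W) for the complex extension of Θ, that is, dψ with
two (0,1)-vectors inserted. The differentiated type condition `hP` moves `J` out of every term at
the cost of a derivative of `J`, and what survives is `nij`, which is `J` applied to the Nijenhuis
tensor. Since `A` and `P` are arbitrary, the lemma serves for coordinate derivatives as well as for
∇J and ∇ψ. -/
theorem psi_nij (h : IsLinearSU3 g J ψ) (A : V → V →L[ℝ] V)
    (P : V → V →L[ℝ] V →L[ℝ] V →L[ℝ] ℂ)
   
    (hP : ∀ X u v w, P X (J u) v w + ψ (A X u) v w = Complex.I * P X u v w)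
    (Θ : V → V → V → V → ℂ)
    (hΘ : ∀ X Y Z W, Θ X Y Z W = P X Y Z W - P Y X Z W + P Z X Y W - P W X Y Z)
    (X Y Z W : V) :
    ψ (nij J A X Y) Z W = Complex.I * (Θ X Y Z W - Θ (J X) (J Y) Z W)
      - (Θ (J X) Y Z W + Θ X (J Y) Z W) := by
  have hI := Complex.I_mul_I
  simp only [nij, hΘ, map_add, map_sub, add_apply, sub_apply, h.J_left]
  have a1 := hP X Y Z W
  have a2 := hP (J X) Y Z W
  have a3 := hP Y X Z W
  have a4 := hP (J Y) X Z W
  have b1 := hP Z X Y W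
  have b2 := hP Z X (J Y) W
  have c1 := hP W X Y Z
  have c2 := hP W X (J Y) Z
  rw [h.J_mid] at b2 c2
  linear_combination a1 + Complex.I * a2 - a3 - Complex.I * a4 + b1 + Complex.I * b2 - c1
    - Complex.I * c2 + (ψ (A W X) Y Z - ψ (A Z X) Y W + P (J X) Y Z W + P Z X (J Y) W
    - P (J Y) X Z W - P W X (J Y) Z) * hI

/-- For a form of type (1,1) the (3,0)+(0,3) part of its exterior derivative involves no derivative
of the form itself, only its contraction with the Nijenhuis tensor. Closedness makes this
contraction vanish. -/
theorem cyclic_nij (h : IsLinearSU3 g J ψ) (A : V → V →L[ℝ] V)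
    (hA : ∀ X Y, A X (J Y) = -J (A X Y))
    (π : V →L[ℝ] V →L[ℝ] ℝ) (hπ : ∀ u v, π u v = -π v u) (hJ : ∀ u v, π (J u) (J v) = π u v)
    (B : V → V →L[ℝ] V →L[ℝ] ℝ)
    (hB : ∀ X u v, B X (J u) (J v) + π (A X u) (J v) + π (J u) (A X v) = B X u v)
    (hd : ∀ X Y Z, B X Y Z + B Y Z X + B Z X Y = 0) (X Y Z : V) :
    π (J (nij J A X Y)) Z + π (J (nij J A Y Z)) X + π (J (nij J A Z X)) Y = 0 := by
  have hJ' : ∀ u v, π u (J v) = -π (J u) v := fun u v => by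
    rw [← hJ u (J v), h.J_J, map_neg]
  -- Summed cyclically, the left side is dπ(X, Y, Z) minus the three values of dπ with `J` in two
  -- slots, i.e. four times the (3,0)+(0,3) projection. The differentiated invariance `hB` trades it
  -- for derivatives of `J`.
  have key : ∀ X Y Z, B X Y Z - B X (J Y) (J Z) - B (J X) (J Y) Z - B (J X) Y (J Z) =
      π (A X Y) (J Z) + π (J Y) (A X Z) + π (A (J X) Y) Z + π Y (A (J X) Z) := by
    intro X Y Z
    have h1 := hB X Y Z
    have h2 := hB (J X) (J Y) Z
    rw [h.J_J, hA, hJ', map_neg π, map_neg (B _)] at h2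
    simp only [neg_apply, map_neg, h.J_J] at h2
    linarith
  have k1 := key X Y Z
  have k2 := key Y Z X
  have k3 := key Z X Y
  have d1 := hd X Y Z
  have d2 := hd (J X) (J Y) Z
  have d3 := hd (J X) Y (J Z)
  have d4 := hd X (J Y) (J Z)
  simp only [nij, map_add, map_sub, add_apply, sub_apply, h.J_J, neg_apply, map_neg]
  simp only [hJ'] at k1 k2 k3
  linarith [hπ (A X Z) (J Y), hπ (A Y X) (J Z), hπ (A Z Y) (J X), hJ' (A X Z) Y, hJ' (A Y X) Z,
    hJ' (A Z Y) X, hπ (A (J X) Z) Y, hπ (A (J Y) X) Z, hπ (A (J Z) Y) X]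

/-- The complex coordinates of a vector in a unitary frame. -/
def cplxCoord (g : V →L[ℝ] V →L[ℝ] ℝ) (J : V →L[ℝ] V) (e : Fin 3 → V) (v : V) (i : Fin 3) : ℂ :=
  g v (e i) + Complex.I * g v (J (e i))

theorem IsAdaptedFrame.apply_eq {e : Fin 3 → V} (he : IsAdaptedFrame g J ψ e) (L : V →L[ℝ] ℂ)
    (hL : ∀ v, L (J v) = Complex.I * L v) (v : V) :
    L v = ∑ i, cplxCoord g J e v i * L (e i) := by
  conv_lhs => rw [he.expand v]
  simp only [map_sum, map_add, map_smul, hL, cplxCoord, Complex.real_smul]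
  exact Finset.sum_congr rfl fun i _ => by ring

/-- Contracting with ψ and two frame vectors reads off the remaining complex coordinate. This is how
knowledge of ψ(N, ·, ·) becomes knowledge of N. -/
theorem IsAdaptedFrame.cplxCoord_eq_psi (h : IsLinearSU3 g J ψ) {e : Fin 3 → V}
    (he : IsAdaptedFrame g J ψ e) (v : V) :
    cplxCoord g J e v 0 = ψ v (e 1) (e 2) ∧ cplxCoord g J e v 1 = -ψ v (e 0) (e 2) ∧
      cplxCoord g J e v 2 = ψ v (e 0) (e 1) := by
  have H : ∀ a b, ψ v a b = ∑ i, cplxCoord g J e v i * ψ (e i) a b := fun a b =>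
    he.apply_eq ((ContinuousLinearMap.apply ℝ ℂ b).comp ((ContinuousLinearMap.apply ℝ _ a).comp ψ))
      (fun u => by simpa using h.J_left u a b) v
  have h1 := he.psi_e
  have h2 : ψ (e 1) (e 0) (e 2) = -1 := by rw [h.swap_left, he.psi_e]
  have h3 : ψ (e 2) (e 0) (e 1) = 1 := by rw [h.swap_left, h.swap_right, he.psi_e, neg_neg]
  have h4 : ∀ a b, ψ a b a = 0 := fun a b => by rw [h.swap_left, h.self_right, neg_zero]
  rw [H, H, H]
  simp [Fin.sum_univ_three, h.self_left, h1, h2, h3, h4]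

theorem IsAdaptedFrame.apply_eq_re_im (h : IsLinearSU3 g J ψ) {e : Fin 3 → V}
    (he : IsAdaptedFrame g J ψ e) (L : V →L[ℝ] ℝ) (v : V) :
    L v = (ψ v (e 1) (e 2)).re * L (e 0) + (ψ v (e 1) (e 2)).im * L (J (e 0))
      - (ψ v (e 0) (e 2)).re * L (e 1) - (ψ v (e 0) (e 2)).im * L (J (e 1))
      + (ψ v (e 0) (e 1)).re * L (e 2) + (ψ v (e 0) (e 1)).im * L (J (e 2)) := by
  obtain ⟨h0, h1, h2⟩ := he.cplxCoord_eq_psi h v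
  have r : ∀ i, (cplxCoord g J e v i).re = g v (e i) := by simp [cplxCoord]
  have m : ∀ i, (cplxCoord g J e v i).im = g v (J (e i)) := by simp [cplxCoord]
  have h1' : ψ v (e 0) (e 2) = -cplxCoord g J e v 1 := by rw [h1, neg_neg]
  rw [← h0, ← h2, h1']
  conv_lhs => rw [he.expand v]
  simp only [Fin.sum_univ_three, map_add, map_smul, smul_eq_mul, r, m, Complex.neg_re,
    Complex.neg_im]
  ring

/-- A primitive `(1,1)`-form `π` vanishes if `dψ = -π ∧ ω` and `dπ = 0`. -/
theorem torsionForm_eq_zero (h : IsLinearSU3 g J ψ) {e : Fin 3 → V}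
    (he : IsAdaptedFrame g J ψ e) (A : V → V →L[ℝ] V)
    (hA : ∀ X Y, A X (J Y) = -J (A X Y))
    (P : V → V →L[ℝ] V →L[ℝ] V →L[ℝ] ℂ)
    (hP : ∀ X u v w, P X (J u) v w + ψ (A X u) v w = Complex.I * P X u v w)
    (π : V →L[ℝ] V →L[ℝ] ℝ) (hπ : ∀ u v, π u v = -π v u) (hJ : ∀ u v, π (J u) (J v) = π u v)
    (B : V → V →L[ℝ] V →L[ℝ] ℝ)
    (hB : ∀ X u v, B X (J u) (J v) + π (A X u) (J v) + π (J u) (A X v) = B X u v)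
    (hdπ : ∀ X Y Z, B X Y Z + B Y Z X + B Z X Y = 0)
    (hdψ : ∀ X Y Z W, P X Y Z W - P Y X Z W + P Z X Y W - P W X Y Z =
      ((-(π X Y * g (J Z) W - π X Z * g (J Y) W + π X W * g (J Y) Z + π Y Z * g (J X) W
        - π Y W * g (J X) Z + π Z W * g (J X) Y) : ℝ) : ℂ))
    (htr : π (e 0) (J (e 0)) + π (e 1) (J (e 1)) + π (e 2) (J (e 2)) = 0) : π = 0 := by
  have hJ' : ∀ u v, π (J u) v = -π u (J v) := fun u v => by
    rw [← hJ u (J v), h.J_J, map_neg, neg_neg]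
  have hq : ∀ u v, π u (J v) = π v (J u) := fun u v => by rw [hπ, hJ', neg_neg]
  have hz : ∀ u, π u u = 0 := fun u => by linarith [hπ u u]
  have N := psi_nij h A P hP _ fun X Y Z W => (hdψ X Y Z W).symm
  -- This single triple suffices. Each Nijenhuis vector in it is expanded in the adapted frame, its
  -- coordinates being values of ψ(N, ·, ·), which `psi_nij` expresses through π and ω.
  have K := cyclic_nij h A hA π hπ hJ B hB hdπ (J (e 0)) (e 1) (e 2)
  have gJ : ∀ i j, g (e i) (J (e j)) = 0 := fun i j => by rw [h.symm]; exact he.g_Je_e _ _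
  have hL : ∀ v Z, π (J v) Z = (-((ContinuousLinearMap.apply ℝ ℝ (J Z)).comp π)) v := fun v Z => by
    simp [hJ']
  have re : ∀ X Y Z W, (ψ (nij J A X Y) Z W).re = _ := fun X Y Z W =>
    congrArg Complex.re (N X Y Z W)
  have im : ∀ X Y Z W, (ψ (nij J A X Y) Z W).im = _ := fun X Y Z W =>
    congrArg Complex.im (N X Y Z W)
  simp only [Complex.sub_re, Complex.add_re, Complex.sub_im, Complex.add_im, Complex.mul_re,
    Complex.mul_im, Complex.I_re, Complex.I_im, Complex.ofReal_re, Complex.ofReal_im] at re im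
  rw [hL, hL, hL, he.apply_eq_re_im h, he.apply_eq_re_im h _ (nij J A (e 1) (e 2)),
    he.apply_eq_re_im h _ (nij J A (e 2) (J (e 0)))] at K
  simp only [re, im] at K
  simp [hJ', h.J_J, gJ, he.g_Je_e, he.g_e_e, h.g_J_J, hz, hπ (e 1) (e 0), hπ (e 2) (e 0),
    hπ (e 2) (e 1), hq (e 1) (e 0), hq (e 2) (e 0), hq (e 2) (e 1)] at K
  -- After the substitution `K` says that this sum of squares equals the square of the trace of π,
  -- which is zero by `htr`. The nine numbers squared here determine a J-invariant 2-form.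
  have sq : π (e 0) (J (e 0)) ^ 2 + π (e 1) (J (e 1)) ^ 2 + π (e 2) (J (e 2)) ^ 2
      + 2 * (π (e 0) (e 1) ^ 2 + π (e 0) (e 2) ^ 2 + π (e 1) (e 2) ^ 2 + π (e 0) (J (e 1)) ^ 2
      + π (e 0) (J (e 2)) ^ 2 + π (e 1) (J (e 2)) ^ 2) = 0 := by
    linear_combination -K + (π (e 0) (J (e 0)) + π (e 1) (J (e 1)) + π (e 2) (J (e 2))) * htr
  have s1 := sq_nonneg (π (e 0) (J (e 0)))
  have s2 := sq_nonneg (π (e 1) (J (e 1)))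
  have s3 := sq_nonneg (π (e 2) (J (e 2)))
  have s4 := sq_nonneg (π (e 0) (e 1))
  have s5 := sq_nonneg (π (e 0) (e 2))
  have s6 := sq_nonneg (π (e 1) (e 2))
  have s7 := sq_nonneg (π (e 0) (J (e 1)))
  have s8 := sq_nonneg (π (e 0) (J (e 2)))
  have s9 := sq_nonneg (π (e 1) (J (e 2)))
  have z1 : π (e 0) (J (e 0)) = 0 := pow_eq_zero_iff two_ne_zero |>.1 (by linarith)
  have z2 : π (e 1) (J (e 1)) = 0 := pow_eq_zero_iff two_ne_zero |>.1 (by linarith)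
  have z3 : π (e 2) (J (e 2)) = 0 := pow_eq_zero_iff two_ne_zero |>.1 (by linarith)
  have z4 : π (e 0) (e 1) = 0 := pow_eq_zero_iff two_ne_zero |>.1 (by linarith)
  have z5 : π (e 0) (e 2) = 0 := pow_eq_zero_iff two_ne_zero |>.1 (by linarith)
  have z6 : π (e 1) (e 2) = 0 := pow_eq_zero_iff two_ne_zero |>.1 (by linarith)
  have z7 : π (e 0) (J (e 1)) = 0 := pow_eq_zero_iff two_ne_zero |>.1 (by linarith)
  have z8 : π (e 0) (J (e 2)) = 0 := pow_eq_zero_iff two_ne_zero |>.1 (by linarith)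
  have z9 : π (e 1) (J (e 2)) = 0 := pow_eq_zero_iff two_ne_zero |>.1 (by linarith)
  ext u v
  rw [he.expand u, he.expand v]
  simp [Fin.sum_univ_three, hJ', h.J_J, hz, hπ (e 1) (e 0), hπ (e 2) (e 0), hπ (e 2) (e 1),
    hq (e 1) (e 0), hq (e 2) (e 0), hq (e 2) (e 1), z1, z2, z3, z4, z5, z6, z7, z8, z9]

/-- The determinant of the complex coordinates of three vectors. -/
def coordDet (g : V →L[ℝ] V →L[ℝ] ℝ) (J : V →L[ℝ] V) (e : Fin 3 → V) (u v w : V) : ℂ :=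
  (Matrix.of ![cplxCoord g J e u, cplxCoord g J e v, cplxCoord g J e w]).det

/-- An alternating complex trilinear form on a complex 3-space is a multiple of the determinant. It
is applied to ψ and later to ∇_X ψ. -/
theorem IsAdaptedFrame.volume_eq_coordDet {e : Fin 3 → V} (he : IsAdaptedFrame g J ψ e)
    {φ : V →L[ℝ] V →L[ℝ] V →L[ℝ] ℂ} (h : IsComplexVolume J φ) (u v w : V) :
    φ u v w = coordDet g J e u v w * φ (e 0) (e 1) (e 2) := by
  have H1 : ∀ u v w, φ u v w = ∑ i, cplxCoord g J e u i * φ (e i) v w := fun u v w =>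
    he.apply_eq ((ContinuousLinearMap.apply ℝ ℂ w).comp ((ContinuousLinearMap.apply ℝ _ v).comp φ))
      (fun x => by simpa using h.J_left x v w) u
  have H2 : ∀ u v w, φ u v w = ∑ i, cplxCoord g J e v i * φ u (e i) w := fun u v w =>
    he.apply_eq ((ContinuousLinearMap.apply ℝ ℂ w).comp (φ u))
      (fun x => by simpa using h.J_mid u x w) v
  have H3 : ∀ u v w, φ u v w = ∑ i, cplxCoord g J e w i * φ u v (e i) := fun u v w =>
    he.apply_eq (φ u v) (fun x => by simpa using h.J_right u v x) w
  have h2 : φ (e 1) (e 0) (e 2) = -φ (e 0) (e 1) (e 2) := by rw [h.swap_left]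
  have h3 : φ (e 2) (e 0) (e 1) = φ (e 0) (e 1) (e 2) := by
    rw [h.swap_left, h.swap_right, neg_neg]
  have h5 : φ (e 0) (e 2) (e 1) = -φ (e 0) (e 1) (e 2) := by rw [h.swap_right]
  have h6 : φ (e 1) (e 2) (e 0) = φ (e 0) (e 1) (e 2) := by rw [h.swap_right, h2, neg_neg]
  have h7 : φ (e 2) (e 1) (e 0) = -φ (e 0) (e 1) (e 2) := by rw [h.swap_right, h3]
  have h4 : ∀ a b, φ a b a = 0 := fun a b => by rw [h.swap_left, h.self_right, neg_zero]
  rw [H1 u]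
  simp only [Fin.sum_univ_three]
  rw [H2 _ v, H2 _ v, H2 _ v]
  simp only [Fin.sum_univ_three, h.self_left]
  rw [H3 _ _ w, H3 _ _ w, H3 _ _ w, H3 _ _ w, H3 _ _ w, H3 _ _ w]
  simp only [Fin.sum_univ_three, h.self_right, h4, h2, h3, h5, h6, h7, coordDet,
    Matrix.det_fin_three]
  simp
  ring

/-- The Hermitian product `g(u, v) - i g(Ju, v)`. -/
def herm (g : V →L[ℝ] V →L[ℝ] ℝ) (J : V →L[ℝ] V) (u v : V) : ℂ :=
  g u v - Complex.I * g (J u) v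

/-- The Hermitian Gram matrix of three vectors. -/
def hermGram (g : V →L[ℝ] V →L[ℝ] ℝ) (J : V →L[ℝ] V) (x : Fin 3 → V) : Matrix (Fin 3) (Fin 3) ℂ :=
  Matrix.of fun i j => herm g J (x i) (x j)

theorem IsAdaptedFrame.herm_eq (h : IsLinearSU3 g J ψ) {e : Fin 3 → V}
    (he : IsAdaptedFrame g J ψ e) (u v : V) :
    herm g J u v = ∑ i, cplxCoord g J e u i * star (cplxCoord g J e v i) := by
  have H : ∀ L : V →L[ℝ] ℝ, L v = ∑ i, (g v (e i) * L (e i) + g v (J (e i)) * L (J (e i))) := by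
    intro L
    conv_lhs => rw [he.expand v]
    simp
  rw [herm, H (g u), H (g (J u))]
  simp only [Fin.sum_univ_three, h.g_J_J, h.g_J_left u, cplxCoord]
  apply Complex.ext <;> simp <;> ring

/-- In an adapted frame ψ is the determinant of the coordinate matrix Z, and the Hermitian Gram
matrix is Z Z*. The unit norm condition, imposed only on unitary frames, thus becomes a formula for
arbitrary vectors that can be differentiated. -/
theorem normSq_psi_eq_det [FiniteDimensional ℝ V] (h : IsLinearSU3 g J ψ)
    (hV : Module.finrank ℝ V = 6) (u v w : V) :
    ((Complex.normSq (ψ u v w) : ℝ) : ℂ) = (hermGram g J ![u, v, w]).det := by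
  obtain ⟨e, he⟩ := h.exists_adaptedFrame hV
  rw [he.volume_eq_coordDet h.toIsComplexVolume, he.psi_e, mul_one, ← Complex.mul_conj, coordDet]
  set Z : Matrix (Fin 3) (Fin 3) ℂ :=
    Matrix.of ![cplxCoord g J e u, cplxCoord g J e v, cplxCoord g J e w]
  have : hermGram g J ![u, v, w] = Z * Z.conjTranspose := by
    ext i j
    rw [hermGram, Matrix.of_apply, he.herm_eq h, Matrix.mul_apply]
    fin_cases i <;> fin_cases j <;> rfl
  rw [this, Matrix.det_mul, Matrix.det_conjTranspose]
  rfl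

/-- A derivation `L` annihilating `ψ` and commuting with `J` satisfies `tr (J ∘ L) = 0`. -/
theorem trace_J_comp_eq_zero (h : IsLinearSU3 g J ψ) (hV : Module.finrank ℝ V = 6)
    {e : Fin 3 → V} (he : IsAdaptedFrame g J ψ e) (L : V →ₗ[ℝ] V)
    (hJ : ∀ u, L (J u) = J (L u))
    (hL : ∀ u v w, ψ (L u) v w + ψ u (L v) w + ψ u v (L w) = 0) :
    LinearMap.trace ℝ V (J.toLinearMap ∘ₗ L) = 0 ∧ LinearMap.trace ℝ V L = 0 := by
  have T : ∀ M : V →ₗ[ℝ] V, LinearMap.trace ℝ V M =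
      ∑ i, g (M (e i)) (e i) + ∑ i, g (M (J (e i))) (J (e i)) := by
    intro M
    rw [LinearMap.trace_eq_matrix_trace ℝ (h.unitaryBasis hV he.g_e_e he.g_Je_e), Matrix.trace]
    simp only [Matrix.diag, LinearMap.toMatrix_apply, h.coe_unitaryBasis, h.repr_unitaryBasis]
    simp [IsLinearSU3.realFrame]
  obtain ⟨h0, -, -⟩ := he.cplxCoord_eq_psi h (L (e 0))
  obtain ⟨-, h1, -⟩ := he.cplxCoord_eq_psi h (L (e 1))
  obtain ⟨-, -, h2⟩ := he.cplxCoord_eq_psi h (L (e 2))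
  -- On the adapted frame this says that the complex trace of `L` is zero. Its real and imaginary
  -- parts are, up to factors, the real traces of `L` and `J ∘ L`.
  have H := hL (e 0) (e 1) (e 2)
  rw [← h0, h.swap_left _ (L (e 1)), ← h1, h.swap_right _ _ (L (e 2)), h.swap_left _ (L (e 2)),
    neg_neg, ← h2] at H
  have hr := congrArg Complex.re H
  have hi := congrArg Complex.im H
  simp [cplxCoord] at hr hi
  constructor
  · rw [T]
    simp [Fin.sum_univ_three, hJ, h.g_J_J, h.g_J_left]
    linarith
  · rw [T]
    simp [Fin.sum_univ_three, hJ, h.g_J_J]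
    linarith

/-- Vanishing of the covariant derivative of `J`, from `dω = 0` and the `(0,2)`-part of `dψ`. -/
theorem covDeriv_J_eq_zero [FiniteDimensional ℝ V] (h : IsLinearSU3 g J ψ)
    (hV : Module.finrank ℝ V = 6)
    (A : V → V →L[ℝ] V)
    (hA : ∀ X Y, A X (J Y) = -J (A X Y)) (hskew : ∀ X u v, g (A X u) v = -g (A X v) u)
    (hN : ∀ X Y Z W, ψ (nij J A X Y) Z W = 0)
    (hdω : ∀ X Y Z, g (A X Y) Z + g (A Y Z) X + g (A Z X) Y = 0) (X : V) : A X = 0 := by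
  obtain ⟨e, he⟩ := h.exists_adaptedFrame hV
  have N0 : ∀ X Y, nij J A X Y = 0 := fun X Y => h.ext_g fun w => by
    have := he.apply_eq_re_im h (g w) (nij J A X Y)
    rw [h.symm, this]
    simp [hN]
  have hgJ : ∀ X Y Z, g (A X (J Y)) Z = g (A X Y) (J Z) := fun X Y Z => by
    rw [hA, map_neg, neg_apply, h.g_J_left, neg_neg]
  have S : ∀ X Y Z, g (A X Y) Z - g (A (J X) Y) (J Z) = g (A Y X) Z - g (A (J Y) X) (J Z) := by
    intro X Y Z
    have := congrArg (fun v => g v Z) (N0 X Y)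
    simp only [nij, map_add, map_sub, add_apply, sub_apply, map_zero, zero_apply,
      h.g_J_left] at this
    linarith
  -- The difference of the two sides is symmetric in X, Y by `S` and skew in Y, Z by `hskew` and
  -- `hgJ`; a trilinear form with both symmetries is zero.
  have C : ∀ X Y Z, g (A X Y) Z = g (A (J X) Y) (J Z) := by
    intro X Y Z
    have := S X Y Z
    have := S Y Z X
    have := S Z X Y
    have := hskew X Y Z
    have := hskew Y Z X
    have := hskew Z X Y
    have a1 := hskew (J X) Y (J Z)
    rw [hgJ] at a1
    have a2 := hskew (J Y) Z (J X)
    rw [hgJ] at a2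
    have a3 := hskew (J Z) X (J Y)
    rw [hgJ] at a3
    linarith
  refine ContinuousLinearMap.ext fun Y => h.ext_g fun Z => ?_
  rw [zero_apply, map_zero, zero_apply]
  -- Write a, b, c for the three terms of `d1`. By `c1`, `c2`, `e1` and `e2`, the identity `d2`
  -- reads -a + b + c = 0, and subtracting it from a + b + c = 0 leaves a = 0.
  have d1 := hdω X Y Z
  have d2 := hdω X (J Y) (J Z)
  have c1 := C Y Z X
  have c2 := C Z X Y
  have e1 : g (A X (J Y)) (J Z) = -g (A X Y) Z := by
    rw [hgJ, h.J_J, map_neg]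
  have e2 : g (A (J Y) (J Z)) X = g (A (J Y) Z) (J X) := hgJ _ _ _
  linarith

/-- Vanishing of the covariant derivative of `ψ` when `∇J = 0` and `dψ = 0`. -/
theorem covDeriv_psi_eq_zero [FiniteDimensional ℝ V] (h : IsLinearSU3 g J ψ)
    (hV : Module.finrank ℝ V = 6) (P : V → V →L[ℝ] V →L[ℝ] V →L[ℝ] ℂ)
    (hP : ∀ X, IsComplexVolume J (P X))
    (hd : ∀ X Y Z W, P X Y Z W - P Y X Z W + P Z X Y W - P W X Y Z = 0)
    (hnorm : ∀ X u v w, (star (ψ u v w) * P X u v w).re = 0) (X : V) : P X = 0 := by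
  obtain ⟨e, he⟩ := h.exists_adaptedFrame hV
  -- Replacing X by JX in dψ = 0 multiplies three of the four terms by i, because each `P Y` is of
  -- type (3,0); hence the fourth is multiplied by i too.
  have hJ : ∀ X u v w, P (J X) u v w = Complex.I * P X u v w := by
    intro X u v w
    have d1 := hd X u v w
    have d2 := hd (J X) u v w
    have d3 := hd X u v w
    rw [(hP u).J_left, (hP v).J_left, (hP w).J_left] at d2
    linear_combination d2 - Complex.I * d1
  -- As ψ = 1 on the frame, the value of `P X` there and i times this value both have zero real
  -- part.
  have n1 := hnorm X (e 0) (e 1) (e 2)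
  have n2 := hnorm (J X) (e 0) (e 1) (e 2)
  rw [hJ] at n2
  simp [he.psi_e] at n1 n2
  have hz : P X (e 0) (e 1) (e 2) = 0 := Complex.ext n1 n2
  ext u v w
  rw [he.volume_eq_coordDet (hP X), hz, mul_zero]
  rfl

end PointwiseAlgebra

/-! ### Curvature tensors with values in 𝔰𝔲(3) -/

section CurvatureAlgebra

variable {V : Type*} [NormedAddCommGroup V] [NormedSpace ℝ V]
  {g : V →L[ℝ] V →L[ℝ] ℝ} {J : V →L[ℝ] V} {ψ : V →L[ℝ] V →L[ℝ] V →L[ℝ] ℂ}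

/-- The pair symmetry `g(R(X, Y)Z, W) = g(R(Z, W)X, Y)` of an algebraic curvature tensor. -/
theorem pair_symm {R : V →ₗ[ℝ] V →ₗ[ℝ] V →ₗ[ℝ] V} (hs : ∀ u v, g u v = g v u)
    (ha : ∀ X Y Z, R X Y Z = -R Y X Z)
    (hb : ∀ X Y Z, R X Y Z + R Y Z X + R Z X Y = 0)
    (hg : ∀ X Y u v, g (R X Y u) v + g u (R X Y v) = 0) (X Y Z W : V) :
    g (R X Y Z) W = g (R Z W X) Y := by
  have A : ∀ X Y Z W, g (R X Y Z) W = -g (R Y X Z) W := fun X Y Z W => by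
    rw [ha, map_neg, neg_apply]
  have G : ∀ X Y Z W, g (R X Y Z) W = -g (R X Y W) Z := fun X Y Z W => by
    have := hg X Y Z W
    rw [hs Z] at this
    linarith
  have B : ∀ X Y Z W, g (R X Y Z) W + g (R Y Z X) W + g (R Z X Y) W = 0 := fun X Y Z W => by
    have := congrArg (fun v => g v W) (hb X Y Z)
    simpa using this
  linarith [B X Y Z W, B Y Z W X, B Z W X Y, B W X Y Z, G X Y Z W, G Y Z X W, G Z X Y W,
    G Y Z W X, G Z W Y X, G W Y Z X, G Z W X Y, G W X Z Y, G X Z W Y, G W X Y Z, G X Y W Z,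
    G Y W X Z, A X Y Z W, A Y Z X W, A Z X Y W, A Y Z W X, A Z W Y X, A W Y Z X, A Z W X Y,
    A W X Z Y, A X Z W Y, A W X Y Z, A X Y W Z, A Y W X Z]

/-- An algebraic curvature tensor with values in `𝔰𝔲(3)` is Ricci-flat. -/
theorem ricci_eq_zero_of_su3 [FiniteDimensional ℝ V] (h : IsLinearSU3 g J ψ)
    (hV : Module.finrank ℝ V = 6) {R : V →ₗ[ℝ] V →ₗ[ℝ] V →ₗ[ℝ] V}
    (ha : ∀ X Y Z, R X Y Z = -R Y X Z)
    (hb : ∀ X Y Z, R X Y Z + R Y Z X + R Z X Y = 0)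
    (hg : ∀ X Y u v, g (R X Y u) v + g u (R X Y v) = 0)
    (hω : ∀ X Y u v, g (J (R X Y u)) v + g (J u) (R X Y v) = 0)
    (hψ : ∀ X Y u v w, ψ (R X Y u) v w + ψ u (R X Y v) w + ψ u v (R X Y w) = 0) (Y Z : V) :
    LinearMap.trace ℝ V ((R.flip Y).flip Z) = 0 := by
  obtain ⟨e, he⟩ := h.exists_adaptedFrame hV
  have hJ : ∀ X Y u, R X Y (J u) = J (R X Y u) := fun X Y u => h.ext_g fun v => by
    linarith [hω X Y u v, hg X Y (J u) v]
  have tr := fun X Y => trace_J_comp_eq_zero h hV he (R X Y) (hJ X Y) (hψ X Y)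
  -- Pair symmetry turns the arguments X, Y into the slots on which R acts by an endomorphism
  -- commuting with `J`, where the two copies of `J` cancel by orthogonality.
  have hRJ : ∀ X Y Z, R (J X) (J Y) Z = R X Y Z := fun X Y Z => h.ext_g fun W => by
    rw [pair_symm h.symm ha hb hg, hJ, h.g_J_J, ← pair_symm h.symm ha hb hg]
  have hRJ' : ∀ X Y Z, R X (J Y) Z = -R (J X) Y Z := fun X Y Z => by
    rw [← hRJ X (J Y), h.J_J, map_neg, LinearMap.neg_apply]
  set ric : V → V → ℝ := fun Y Z => LinearMap.trace ℝ V ((R.flip Y).flip Z) with hric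
  -- By the Bianchi identity the skew part is minus the trace of R(Y, Z), which vanishes.
  have symm : ∀ Y Z, ric Y Z = ric Z Y := by
    intro Y Z
    have : (R.flip Y).flip Z - (R.flip Z).flip Y = -R Y Z := by
      ext X
      have h1 := hb X Y Z
      have h2 := ha Z X Y
      simp only [LinearMap.sub_apply, LinearMap.neg_apply, LinearMap.flip_apply]
      rw [h2] at h1
      linear_combination (norm := module) h1
    have t := congrArg (LinearMap.trace ℝ V) this
    rw [map_sub, map_neg, (tr Y Z).2, neg_zero, sub_eq_zero] at t
    exact t
  have jinv : ∀ Y Z, ric (J Z) (J Y) = ric Z Y := by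
    intro Y Z
    have : (R.flip (J Z)).flip (J Y) =
        -(J.toLinearMap ∘ₗ ((R.flip Z).flip Y ∘ₗ J.toLinearMap)) := by
      ext X
      simp [hJ, hRJ']
    simp only [hric, this, map_neg]
    rw [LinearMap.trace_comp_comm' ((R.flip Z).flip Y ∘ₗ J.toLinearMap) J.toLinearMap,
      LinearMap.comp_assoc,
      show J.toLinearMap ∘ₗ J.toLinearMap = -LinearMap.id from LinearMap.ext h.J_J]
    simp
  -- Applying `J` to the Bianchi identity for X, Y, JZ exhibits the sum as the trace of `J ∘ R(Y,
  -- JZ)`, which vanishes. By `jinv` and `symm` the same sum is twice the Ricci form.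
  have main : ric Y Z + ric (J Z) (J Y) = 0 := by
    have : (R.flip Y).flip Z + (R.flip (J Z)).flip (J Y) = J.toLinearMap ∘ₗ R Y (J Z) := by
      ext X
      have h1 := congrArg J (hb X Y (J Z))
      have h2 := ha (J Z) X Y
      simp only [map_add, hJ, h.J_J, map_zero, h2, map_neg] at h1
      simp only [LinearMap.add_apply, LinearMap.flip_apply, LinearMap.comp_apply, hJ,
        ContinuousLinearMap.coe_coe]
      linear_combination (norm := module) -h1
    have t := congrArg (LinearMap.trace ℝ V) this
    rwa [map_add, (tr _ _).1] at t
  have := jinv Y Z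
  have := symm Y Z
  change ric Y Z = 0
  linarith

end CurvatureAlgebra

/-! ### Differentiating the algebraic identities on an open set -/

section LocalAnalysis

variable {V : Type*} [NormedAddCommGroup V] [NormedSpace ℝ V]
  {F : Type*} [NormedAddCommGroup F] [NormedSpace ℝ F]

theorem hasDerivAt_line {f : V → F} {z : V} (hf : DifferentiableAt ℝ f z) (X : V) :
    HasDerivAt (fun t : ℝ => f (z + t • X)) (fderiv ℝ f z X) 0 := by
  have h1 : HasDerivAt (fun t : ℝ => z + t • X) X 0 := by
    simpa using ((hasDerivAt_id (0 : ℝ)).smul_const X).const_add z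
  have h2 : HasFDerivAt f (fderiv ℝ f z) (z + (0 : ℝ) • X) := by simpa using hf.hasFDerivAt
  exact h2.comp_hasDerivAt 0 h1

/-- The tool behind the differentiated identities below: both sides of an identity valid on `U` are
differentiated at t = 0 along z + tX, and they need to agree only while this line stays in `U`. -/
theorem hasDerivAt_unique_line {U : Set V} (hU : IsOpen U) {z : V} (hz : z ∈ U) (X : V)
    {f k : ℝ → F} {a b : F} (hf : HasDerivAt f a 0) (hk : HasDerivAt k b 0)
    (h : ∀ t, z + t • X ∈ U → f t = k t) : a = b := by
  refine hf.unique (hk.congr_of_eventuallyEq ?_)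
  have hc : ContinuousAt (fun t : ℝ => z + t • X) 0 := by fun_prop
  have : ∀ᶠ t in nhds (0 : ℝ), z + t • X ∈ U :=
    hc.eventually (by simpa using hU.mem_nhds hz)
  exact this.mono fun t ht => h t ht

/-- A smooth `SU(3)`-structure on an open subset of a vector space. -/
structure IsLocalSU3 (U : Set V) (G : V → V →L[ℝ] V →L[ℝ] ℝ) (J : V → V →L[ℝ] V)
    (Ψ : V → V →L[ℝ] V →L[ℝ] V →L[ℝ] ℂ) : Prop where
  isOpen : IsOpen U
  smooth_g : ContDiffOn ℝ ∞ G U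
  smooth_J : ContDiffOn ℝ ∞ J U
  smooth_psi : ContDiffOn ℝ ∞ Ψ U
  linear : ∀ z ∈ U, IsLinearSU3 (G z) (J z) (Ψ z)

theorem differentiableAt_of_smoothOn {U : Set V} (hU : IsOpen U) {f : V → F}
    (hf : ContDiffOn ℝ ∞ f U) {z : V} (hz : z ∈ U) : DifferentiableAt ℝ f z :=
  (hf.contDiffAt (hU.mem_nhds hz)).differentiableAt (by simp)

namespace IsLocalSU3

variable {U : Set V} {G : V → V →L[ℝ] V →L[ℝ] ℝ} {J : V → V →L[ℝ] V}
    {Ψ : V → V →L[ℝ] V →L[ℝ] V →L[ℝ] ℂ}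

theorem line_g (h : IsLocalSU3 U G J Ψ) {z : V} (hz : z ∈ U) (X : V) :
    HasDerivAt (fun t : ℝ => G (z + t • X)) (fderiv ℝ G z X) 0 :=
  hasDerivAt_line (differentiableAt_of_smoothOn h.isOpen h.smooth_g hz) X

theorem line_J (h : IsLocalSU3 U G J Ψ) {z : V} (hz : z ∈ U) (X : V) :
    HasDerivAt (fun t : ℝ => J (z + t • X)) (fderiv ℝ J z X) 0 :=
  hasDerivAt_line (differentiableAt_of_smoothOn h.isOpen h.smooth_J hz) X

theorem line_psi (h : IsLocalSU3 U G J Ψ) {z : V} (hz : z ∈ U) (X : V) :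
    HasDerivAt (fun t : ℝ => Ψ (z + t • X)) (fderiv ℝ Ψ z X) 0 :=
  hasDerivAt_line (differentiableAt_of_smoothOn h.isOpen h.smooth_psi hz) X

theorem fderiv_J_J (h : IsLocalSU3 U G J Ψ) {z : V} (hz : z ∈ U) (X u : V) :
    fderiv ℝ J z X (J z u) = -J z (fderiv ℝ J z X u) := by
  have h1 := h.line_J hz X
  have h2 := h1.clm_apply (h1.clm_apply (hasDerivAt_const (0 : ℝ) u))
  have := hasDerivAt_unique_line h.isOpen hz X h2 (hasDerivAt_const (0 : ℝ) (-u))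
    fun t ht => (h.linear _ ht).J_J u
  simp at this
  exact eq_neg_of_add_eq_zero_left this

theorem fderiv_bilin_J (h : IsLocalSU3 U G J Ψ) {B : V → V →L[ℝ] V →L[ℝ] ℝ}
    (hB : ContDiffOn ℝ ∞ B U) (hBJ : ∀ z ∈ U, ∀ u v, B z (J z u) (J z v) = B z u v)
    {z : V} (hz : z ∈ U) (X u v : V) :
    fderiv ℝ B z X (J z u) (J z v) + B z (fderiv ℝ J z X u) (J z v)
      + B z (J z u) (fderiv ℝ J z X v) = fderiv ℝ B z X u v := by
  have h1 := h.line_J hz X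
  have hb := hasDerivAt_line (differentiableAt_of_smoothOn h.isOpen hB hz) X
  have hu := hasDerivAt_const (0 : ℝ) u
  have hv := hasDerivAt_const (0 : ℝ) v
  have := hasDerivAt_unique_line h.isOpen hz X
    ((hb.clm_apply (h1.clm_apply hu)).clm_apply (h1.clm_apply hv))
    ((hb.clm_apply hu).clm_apply hv) fun t ht => hBJ _ ht u v
  simpa using this

theorem fderiv_psi_J (h : IsLocalSU3 U G J Ψ) {z : V} (hz : z ∈ U) (X u v w : V) :
    fderiv ℝ Ψ z X (J z u) v w + Ψ z (fderiv ℝ J z X u) v w =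
      Complex.I * fderiv ℝ Ψ z X u v w := by
  have h1 := h.line_J hz X
  have hp := h.line_psi hz X
  have hu := hasDerivAt_const (0 : ℝ) u
  have hv := hasDerivAt_const (0 : ℝ) v
  have hw := hasDerivAt_const (0 : ℝ) w
  have := hasDerivAt_unique_line h.isOpen hz X
    (((hp.clm_apply (h1.clm_apply hu)).clm_apply hv).clm_apply hw)
    ((((hp.clm_apply hu).clm_apply hv).clm_apply hw).const_mul Complex.I)
    fun t ht => (h.linear _ ht).J_left u v w
  simpa using this

theorem fderiv_psi_self_left (h : IsLocalSU3 U G J Ψ) {z : V} (hz : z ∈ U) (X u w : V) :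
    fderiv ℝ Ψ z X u u w = 0 := by
  have hu := hasDerivAt_const (0 : ℝ) u
  have := hasDerivAt_unique_line h.isOpen hz X
    ((((h.line_psi hz X).clm_apply hu).clm_apply hu).clm_apply (hasDerivAt_const (0 : ℝ) w))
    (hasDerivAt_const (0 : ℝ) 0) fun t ht => (h.linear _ ht).self_left u w
  simpa using this

theorem fderiv_psi_self_right (h : IsLocalSU3 U G J Ψ) {z : V} (hz : z ∈ U) (X u v : V) :
    fderiv ℝ Ψ z X u v v = 0 := by
  have hv := hasDerivAt_const (0 : ℝ) v
  have := hasDerivAt_unique_line h.isOpen hz X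
    ((((h.line_psi hz X).clm_apply (hasDerivAt_const (0 : ℝ) u)).clm_apply hv).clm_apply hv)
    (hasDerivAt_const (0 : ℝ) 0) fun t ht => (h.linear _ ht).self_right u v
  simpa using this

/-- A smooth `π` with `dψ = -π ∧ ω` and `dπ = 0` vanishes, if it is of type `(1,1)` and trace-free
at the point considered. -/
theorem torsionForm_eq_zero (h : IsLocalSU3 U G J Ψ) {B : V → V →L[ℝ] V →L[ℝ] ℝ}
    (hB : ContDiffOn ℝ ∞ B U) (hBJ : ∀ z ∈ U, ∀ u v, B z (J z u) (J z v) = B z u v)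
    {z : V} (hz : z ∈ U) (hBs : ∀ u v, B z u v = -B z v u)
    {e : Fin 3 → V} (he : IsAdaptedFrame (G z) (J z) (Ψ z) e)
    (htr : B z (e 0) (J z (e 0)) + B z (e 1) (J z (e 1)) + B z (e 2) (J z (e 2)) = 0)
    (hdB : ∀ X Y Z, fderiv ℝ B z X Y Z + fderiv ℝ B z Y Z X + fderiv ℝ B z Z X Y = 0)
    (hdψ : ∀ X Y Z W, fderiv ℝ Ψ z X Y Z W - fderiv ℝ Ψ z Y X Z W + fderiv ℝ Ψ z Z X Y W
        - fderiv ℝ Ψ z W X Y Z =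
      ((-(B z X Y * G z (J z Z) W - B z X Z * G z (J z Y) W + B z X W * G z (J z Y) Z
        + B z Y Z * G z (J z X) W - B z Y W * G z (J z X) Z + B z Z W * G z (J z X) Y) : ℝ) : ℂ)) :
    B z = 0 :=
  SU3Geometry.torsionForm_eq_zero (h.linear z hz) he (fderiv ℝ J z)
    (h.fderiv_J_J hz) (fun X => fderiv ℝ Ψ z X) (h.fderiv_psi_J hz) (B z) hBs (hBJ z hz)
    (fun X => fderiv ℝ B z X) (h.fderiv_bilin_J hB hBJ hz) hdB hdψ htr

end IsLocalSU3

end LocalAnalysis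

/-! ### Parallelism of J and ψ for the Levi-Civita connection -/

section LeviCivita

variable {V : Type*} [NormedAddCommGroup V] [NormedSpace ℝ V]
  {F : Type*} [NormedAddCommGroup F] [NormedSpace ℝ F]

/-- The derivation action of an endomorphism on a trilinear form. -/
def trilinAct (φ : V →L[ℝ] V →L[ℝ] V →L[ℝ] F) (T : V →L[ℝ] V) : V →L[ℝ] V →L[ℝ] V →L[ℝ] F :=
  φ.comp T + ((ContinuousLinearMap.compL ℝ V V (V →L[ℝ] F)).flip T).comp φ +
    (ContinuousLinearMap.compL ℝ V (V →L[ℝ] F) (V →L[ℝ] F)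
      ((ContinuousLinearMap.compL ℝ V V F).flip T)).comp φ

theorem trilinAct_apply (φ : V →L[ℝ] V →L[ℝ] V →L[ℝ] F) (T : V →L[ℝ] V) (u v w : V) :
    trilinAct φ T u v w = φ (T u) v w + φ u (T v) w + φ u v (T w) := by
  simp [trilinAct]

/-- `Γ` is the (smooth) Christoffel map of the Levi-Civita connection of `G` on `U`. -/
structure IsChristoffel (U : Set V) (G : V → V →L[ℝ] V →L[ℝ] ℝ) (Γ : V → V →L[ℝ] V →L[ℝ] V) :
    Prop where
  smooth : ContDiffOn ℝ ∞ Γ U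
  symm : ∀ z ∈ U, ∀ X Y, Γ z X Y = Γ z Y X
  metric : ∀ z ∈ U, ∀ X u v, fderiv ℝ G z X u v = G z (Γ z X u) v + G z u (Γ z X v)

namespace IsLocalSU3

variable {U : Set V} {G : V → V →L[ℝ] V →L[ℝ] ℝ} {J : V → V →L[ℝ] V}
    {Ψ : V → V →L[ℝ] V →L[ℝ] V →L[ℝ] ℂ} {Γ : V → V →L[ℝ] V →L[ℝ] V}

/-- This is ∇J = 0. Because Γ is symmetric it cancels from the alternations defining dω and dψ, so
the pointwise lemmas apply with `A` = ∇J and `P` = ∇ψ in place of coordinate derivatives. -/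
theorem fderiv_J_eq [FiniteDimensional ℝ V] (h : IsLocalSU3 U G J Ψ) (hΓ : IsChristoffel U G Γ)
    (hV : Module.finrank ℝ V = 6) {z : V} (hz : z ∈ U)
    (hdω : ∀ X Y Z, fderiv ℝ G z X (J z Y) Z + G z (fderiv ℝ J z X Y) Z +
      (fderiv ℝ G z Y (J z Z) X + G z (fderiv ℝ J z Y Z) X) +
      (fderiv ℝ G z Z (J z X) Y + G z (fderiv ℝ J z Z X) Y) = 0)
    (hdψ : ∀ X Y Z W, fderiv ℝ Ψ z X Y Z W - fderiv ℝ Ψ z Y X Z W + fderiv ℝ Ψ z Z X Y W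
        - fderiv ℝ Ψ z W X Y Z = 0) (X u : V) :
    fderiv ℝ J z X u = J z (Γ z X u) - Γ z X (J z u) := by
  have hl := h.linear z hz
  set A : V → V →L[ℝ] V := fun X => fderiv ℝ J z X - (J z).comp (Γ z X) + (Γ z X).comp (J z)
    with hAdef
  have Aap : ∀ X u, A X u = fderiv ℝ J z X u - J z (Γ z X u) + Γ z X (J z u) := fun X u => rfl
  set P : V → V →L[ℝ] V →L[ℝ] V →L[ℝ] ℂ := fun X => fderiv ℝ Ψ z X - trilinAct (Ψ z) (Γ z X)
  have Pap : ∀ X u v w, P X u v w = fderiv ℝ Ψ z X u v w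
      - (Ψ z (Γ z X u) v w + Ψ z u (Γ z X v) w + Ψ z u v (Γ z X w)) := fun X u v w => by
    simp only [P, sub_apply, trilinAct_apply]
  have hA : ∀ X Y, A X (J z Y) = -J z (A X Y) := by
    intro X Y
    rw [Aap, Aap, h.fderiv_J_J hz, hl.J_J, map_neg, map_add, map_sub, hl.J_J]
    module
  have hP : ∀ X u v w, P X (J z u) v w + Ψ z (A X u) v w = Complex.I * P X u v w := by
    intro X u v w
    have := h.fderiv_psi_J hz X u v w
    simp only [Pap, Aap, map_add, map_sub, add_apply, sub_apply, hl.J_left]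
    linear_combination this
  have hN := psi_nij hl A P hP (fun _ _ _ _ => 0) fun X Y Z W => by
    simp only [Pap]
    have := hdψ X Y Z W
    rw [hΓ.symm z hz Y X, hΓ.symm z hz Z X, hΓ.symm z hz W X, hΓ.symm z hz Z Y,
      hΓ.symm z hz W Y, hΓ.symm z hz W Z]
    have s1 := hl.swap_left Y (Γ z X Z) W
    have s2 := hl.swap_left Y (Γ z X W) Z
    have s3 := hl.swap_right X (Γ z Y W) Z
    have s4 := hl.swap_right Y (Γ z X W) Z
    have s5 := hl.swap_right (Γ z X W) Y Z
    have s6 := hl.swap_right Z (Γ z X W) Y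
    have s7 := hl.swap_left Z (Γ z X W) Y
    have s8 := hl.swap_right X Z (Γ z Y W)
    rw [hl.swap_left Y (Γ z X Z) W, hl.swap_right Y Z (Γ z X W), hl.swap_left Y (Γ z X W) Z,
      hl.swap_right X Z (Γ z Y W)]
    linear_combination -this
  have hskew : ∀ X u v, G z (A X u) v = -G z (A X v) u := by
    intro X u v
    have := h.fderiv_bilin_J h.smooth_g (fun z hz => (h.linear z hz).g_J_J) hz X u (J z v)
    simp only [hl.J_J, h.fderiv_J_J hz, map_neg, hl.g_J_J, hΓ.metric z hz] at this
    rw [hl.symm _ u]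
    simp only [Aap, map_add, map_sub, add_apply, sub_apply]
    have a1 := hl.g_J_left u (Γ z X v)
    have a2 := hl.g_J_left (Γ z X u) v
    linarith
  have hd : ∀ X Y Z, G z (A X Y) Z + G z (A Y Z) X + G z (A Z X) Y = 0 := by
    intro X Y Z
    have := hdω X Y Z
    simp only [hΓ.metric z hz] at this
    simp only [Aap, map_add, map_sub, add_apply, sub_apply]
    rw [hΓ.symm z hz Y X, hΓ.symm z hz Z X, hΓ.symm z hz Z Y] at *
    have a1 := hl.g_J_left (Γ z X Y) Z
    have a2 := hl.g_J_left (Γ z Y Z) X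
    have a3 := hl.g_J_left (Γ z X Z) Y
    rw [hl.symm] at a1 a2 a3
    have b1 := hl.symm (J z Z) (Γ z X Y)
    have b2 := hl.symm (J z X) (Γ z Y Z)
    have b3 := hl.symm (J z Y) (Γ z X Z)
    have c1 := hl.symm (J z (Γ z X Y)) Z
    have c2 := hl.symm (J z (Γ z Y Z)) X
    have c3 := hl.symm (J z (Γ z X Z)) Y
    linarith
  have := congrArg (fun T => T u) (covDeriv_J_eq_zero hl hV A hA hskew
    (fun X Y Z W => by rw [hN]; simp) hd X)
  simp only [Aap, zero_apply] at this
  linear_combination (norm := module) this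

/-- The vectors u - tΓ(X, u) are parallel to first order along z + tX. As ∇g = 0 and ∇J = 0, the
Hermitian Gram matrix of three of them is stationary at t = 0, hence so is |ψ|² by
`normSq_psi_eq_det`; its derivative is twice the real part considered. -/
theorem re_star_psi_mul (h : IsLocalSU3 U G J Ψ) (hΓ : IsChristoffel U G Γ)
    [FiniteDimensional ℝ V] (hV : Module.finrank ℝ V = 6) {z : V} (hz : z ∈ U)
    (hJ : ∀ X u, fderiv ℝ J z X u = J z (Γ z X u) - Γ z X (J z u)) (X u v w : V) :
    (star (Ψ z u v w) * (fderiv ℝ Ψ z X - trilinAct (Ψ z) (Γ z X)) u v w).re = 0 := by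
  have hc : ∀ u, HasDerivAt (fun t : ℝ => u - t • Γ z X u) (-Γ z X u) 0 := fun u => by
    simpa using ((hasDerivAt_id (0 : ℝ)).smul_const (Γ z X u)).const_sub u
  have hψ := (((h.line_psi hz X).clm_apply (hc u)).clm_apply (hc v)).clm_apply (hc w)
  have hH : ∀ u v, HasDerivAt (fun t : ℝ => herm (G (z + t • X)) (J (z + t • X))
      (u - t • Γ z X u) (v - t • Γ z X v)) 0 0 := by
    intro u v
    have h1 := ((h.line_g hz X).clm_apply (hc u)).clm_apply (hc v)
    have h2 := ((h.line_g hz X).clm_apply ((h.line_J hz X).clm_apply (hc u))).clm_apply (hc v)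
    have h3 := h1.ofReal_comp.sub (h2.ofReal_comp.const_mul Complex.I)
    refine h3.congr_deriv ?_
    simp only [zero_smul, add_zero, sub_zero, add_apply, map_add, map_neg, neg_apply, hJ,
      map_sub, sub_apply, hΓ.metric z hz]
    push_cast
    ring
  set x : ℝ → Fin 3 → V := fun t =>
    ![u - t • Γ z X u, v - t • Γ z X v, w - t • Γ z X w] with hx
  have hM : ∀ i j, HasDerivAt (fun t : ℝ => hermGram (G (z + t • X)) (J (z + t • X)) (x t) i j)
      0 0 := by
    intro i j
    fin_cases i <;> fin_cases j <;> exact hH _ _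
  have hdet : HasDerivAt
      (fun t : ℝ => (hermGram (G (z + t • X)) (J (z + t • X)) (x t)).det) 0 0 := by
    simp only [Matrix.det_fin_three]
    have := (((((((hM 0 0).mul (hM 1 1)).mul (hM 2 2)).sub
      (((hM 0 0).mul (hM 1 2)).mul (hM 2 1))).sub
      (((hM 0 1).mul (hM 1 0)).mul (hM 2 2))).add
      (((hM 0 1).mul (hM 1 2)).mul (hM 2 0))).add
      (((hM 0 2).mul (hM 1 0)).mul (hM 2 1))).sub
      (((hM 0 2).mul (hM 1 1)).mul (hM 2 0))
    refine this.congr_deriv ?_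
    simp
  have hre := (Complex.reCLM.hasFDerivAt.comp_hasDerivAt (0 : ℝ) hψ)
  have him := (Complex.imCLM.hasFDerivAt.comp_hasDerivAt (0 : ℝ) hψ)
  have hns := (hre.mul hre).add (him.mul him)
  have hdr := (Complex.reCLM.hasFDerivAt.comp_hasDerivAt (0 : ℝ) hdet)
  have key := hasDerivAt_unique_line h.isOpen hz X hns hdr fun t ht => by
    have := congrArg Complex.re (normSq_psi_eq_det (h.linear _ ht) hV
      (u - t • Γ z X u) (v - t • Γ z X v) (w - t • Γ z X w))
    simpa [Complex.normSq_apply] using this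
  simp at key
  simp [trilinAct_apply]
  linarith

theorem fderiv_psi_eq [FiniteDimensional ℝ V] (h : IsLocalSU3 U G J Ψ) (hΓ : IsChristoffel U G Γ)
    (hV : Module.finrank ℝ V = 6) {z : V} (hz : z ∈ U)
    (hJ : ∀ X u, fderiv ℝ J z X u = J z (Γ z X u) - Γ z X (J z u))
    (hdψ : ∀ X Y Z W, fderiv ℝ Ψ z X Y Z W - fderiv ℝ Ψ z Y X Z W + fderiv ℝ Ψ z Z X Y W
        - fderiv ℝ Ψ z W X Y Z = 0) (X : V) :
    fderiv ℝ Ψ z X = trilinAct (Ψ z) (Γ z X) := by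
  have hl := h.linear z hz
  have Pap : ∀ X u v w, (fderiv ℝ Ψ z X - trilinAct (Ψ z) (Γ z X)) u v w = fderiv ℝ Ψ z X u v w
      - (Ψ z (Γ z X u) v w + Ψ z u (Γ z X v) w + Ψ z u v (Γ z X w)) := fun X u v w => by
    simp only [sub_apply, trilinAct_apply]
  rw [← sub_eq_zero]
  refine covDeriv_psi_eq_zero hl hV (fun X => fderiv ℝ Ψ z X - trilinAct (Ψ z) (Γ z X))
    (fun X => ⟨fun u w => ?_, fun u v => ?_, fun u v w => ?_⟩) (fun X Y Z W => ?_)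
    (h.re_star_psi_mul hΓ hV hz hJ) X
  · rw [Pap, h.fderiv_psi_self_left hz, hl.self_left, hl.swap_left u]
    ring
  · rw [Pap, h.fderiv_psi_self_right hz, hl.self_right, hl.swap_right u v (Γ z X v)]
    ring
  · have := h.fderiv_psi_J hz X u v w
    simp only [hJ, map_sub, sub_apply, hl.J_left] at this
    simp only [Pap, hl.J_left]
    linear_combination this
  · simp only [Pap]
    have := hdψ X Y Z W
    rw [hΓ.symm z hz Y X, hΓ.symm z hz Z X, hΓ.symm z hz W X, hΓ.symm z hz Z Y,
      hΓ.symm z hz W Y, hΓ.symm z hz W Z]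
    rw [hl.swap_left Y (Γ z X Z) W, hl.swap_right Y Z (Γ z X W), hl.swap_left Y (Γ z X W) Z,
      hl.swap_right X Z (Γ z Y W)]
    linear_combination this

end IsLocalSU3

/-! ### Curvature of the local connection -/

section Curvature

variable {U : Set V} {Γ : V → V →L[ℝ] V →L[ℝ] V}

/-- The curvature `R(X, Y)Z` of the connection with Christoffel map `Γ`. -/
def curv (Γ : V → V →L[ℝ] V →L[ℝ] V) (z : V) : V →ₗ[ℝ] V →ₗ[ℝ] V →ₗ[ℝ] V :=
  LinearMap.mk₂ ℝ (fun X Y => ((fderiv ℝ Γ z X Y - fderiv ℝ Γ z Y X + (Γ z X).comp (Γ z Y)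
    - (Γ z Y).comp (Γ z X) : V →L[ℝ] V) : V →ₗ[ℝ] V))
    (by intros; ext; simp; abel) (by intros; ext; simp [smul_sub, smul_add])
    (by intros; ext; simp; abel) (by intros; ext; simp [smul_sub, smul_add])

theorem curv_apply (z X Y Z : V) : curv Γ z X Y Z = fderiv ℝ Γ z X Y Z - fderiv ℝ Γ z Y X Z
    + Γ z X (Γ z Y Z) - Γ z Y (Γ z X Z) := rfl

theorem fderiv_fderiv_comm (hU : IsOpen U) {f : V → F} (hf : ContDiffOn ℝ ∞ f U) {z : V}
    (hz : z ∈ U) (X Y : V) : fderiv ℝ (fun w => fderiv ℝ f w Y) z X =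
      fderiv ℝ (fun w => fderiv ℝ f w X) z Y := by
  have hc := hf.contDiffAt (hU.mem_nhds hz)
  have hd : DifferentiableAt ℝ (fderiv ℝ f) z :=
    (hc.fderiv_right (m := ∞) (by simp)).differentiableAt (by simp)
  have := hc.isSymmSndFDerivAt (by simpa using ENat.LEInfty.out)
  have e : ∀ Y, fderiv ℝ (fun w => fderiv ℝ f w Y) z = (fderiv ℝ (fderiv ℝ f) z).flip Y := fun Y => by
    ext X
    simp [fderiv_clm_apply hd (differentiableAt_const Y)]
  rw [e, e]
  exact this X Y

/-- The Ricci identity: the second derivatives of B(u, v), computed by using the parallel equation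
twice, must commute, and their commutator is the action of the curvature on B. -/
theorem curv_bilin (hU : IsOpen U) (hΓ : ContDiffOn ℝ ∞ Γ U) {B : V → V →L[ℝ] V →L[ℝ] F}
    (hB : ContDiffOn ℝ ∞ B U)
    (h : ∀ z ∈ U, ∀ X u v, fderiv ℝ B z X u v = B z (Γ z X u) v + B z u (Γ z X v))
    {z : V} (hz : z ∈ U) (X Y u v : V) :
    B z (curv Γ z X Y u) v + B z u (curv Γ z X Y v) = 0 := by
  have hBd : ∀ w ∈ U, DifferentiableAt ℝ B w := fun w hw => differentiableAt_of_smoothOn hU hB hw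
  have hf : ContDiffOn ℝ ∞ (fun w => B w u v) U :=
    (hB.clm_apply contDiffOn_const).clm_apply contDiffOn_const
  have e1 : ∀ w ∈ U, ∀ X, fderiv ℝ (fun w => B w u v) w X =
      B w (Γ w X u) v + B w u (Γ w X v) := fun w hw X => by
    have := (hasDerivAt_unique_line hU hw X (((hasDerivAt_line (hBd w hw) X).clm_apply
      (hasDerivAt_const (0 : ℝ) u)).clm_apply (hasDerivAt_const (0 : ℝ) v))
      (hasDerivAt_line (differentiableAt_of_smoothOn hU hf hw) X) fun _ _ => rfl)
    rw [← this]
    simpa using h w hw X u v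
  have hf2 : ∀ Y, ContDiffOn ℝ ∞ (fun w => fderiv ℝ (fun w => B w u v) w Y) U := fun Y =>
    (hf.fderiv_of_isOpen hU (by simp)).clm_apply contDiffOn_const
  have e2 : ∀ X Y, fderiv ℝ (fun w => fderiv ℝ (fun w => B w u v) w Y) z X =
      (fderiv ℝ B z X (Γ z Y u) v + B z (fderiv ℝ Γ z X Y u) v)
        + (fderiv ℝ B z X u (Γ z Y v) + B z u (fderiv ℝ Γ z X Y v)) := by
    intro X Y
    have hb := hasDerivAt_line (hBd z hz) X
    have hg := hasDerivAt_line (differentiableAt_of_smoothOn hU hΓ hz) X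
    have hc : ∀ u : V, HasDerivAt (fun _ : ℝ => u) 0 0 := fun u => hasDerivAt_const 0 u
    have := hasDerivAt_unique_line hU hz X
      (hasDerivAt_line (differentiableAt_of_smoothOn hU (hf2 Y) hz) X)
      (((hb.clm_apply ((hg.clm_apply (hc Y)).clm_apply (hc u))).clm_apply (hc v)).add
        ((hb.clm_apply (hc u)).clm_apply ((hg.clm_apply (hc Y)).clm_apply (hc v))))
      fun t ht => e1 _ ht Y
    simpa using this
  have := fderiv_fderiv_comm hU hf hz X Y
  rw [e2, e2] at this
  simp only [h z hz] at this
  simp only [curv_apply, map_add, map_sub, add_apply, sub_apply]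
  linear_combination (norm := module) this

theorem curv_trilin (hU : IsOpen U) (hΓ : ContDiffOn ℝ ∞ Γ U)
    {B : V → V →L[ℝ] V →L[ℝ] V →L[ℝ] F} (hB : ContDiffOn ℝ ∞ B U)
    (h : ∀ z ∈ U, ∀ X, fderiv ℝ B z X = trilinAct (B z) (Γ z X))
    {z : V} (hz : z ∈ U) (X Y u v x : V) :
    B z (curv Γ z X Y u) v x + B z u (curv Γ z X Y v) x + B z u v (curv Γ z X Y x) = 0 := by
  have hBd : ∀ w ∈ U, DifferentiableAt ℝ B w := fun w hw => differentiableAt_of_smoothOn hU hB hw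
  have hf : ContDiffOn ℝ ∞ (fun w => B w u v x) U :=
    ((hB.clm_apply contDiffOn_const).clm_apply contDiffOn_const).clm_apply contDiffOn_const
  have e1 : ∀ w ∈ U, ∀ X, fderiv ℝ (fun w => B w u v x) w X =
      B w (Γ w X u) v x + B w u (Γ w X v) x + B w u v (Γ w X x) := fun w hw X => by
    have := (hasDerivAt_unique_line hU hw X ((((hasDerivAt_line (hBd w hw) X).clm_apply
      (hasDerivAt_const (0 : ℝ) u)).clm_apply (hasDerivAt_const (0 : ℝ) v)).clm_apply
      (hasDerivAt_const (0 : ℝ) x))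
      (hasDerivAt_line (differentiableAt_of_smoothOn hU hf hw) X) fun _ _ => rfl)
    rw [← this, h w hw]
    simp [trilinAct_apply]
  have hf2 : ∀ Y, ContDiffOn ℝ ∞ (fun w => fderiv ℝ (fun w => B w u v x) w Y) U := fun Y =>
    (hf.fderiv_of_isOpen hU (by simp)).clm_apply contDiffOn_const
  have e2 : ∀ X Y, fderiv ℝ (fun w => fderiv ℝ (fun w => B w u v x) w Y) z X =
      (fderiv ℝ B z X (Γ z Y u) v x + B z (fderiv ℝ Γ z X Y u) v x)
        + (fderiv ℝ B z X u (Γ z Y v) x + B z u (fderiv ℝ Γ z X Y v) x)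
        + (fderiv ℝ B z X u v (Γ z Y x) + B z u v (fderiv ℝ Γ z X Y x)) := by
    intro X Y
    have hb := hasDerivAt_line (hBd z hz) X
    have hg := hasDerivAt_line (differentiableAt_of_smoothOn hU hΓ hz) X
    have hc : ∀ u : V, HasDerivAt (fun _ : ℝ => u) 0 0 := fun u => hasDerivAt_const 0 u
    have := hasDerivAt_unique_line hU hz X
      (hasDerivAt_line (differentiableAt_of_smoothOn hU (hf2 Y) hz) X)
      (((((hb.clm_apply ((hg.clm_apply (hc Y)).clm_apply (hc u))).clm_apply (hc v)).clm_apply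
        (hc x)).add
        (((hb.clm_apply (hc u)).clm_apply ((hg.clm_apply (hc Y)).clm_apply (hc v))).clm_apply
        (hc x))).add
        (((hb.clm_apply (hc u)).clm_apply (hc v)).clm_apply
          ((hg.clm_apply (hc Y)).clm_apply (hc x))))
      fun t ht => e1 _ ht Y
    simpa using this
  have := fderiv_fderiv_comm hU hf hz X Y
  rw [e2, e2] at this
  simp only [h z hz, trilinAct_apply] at this
  simp only [curv_apply, map_add, map_sub, add_apply, sub_apply]
  linear_combination (norm := module) this

theorem fderiv_christoffel_symm (hU : IsOpen U) (hΓ : ContDiffOn ℝ ∞ Γ U)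
    (hs : ∀ z ∈ U, ∀ X Y, Γ z X Y = Γ z Y X) {z : V} (hz : z ∈ U) (X Y Z : V) :
    fderiv ℝ Γ z X Y Z = fderiv ℝ Γ z X Z Y := by
  have hg := hasDerivAt_line (differentiableAt_of_smoothOn hU hΓ hz) X
  have hc : ∀ u : V, HasDerivAt (fun _ : ℝ => u) 0 0 := fun u => hasDerivAt_const 0 u
  have := hasDerivAt_unique_line hU hz X ((hg.clm_apply (hc Y)).clm_apply (hc Z))
    ((hg.clm_apply (hc Z)).clm_apply (hc Y)) fun t ht => hs _ ht Y Z
  simpa using this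

variable {G : V → V →L[ℝ] V →L[ℝ] ℝ} {J : V → V →L[ℝ] V}
    {Ψ : V → V →L[ℝ] V →L[ℝ] V →L[ℝ] ℂ}

theorem IsLocalSU3.ricci_eq_zero [FiniteDimensional ℝ V] (h : IsLocalSU3 U G J Ψ)
    (hΓ : IsChristoffel U G Γ) (hV : Module.finrank ℝ V = 6)
    (hJ : ∀ z ∈ U, ∀ X u, fderiv ℝ J z X u = J z (Γ z X u) - Γ z X (J z u))
    (hψ : ∀ z ∈ U, ∀ X, fderiv ℝ Ψ z X = trilinAct (Ψ z) (Γ z X))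
    {z : V} (hz : z ∈ U) (Y Z : V) :
    LinearMap.trace ℝ V (((curv Γ z).flip Y).flip Z) = 0 := by
  refine ricci_eq_zero_of_su3 (h.linear z hz) hV (fun X Y Z => ?_) (fun X Y Z => ?_)
    (curv_bilin h.isOpen hΓ.smooth h.smooth_g hΓ.metric hz) ?_
    (curv_trilin h.isOpen hΓ.smooth h.smooth_psi hψ hz) Y Z
  · simp only [curv_apply]
    module
  · have s := fderiv_christoffel_symm h.isOpen hΓ.smooth hΓ.symm hz
    have g := hΓ.symm z hz
    simp only [curv_apply]
    rw [s X Z Y, s Y X Z, s Z Y X, g Z Y, g Z X, g Y X]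
    module
  -- The fundamental form `G ∘ J` is parallel by the product rule from ∇g = 0 and ∇J = 0.
  · refine curv_bilin h.isOpen hΓ.smooth (B := fun z => (G z).comp (J z))
      (h.smooth_g.clm_comp h.smooth_J) (fun z hz X u v => ?_) hz
    have hc : ∀ u : V, HasDerivAt (fun _ : ℝ => u) 0 0 := fun u => hasDerivAt_const 0 u
    have := hasDerivAt_unique_line h.isOpen hz X
      (((hasDerivAt_line (differentiableAt_of_smoothOn h.isOpen
        (h.smooth_g.clm_comp h.smooth_J) hz) X).clm_apply (hc u)).clm_apply (hc v))
      (((h.line_g hz X).clm_apply ((h.line_J hz X).clm_apply (hc u))).clm_apply (hc v))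
      fun t ht => rfl
    simp [hJ z hz, hΓ.metric z hz] at this
    simp only [this, ContinuousLinearMap.comp_apply]
    ring

end Curvature

end LeviCivita

/-! ### Explicit wedge products in low degree -/

section WedgeFormulas

/-- Every permutation is a permutation fixing 0 followed by the transposition of 0 and p, whose sign
is -1 unless p = 0. -/
theorem sum_sign_perm_succ {n : ℕ} (f : Equiv.Perm (Fin (n + 1)) → ℝ) :
    ∑ σ, Equiv.Perm.sign σ • f σ = ∑ p : Fin (n + 1), (if p = 0 then (1 : ℝ) else -1) *
      ∑ τ : Equiv.Perm (Fin n), Equiv.Perm.sign τ • f (Equiv.Perm.decomposeFin.symm (p, τ)) := by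
  rw [← Equiv.Perm.decomposeFin.symm.sum_comp, Fintype.sum_prod_type]
  refine Finset.sum_congr rfl fun p _ => ?_
  rw [Finset.mul_sum]
  refine Finset.sum_congr rfl fun τ _ => ?_
  rw [Equiv.Perm.decomposeFin.symm_sign]
  split_ifs <;> simp [Units.smul_def]

variable {V : Type*} [AddCommGroup V] [Module ℝ V] [TopologicalSpace V]

/-- Splitting off the images of 0 and 1 leaves the l! permutations of the slots of `b`. They
contribute equally, since `b` is alternating, and cancel the 1/l! of the normalisation. The cast
brings the index type into successor form. -/
theorem wedge_two_apply {l : ℕ} (a : V [⋀^Fin 2]→L[ℝ] ℝ) (b : V [⋀^Fin l]→L[ℝ] ℝ)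
    (v : Fin (l + 2) → V) :
    wedge a b (fun i => v (Fin.cast (add_comm 2 l) i)) =
      1 / 2 * ∑ p : Fin (l + 2), (if p = 0 then (1 : ℝ) else -1) *
        ∑ q : Fin (l + 1), (if q = 0 then (1 : ℝ) else -1) *
          (a ![v p, v (Equiv.swap 0 p q.succ)] *
            b (fun i => v (Equiv.swap 0 p (Equiv.swap 0 q i.succ).succ))) := by
  have hl : (Nat.factorial l : ℝ) ≠ 0 := by positivity
  rw [wedge_apply]
  have e : ∑ σ : Equiv.Perm (Fin (2 + l)), Equiv.Perm.sign σ •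
      (a (fun i => v (Fin.cast (add_comm 2 l) (σ (Fin.castAdd l i)))) *
        b (fun i => v (Fin.cast (add_comm 2 l) (σ (Fin.natAdd 2 i))))) =
      ∑ σ : Equiv.Perm (Fin (l + 2)), Equiv.Perm.sign σ •
        (a ![v (σ 0), v (σ 1)] * b (fun i => v (σ i.succ.succ))) := by
    rw [← (Equiv.permCongr (finCongr (add_comm 2 l))).sum_comp]
    refine Finset.sum_congr rfl fun σ _ => ?_
    rw [Equiv.Perm.sign_permCongr]
    congr 3
    · ext i
      fin_cases i <;> simp [Equiv.permCongr_apply] <;> rfl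
    · ext i
      simp only [Equiv.permCongr_apply, finCongr_apply, finCongr_symm]
      congr 4
      ext
      simp
      omega
  rw [e, sum_sign_perm_succ, Finset.mul_sum, Finset.mul_sum]
  refine Finset.sum_congr rfl fun p _ => ?_
  rw [sum_sign_perm_succ]
  have : ∀ q : Fin (l + 1), ∑ τ : Equiv.Perm (Fin l), Equiv.Perm.sign τ •
      (a ![v (Equiv.Perm.decomposeFin.symm (p, Equiv.Perm.decomposeFin.symm (q, τ)) 0),
        v (Equiv.Perm.decomposeFin.symm (p, Equiv.Perm.decomposeFin.symm (q, τ)) 1)] *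
        b (fun i => v (Equiv.Perm.decomposeFin.symm
          (p, Equiv.Perm.decomposeFin.symm (q, τ)) i.succ.succ))) =
      Nat.factorial l * (a ![v p, v (Equiv.swap 0 p q.succ)] *
            b (fun i => v (Equiv.swap 0 p (Equiv.swap 0 q i.succ).succ))) := by
    intro q
    have ht : ∀ τ : Equiv.Perm (Fin l), Equiv.Perm.sign τ •
      (a ![v (Equiv.Perm.decomposeFin.symm (p, Equiv.Perm.decomposeFin.symm (q, τ)) 0),
        v (Equiv.Perm.decomposeFin.symm (p, Equiv.Perm.decomposeFin.symm (q, τ)) 1)] *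
        b (fun i => v (Equiv.Perm.decomposeFin.symm
          (p, Equiv.Perm.decomposeFin.symm (q, τ)) i.succ.succ))) =
        a ![v p, v (Equiv.swap 0 p q.succ)] *
            b (fun i => v (Equiv.swap 0 p (Equiv.swap 0 q i.succ).succ)) := by
      intro τ
      have hb := b.map_perm (fun i => v (Equiv.swap 0 p (Equiv.swap 0 q i.succ).succ)) τ
      rw [show (1 : Fin (l + 2)) = Fin.succ 0 from rfl]
      simp only [Equiv.Perm.decomposeFin_symm_apply_zero, Equiv.Perm.decomposeFin_symm_apply_succ]
      have hb' : b (fun i => v (Equiv.swap 0 p (Equiv.swap 0 q (τ i).succ).succ)) =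
        Equiv.Perm.sign τ • b (fun i => v (Equiv.swap 0 p (Equiv.swap 0 q i.succ).succ)) := hb
      rw [hb', mul_smul_comm, smul_smul, Int.units_mul_self, one_smul]
    simp only [ht]
    simp [Fintype.card_perm]
  simp only [this]
  rw [Finset.mul_sum, Finset.mul_sum, Finset.mul_sum, Finset.mul_sum]
  refine Finset.sum_congr rfl fun q _ => ?_
  push_cast
  rw [Nat.factorial_two]
  field_simp
  push_cast
  ring

theorem wedge_two_apply_of_eq {l m n : ℕ} [NeZero m] [NeZero n] (hm : l + 1 = m) (hn : m + 1 = n)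
    (h2 : 2 + l = n) (a : V [⋀^Fin 2]→L[ℝ] ℝ) (b : V [⋀^Fin l]→L[ℝ] ℝ) (v : Fin n → V)
    (w : Fin (2 + l) → V) (hw : ∀ i, w i = v (Fin.cast h2 i)) :
    wedge a b w =
      1 / 2 * ∑ p : Fin n, (if p = 0 then (1 : ℝ) else -1) *
        ∑ q : Fin m, (if q = 0 then (1 : ℝ) else -1) *
          (a ![v p, v (Equiv.swap 0 p (Fin.cast hn q.succ))] *
            b (fun i => v (Equiv.swap 0 p (Fin.cast hn
              (Equiv.swap 0 q (Fin.cast hm i.succ)).succ)))) := by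
  subst hm hn
  rw [show w = fun i => v (Fin.cast h2 i) from funext hw]
  exact wedge_two_apply a b v

theorem two_form_swap (a : V [⋀^Fin 2]→L[ℝ] ℝ) (X Y : V) : a ![X, Y] = -a ![Y, X] := by
  have h : a (![Y, X] ∘ Equiv.swap (0 : Fin 2) 1) = -a ![Y, X] :=
    a.toAlternatingMap.map_swap ![Y, X] (i := 0) (j := 1) (by decide)
  rw [← h]
  congr 1
  ext i
  fin_cases i <;> rfl

theorem wedge_two_two_apply (a b : V [⋀^Fin 2]→L[ℝ] ℝ) (v : Fin 4 → V) :
    wedge a b v = a ![v 0, v 1] * b ![v 2, v 3] - a ![v 0, v 2] * b ![v 1, v 3]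
      + a ![v 0, v 3] * b ![v 1, v 2] + a ![v 1, v 2] * b ![v 0, v 3]
      - a ![v 1, v 3] * b ![v 0, v 2] + a ![v 2, v 3] * b ![v 0, v 1] := by
  have hw : wedge a b v = 1 / 2 * ∑ p : Fin 4, (if p = 0 then (1 : ℝ) else -1) *
      ∑ q : Fin 3, (if q = 0 then (1 : ℝ) else -1) * (a ![v p, v (Equiv.swap 0 p q.succ)] *
        b (fun i : Fin 2 => v (Equiv.swap 0 p (Equiv.swap 0 q i.succ).succ))) := by
    have := wedge_two_apply_of_eq (l := 2) (m := 3) (n := 4) rfl rfl rfl a b v v fun _ => rfl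
    simp only [Fin.cast_eq_self] at this
    exact this
  have hb : ∀ f : Fin 2 → V, b f = b ![f 0, f 1] := fun f => by
    congr 1; ext i; fin_cases i <;> rfl
  rw [hw, show (b : (Fin 2 → V) → ℝ) = fun f => b ![f 0, f 1] from funext hb]
  simp only [Fin.sum_univ_four, Fin.sum_univ_three]
  simp [Equiv.swap_apply_def]
  rw [two_form_swap a (v 1) (v 0), two_form_swap a (v 2) (v 0), two_form_swap a (v 3) (v 0),
    two_form_swap a (v 2) (v 1), two_form_swap a (v 3) (v 1), two_form_swap a (v 3) (v 2),
    two_form_swap b (v 1) (v 0), two_form_swap b (v 2) (v 0), two_form_swap b (v 2) (v 1)]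
  ring

/-- The matrix of `e⁰¹ + e²³ + e⁴⁵`. -/
def symplecticMatrix : Fin 6 → Fin 6 → ℤ :=
  ![![0, 1, 0, 0, 0, 0], ![-1, 0, 0, 0, 0, 0], ![0, 0, 0, 1, 0, 0], ![0, 0, -1, 0, 0, 0],
    ![0, 0, 0, 0, 0, 1], ![0, 0, 0, 0, -1, 0]]

/-- The value of the square of `e⁰¹ + e²³ + e⁴⁵` on four basis vectors. -/
def symplecticSquare (s : Fin 4 → Fin 6) : ℤ :=
  2 * (symplecticMatrix (s 0) (s 1) * symplecticMatrix (s 2) (s 3)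
    - symplecticMatrix (s 0) (s 2) * symplecticMatrix (s 1) (s 3)
    + symplecticMatrix (s 0) (s 3) * symplecticMatrix (s 1) (s 2))

/-- A finite table. An entry is nonzero only if the two indices split off form one of the symplectic
pairs 01, 23, 45, the other four indices then being the union of the other two pairs. -/
theorem symplecticSquare_swap : ∀ (p : Fin 6) (q : Fin 5),
    symplecticSquare (fun i : Fin (2 + 2) => Equiv.swap 0 p (Fin.cast (n := 5 + 1) (m := 6) rfl
      (Equiv.swap 0 q (Fin.cast (n := 2 + 2 + 1) (m := 5) rfl i.succ)).succ)) =
      (![![2, 0, 0, 0, 0], ![2, 0, 0, 0, 0], ![0, 0, 2, 0, 0], ![0, -2, 0, 0, 0],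
        ![0, 0, 0, 0, 2], ![0, 0, 0, -2, 0]] : Fin 6 → Fin 5 → ℤ) p q := by
  decide

/-- In a frame in which `w = e⁰¹ + e²³ + e⁴⁵`, the value of `a ∧ w ∧ w` is twice the trace
of `a`. -/
theorem wedge_wedge_frame (a w : V [⋀^Fin 2]→L[ℝ] ℝ) (v : Fin 6 → V)
    (hW : ∀ i j, w ![v i, v j] = symplecticMatrix i j) :
    wedge a (wedge w w) v = 2 * (a ![v 0, v 1] + a ![v 2, v 3] + a ![v 4, v 5]) := by
  have hc : ∀ s : Fin 4 → Fin 6, wedge w w (fun i => v (s i)) = symplecticSquare s := by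
    intro s
    rw [wedge_two_two_apply]
    simp only [hW, symplecticSquare]
    push_cast
    ring
  rw [wedge_two_apply_of_eq (l := 2 + 2) (m := 5) (n := 6) rfl rfl rfl a (wedge w w) v v
    fun _ => rfl]
  simp only [hc, symplecticSquare_swap, Fin.sum_univ_six, Fin.sum_univ_five]
  simp [Equiv.swap_apply_def]
  rw [two_form_swap a (v 1) (v 0), two_form_swap a (v 3) (v 2), two_form_swap a (v 5) (v 4)]
  ring

end WedgeFormulas

/-! ### Forms as curried multilinear maps, and their exterior derivatives -/

section Curry

theorem update_two_zero {V : Type*} (x y u : V) : Function.update ![x, y] 0 u = ![u, y] := by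
  ext i; fin_cases i <;> rfl

theorem update_two_one {V : Type*} (x y u : V) : Function.update ![x, y] 1 u = ![x, u] := by
  ext i; fin_cases i <;> rfl

theorem update_three_zero {V : Type*} (x y z u : V) :
    Function.update ![x, y, z] 0 u = ![u, y, z] := by
  ext i; fin_cases i <;> rfl

theorem update_three_one {V : Type*} (x y z u : V) :
    Function.update ![x, y, z] 1 u = ![x, u, z] := by
  ext i; fin_cases i <;> rfl

theorem update_three_two {V : Type*} (x y z u : V) :
    Function.update ![x, y, z] 2 u = ![x, y, u] := by
  ext i; fin_cases i <;> rfl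

variable {V : Type*} [NormedAddCommGroup V] [NormedSpace ℝ V]
  {F : Type*} [NormedAddCommGroup F] [NormedSpace ℝ F] {U : Set V}

theorem contDiffOn_form_apply {k : ℕ} {η : V → V [⋀^Fin k]→L[ℝ] F} (h : ContDiffOn ℝ ∞ η U)
    (v : Fin k → V) : ContDiffOn ℝ ∞ (fun z => η z v) U :=
  (ContinuousAlternatingMap.apply ℝ V F v).contDiff.comp_contDiffOn h

/-- Evaluation on tuples of basis vectors is an injective linear map with a continuous left inverse,
so finitely many scalar components control the form. -/
theorem differentiableAt_form [FiniteDimensional ℝ V] [FiniteDimensional ℝ F] {k : ℕ}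
    {η : V → V [⋀^Fin k]→L[ℝ] F} {z : V}
    (h : ∀ v, DifferentiableAt ℝ (fun z => η z v) z) : DifferentiableAt ℝ η z := by
  let b := Module.finBasis ℝ V
  let c : (V [⋀^Fin k]→L[ℝ] F) →ₗ[ℝ] ((Fin k → Fin (Module.finrank ℝ V)) → F) :=
    { toFun := fun a s => a fun i => b (s i)
      map_add' := fun _ _ => rfl
      map_smul' := fun _ _ => rfl }
  have hc : LinearMap.ker c = ⊥ := by
    rw [LinearMap.ker_eq_bot']
    intro a ha
    refine ContinuousAlternatingMap.toAlternatingMap_injective ?_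
    exact Module.Basis.ext_alternating b fun v _ => congrFun ha v
  obtain ⟨L, hL⟩ := LinearMap.exists_leftInverse_of_injective c hc
  have : η = fun z => LinearMap.toContinuousLinearMap L (c (η z)) := by
    funext z
    exact (congrArg (fun T => T (η z)) hL).symm
  rw [this]
  exact (LinearMap.toContinuousLinearMap L).differentiableAt.comp z
    (differentiableAt_pi.2 fun s => h _)

theorem extDeriv_two_apply {η : V → V [⋀^Fin 2]→L[ℝ] F} {z : V} (h : DifferentiableAt ℝ η z)
    (X Y Z : V) : extDeriv η z ![X, Y, Z] = fderiv ℝ (fun z => η z ![Y, Z]) z X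
      - fderiv ℝ (fun z => η z ![X, Z]) z Y + fderiv ℝ (fun z => η z ![X, Y]) z Z := by
  rw [extDeriv_apply h]
  refine (Fin.sum_univ_three _).trans ?_
  have e0 : (0 : Fin 3).removeNth ![X, Y, Z] = ![Y, Z] := by ext i; fin_cases i <;> rfl
  have e1 : (1 : Fin 3).removeNth ![X, Y, Z] = ![X, Z] := by ext i; fin_cases i <;> rfl
  have e2 : (2 : Fin 3).removeNth ![X, Y, Z] = ![X, Y] := by ext i; fin_cases i <;> rfl
  rw [e0, e1, e2]
  simp
  abel

theorem extDeriv_two_apply_cyclic {η : V → V [⋀^Fin 2]→L[ℝ] F} {z : V}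
    (h : DifferentiableAt ℝ η z)
    (X Y Z : V) : extDeriv η z ![X, Y, Z] = fderiv ℝ (fun z => η z ![Y, Z]) z X
      + fderiv ℝ (fun z => η z ![Z, X]) z Y + fderiv ℝ (fun z => η z ![X, Y]) z Z := by
  have hs : (fun z => η z ![X, Z]) = fun z => -η z ![Z, X] := by
    funext z
    have h := (η z).toAlternatingMap.map_swap ![Z, X] (i := 0) (j := 1) (by decide)
    refine Eq.trans ?_ h
    change η z _ = η z _
    congr 1
    ext i; fin_cases i <;> rfl
  rw [extDeriv_two_apply h, hs]
  simp

theorem extDeriv_three_apply {η : V → V [⋀^Fin 3]→L[ℝ] F} {z : V} (h : DifferentiableAt ℝ η z)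
    (X Y Z W : V) : extDeriv η z ![X, Y, Z, W] = fderiv ℝ (fun z => η z ![Y, Z, W]) z X
      - fderiv ℝ (fun z => η z ![X, Z, W]) z Y + fderiv ℝ (fun z => η z ![X, Y, W]) z Z
      - fderiv ℝ (fun z => η z ![X, Y, Z]) z W := by
  rw [extDeriv_apply h]
  refine (Fin.sum_univ_four _).trans ?_
  have e0 : (0 : Fin 4).removeNth ![X, Y, Z, W] = ![Y, Z, W] := by ext i; fin_cases i <;> rfl
  have e1 : (1 : Fin 4).removeNth ![X, Y, Z, W] = ![X, Z, W] := by ext i; fin_cases i <;> rfl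
  have e2 : (2 : Fin 4).removeNth ![X, Y, Z, W] = ![X, Y, W] := by ext i; fin_cases i <;> rfl
  have e3 : (3 : Fin 4).removeNth ![X, Y, Z, W] = ![X, Y, Z] := by ext i; fin_cases i <;> rfl
  rw [e0, e1, e2, e3]
  simp [pow_succ]
  abel

variable [FiniteDimensional ℝ V]

/-- A `2`-form as a bilinear map. -/
def curryTwo (η : V [⋀^Fin 2]→L[ℝ] F) : V →L[ℝ] V →L[ℝ] F :=
  (LinearMap.mk₂ ℝ (fun u v => η ![u, v])
    (fun u u' v => by simpa only [update_two_zero] using η.map_update_add ![u, v] 0 u u')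
    (fun c u v => by simpa only [update_two_zero] using η.map_update_smul ![u, v] 0 c u)
    (fun u v v' => by simpa only [update_two_one] using η.map_update_add ![u, v] 1 v v')
    (fun c u v => by
      simpa only [update_two_one] using η.map_update_smul ![u, v] 1 c v)).toContinuousBilinearMap

theorem curryTwo_apply (η : V [⋀^Fin 2]→L[ℝ] F) (u v : V) : curryTwo η u v = η ![u, v] := rfl

/-- A `3`-form as a trilinear map. -/
def curryThree (η : V [⋀^Fin 3]→L[ℝ] F) : V →L[ℝ] V →L[ℝ] V →L[ℝ] F :=
  LinearMap.toContinuousBilinearMap (LinearMap.mk₂ ℝ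
    (fun u v => LinearMap.toContinuousLinearMap
      { toFun := fun w => η ![u, v, w]
        map_add' := fun w w' => by
          simpa only [update_three_two] using η.map_update_add ![u, v, w] 2 w w'
        map_smul' := fun c w => by
          simpa only [update_three_two, RingHom.id_apply] using η.map_update_smul ![u, v, w] 2 c w })
    (fun u u' v => by
      ext w
      have h := η.map_update_add ![u, v, w] 0 u u'
      simp only [update_three_zero] at h
      exact h)
    (fun c u v => by
      ext w
      have h := η.map_update_smul ![u, v, w] 0 c u
      simp only [update_three_zero] at h
      exact h)
    (fun u v v' => by
      ext w
      have h := η.map_update_add ![u, v, w] 1 v v'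
      simp only [update_three_one] at h
      exact h)
    (fun c u v => by
      ext w
      have h := η.map_update_smul ![u, v, w] 1 c v
      simp only [update_three_one] at h
      exact h))

theorem contDiffOn_curryTwo {η : V → V [⋀^Fin 2]→L[ℝ] F} (h : ContDiffOn ℝ ∞ η U) :
    ContDiffOn ℝ ∞ (fun z => curryTwo (η z)) U :=
  contDiffOn_clm_apply.2 fun u => contDiffOn_clm_apply.2 fun v =>
    contDiffOn_form_apply h ![u, v]

theorem contDiffOn_curryThree {η : V → V [⋀^Fin 3]→L[ℝ] F} (h : ContDiffOn ℝ ∞ η U) :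
    ContDiffOn ℝ ∞ (fun z => curryThree (η z)) U :=
  contDiffOn_clm_apply.2 fun u => contDiffOn_clm_apply.2 fun v => contDiffOn_clm_apply.2 fun w =>
    contDiffOn_form_apply h ![u, v, w]

end Curry

/-! ### Charts and coordinate vector fields -/

section ChartLocal

variable {n : ℕ} {N : Type*} [TopologicalSpace N]
  [ChartedSpace (EuclideanSpace ℝ (Fin n)) N]

/-- The derivative of the inverse of the chart `e`. -/
def chartDeriv (e : OpenPartialHomeomorph N (EuclideanSpace ℝ (Fin n)))
    (z : EuclideanSpace ℝ (Fin n)) :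
    EuclideanSpace ℝ (Fin n) →L[ℝ] TangentSpace (𝓡 n) ((e.extend (𝓡 n)).symm z) :=
  mfderiv 𝓘(ℝ, EuclideanSpace ℝ (Fin n)) (𝓡 n) (e.extend (𝓡 n)).symm z

variable {e : OpenPartialHomeomorph N (EuclideanSpace ℝ (Fin n))}

theorem contMDiffAt_extend_symm (he : e ∈ IsManifold.maximalAtlas (𝓡 n) ∞ N)
    {z : EuclideanSpace ℝ (Fin n)} (hz : z ∈ (e.extend (𝓡 n)).target) :
    ContMDiffAt 𝓘(ℝ, EuclideanSpace ℝ (Fin n)) (𝓡 n) ∞ (e.extend (𝓡 n)).symm z := by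
  have := contMDiffOn_extend_symm he
  rw [← OpenPartialHomeomorph.extend_target'] at this
  exact this.contMDiffAt ((e.isOpen_extend_target).mem_nhds hz)

theorem chartDeriv_bijective (he : e ∈ IsManifold.maximalAtlas (𝓡 n) ∞ N)
    {z : EuclideanSpace ℝ (Fin n)} (hz : z ∈ (e.extend (𝓡 n)).target) :
    Function.Bijective (chartDeriv e z) := by
  have h1 := (contMDiffAt_extend_symm he hz).mdifferentiableAt (by simp)
  have hs : (e.extend (𝓡 n)).symm z ∈ e.source := by
    rw [← e.extend_source (I := 𝓡 n)]
    exact (e.extend (𝓡 n)).map_target hz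
  have h2 := (e.contMDiffAt_extend he hs).mdifferentiableAt (by simp)
  have hU := (e.isOpen_extend_target (I := 𝓡 n)).mem_nhds hz
  have hid : mfderiv 𝓘(ℝ, EuclideanSpace ℝ (Fin n)) 𝓘(ℝ, EuclideanSpace ℝ (Fin n))
      (e.extend (𝓡 n) ∘ (e.extend (𝓡 n)).symm) z = ContinuousLinearMap.id ℝ _ := by
    rw [← mfderiv_id]
    refine Filter.EventuallyEq.mfderiv_eq ?_
    filter_upwards [hU] with w hw
    exact (e.extend (𝓡 n)).right_inv hw
  have hc := (mfderiv_comp z h2 h1).symm.trans hid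
  have hi : Function.Injective (chartDeriv e z) := by
    intro u v huv
    have := congrArg (fun x => (mfderiv (𝓡 n) 𝓘(ℝ, EuclideanSpace ℝ (Fin n)) (e.extend (𝓡 n))
      ((e.extend (𝓡 n)).symm z)) x) huv
    have h := fun u => congrArg (fun T => T u) hc
    exact (h u).symm.trans (this.trans (h v))
  let L : EuclideanSpace ℝ (Fin n) →L[ℝ] EuclideanSpace ℝ (Fin n) := chartDeriv e z
  exact ⟨hi, (LinearMap.injective_iff_surjective (f := L.toLinearMap)).1 hi⟩

theorem inChart_eq_zero {F : Type*} [NormedAddCommGroup F] [NormedSpace ℝ F] {k : ℕ}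
    (η : DForm (𝓡 n) N k F) (he : e ∈ IsManifold.maximalAtlas (𝓡 n) ∞ N)
    {z : EuclideanSpace ℝ (Fin n)} (hz : z ∈ (e.extend (𝓡 n)).target)
    (h : η.inChart (𝓡 n) e z = 0) : η ((e.extend (𝓡 n)).symm z) = 0 := by
  ext v
  choose u hu using fun i => (chartDeriv_bijective he hz).2 (v i)
  have := congrArg (fun T => T u) h
  rw [← show (fun i => chartDeriv e z (u i)) = v from funext hu]
  exact this

theorem eq_zero_of_inChart [IsManifold (𝓡 n) ∞ N] {F : Type*} [NormedAddCommGroup F]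
    [NormedSpace ℝ F] {k : ℕ} (η : DForm (𝓡 n) N k F)
    (h : ∀ x : N, η.inChart (𝓡 n) (chartAt (EuclideanSpace ℝ (Fin n)) x)
      (extChartAt (𝓡 n) x x) = 0) : η = 0 := by
  funext x
  have := inChart_eq_zero η (IsManifold.chart_mem_maximalAtlas x)
    (mem_extChartAt_target (I := 𝓡 n) x) (h x)
  have hx : ((chartAt (EuclideanSpace ℝ (Fin n)) x).extend (𝓡 n)).symm (extChartAt (𝓡 n) x x) = x :=
    extChartAt_to_inv (I := 𝓡 n) x
  rw [hx] at this
  exact this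

theorem curryTwo_inChart_apply (η : DForm (𝓡 n) N 2 ℝ) (z u v : EuclideanSpace ℝ (Fin n)) :
    curryTwo (η.inChart (𝓡 n) e z) u v
      = η ((e.extend (𝓡 n)).symm z) ![chartDeriv e z u, chartDeriv e z v] := by
  change η _ _ = η _ _
  congr 1
  ext1 i
  fin_cases i <;> rfl

/-- Constant-coefficient coordinate fields are smooth sections of the tangent bundle. This turns the
bundle-theoretic smoothness of g and J into smoothness of their components in a chart. -/
theorem contMDiffAt_chartDeriv [IsManifold (𝓡 n) ∞ N] (he : e ∈ IsManifold.maximalAtlas (𝓡 n) ∞ N)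
    {z : EuclideanSpace ℝ (Fin n)} (hz : z ∈ (e.extend (𝓡 n)).target)
    (u : EuclideanSpace ℝ (Fin n)) :
    ContMDiffAt 𝓘(ℝ, EuclideanSpace ℝ (Fin n)) ((𝓡 n).prod 𝓘(ℝ, EuclideanSpace ℝ (Fin n))) ∞
      (fun w => (Bundle.TotalSpace.mk' (EuclideanSpace ℝ (Fin n)) ((e.extend (𝓡 n)).symm w)
        (chartDeriv e w u) : TangentBundle (𝓡 n) N)) z := by
  have h := contMDiffAt_extend_symm he hz
  have h1 := h.mfderiv_const (m := ∞) (by simp)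
  have hv : ContMDiffAt 𝓘(ℝ, EuclideanSpace ℝ (Fin n))
      (𝓘(ℝ, EuclideanSpace ℝ (Fin n)).prod 𝓘(ℝ, EuclideanSpace ℝ (Fin n))) ∞
      (fun w => (Bundle.TotalSpace.mk (id w) u :
        TangentBundle 𝓘(ℝ, EuclideanSpace ℝ (Fin n)) (EuclideanSpace ℝ (Fin n)))) z := by
    rw [Bundle.contMDiffAt_totalSpace]
    refine ⟨contMDiffAt_id, ?_⟩
    simp
    exact contMDiffAt_const
  exact ContMDiffAt.clm_apply_of_inCoordinates (F₁ := EuclideanSpace ℝ (Fin n))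
    (F₂ := EuclideanSpace ℝ (Fin n))
    (E₁ := fun w : EuclideanSpace ℝ (Fin n) => TangentSpace 𝓘(ℝ, EuclideanSpace ℝ (Fin n)) w)
    (E₂ := fun x : N => TangentSpace (𝓡 n) x)
    (IB₁ := 𝓘(ℝ, EuclideanSpace ℝ (Fin n))) (b₁ := id) (b₂ := (e.extend (𝓡 n)).symm)
    (ϕ := fun w => chartDeriv e w) (v := fun _ => u) h1 hv h

end ChartLocal

/-! ### The Levi-Civita connection from the Koszul formula -/

section LocalLeviCivita

variable {V : Type*} [NormedAddCommGroup V] [NormedSpace ℝ V]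

theorem isInvertible_of_pos [FiniteDimensional ℝ V] {B : V →L[ℝ] V →L[ℝ] ℝ}
    (hB : ∀ u, u ≠ 0 → 0 < B u u) :
    B.IsInvertible := by
  have hi : Function.Injective (LinearMap.toContinuousLinearMap.symm.toLinearMap ∘ₗ B.toLinearMap :
      V →ₗ[ℝ] Module.Dual ℝ V) := by
    rw [← LinearMap.ker_eq_bot, LinearMap.ker_eq_bot']
    intro u hu
    by_contra h
    have := congrArg (fun T : Module.Dual ℝ V => T u) hu
    exact (hB u h).ne' this
  let L := LinearEquiv.ofInjectiveOfFinrankEq _ hi Subspace.dual_finrank_eq.symm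
  refine ⟨(L.trans LinearMap.toContinuousLinearMap).toContinuousLinearEquiv, ?_⟩
  ext u v
  rfl

/-- The Koszul form `½ (D_X Y W + D_Y X W - D_W X Y)` of the derivative `D` of a metric. -/
def koszul (D : V →L[ℝ] V →L[ℝ] V →L[ℝ] ℝ) : V →L[ℝ] V →L[ℝ] V →L[ℝ] ℝ :=
  (1 / 2 : ℝ) • (D + D.flip -
    ((ContinuousLinearMap.flipₗᵢ ℝ V V ℝ).toContinuousLinearEquiv.toContinuousLinearMap).comp
      D.flip)

theorem koszul_apply (D : V →L[ℝ] V →L[ℝ] V →L[ℝ] ℝ) (X Y W : V) :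
    koszul D X Y W = 1 / 2 * (D X Y W + D Y X W - D W X Y) := rfl

/-- The Levi-Civita connection of the metric `G` on an open subset of `V`. -/
def leviCivita (G : V → V →L[ℝ] V →L[ℝ] ℝ) (z : V) : V →L[ℝ] V →L[ℝ] V :=
  (ContinuousLinearMap.compL ℝ V (V →L[ℝ] ℝ) V (G z).inverse).comp (koszul (fderiv ℝ G z))

theorem leviCivita_apply (G : V → V →L[ℝ] V →L[ℝ] ℝ) (z X Y : V) :
    leviCivita G z X Y = (G z).inverse (koszul (fderiv ℝ G z) X Y) := rfl

variable {U : Set V} {G : V → V →L[ℝ] V →L[ℝ] ℝ}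

theorem metric_leviCivita [FiniteDimensional ℝ V] {z : V}
    (hpos : ∀ u, u ≠ 0 → 0 < G z u u) (X Y W : V) :
    G z (leviCivita G z X Y) W
      = 1 / 2 * (fderiv ℝ G z X Y W + fderiv ℝ G z Y X W - fderiv ℝ G z W X Y) := by
  rw [leviCivita_apply, (isInvertible_of_pos hpos).self_apply_inverse, koszul_apply]

theorem contDiffOn_inverse_apply [FiniteDimensional ℝ V] {F : Type*} [NormedAddCommGroup F]
    [NormedSpace ℝ F] (hG : ContDiffOn ℝ ∞ G U)
    (hpos : ∀ z ∈ U, ∀ u, u ≠ 0 → 0 < G z u u) {κ : V → F →L[ℝ] V →L[ℝ] ℝ}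
    (hκ : ContDiffOn ℝ ∞ κ U) : ContDiffOn ℝ ∞ (fun z => (G z).inverse.comp (κ z)) U := by
  have : ContDiffOn ℝ ∞ (fun z => (G z).inverse) U := fun z hz =>
    ((isInvertible_of_pos (hpos z hz)).contDiffAt_map_inverse.comp_contDiffWithinAt z (hG z hz))
  exact this.clm_comp hκ

theorem fderiv_symm_of_symm (hU : IsOpen U) (hsymm : ∀ z ∈ U, ∀ u v, G z u v = G z v u)
    (hG : ContDiffOn ℝ ∞ G U) {z : V} (hz : z ∈ U) (X u v : V) :
    fderiv ℝ G z X u v = fderiv ℝ G z X v u := by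
  have hd : DifferentiableAt ℝ G z := differentiableAt_of_smoothOn hU hG hz
  have h : ∀ u v, fderiv ℝ (fun z => G z u v) z X = fderiv ℝ G z X u v := fun u v => by
    have := ((hd.hasFDerivAt.clm_apply (hasFDerivAt_const u z)).clm_apply (hasFDerivAt_const v z))
    rw [this.fderiv]
    simp
  rw [← h, ← h]
  have : (fun z => G z u v) =ᶠ[nhds z] fun z => G z v u := by
    filter_upwards [hU.mem_nhds hz] with w hw using hsymm w hw u v
  rw [this.fderiv_eq]

theorem isChristoffel_leviCivita [FiniteDimensional ℝ V] (hU : IsOpen U) (hG : ContDiffOn ℝ ∞ G U)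
    (hpos : ∀ z ∈ U, ∀ u, u ≠ 0 → 0 < G z u u) (hsymm : ∀ z ∈ U, ∀ u v, G z u v = G z v u) :
    IsChristoffel U G (leviCivita G) where
  smooth := by
    have hD : ContDiffOn ℝ ∞ (fderiv ℝ G) U := hG.fderiv_of_isOpen hU (by simp)
    have hD3 : ∀ u v w, ContDiffOn ℝ ∞ (fun z => fderiv ℝ G z u v w) U := fun u v w =>
      ((hD.clm_apply contDiffOn_const).clm_apply contDiffOn_const).clm_apply contDiffOn_const
    refine contDiffOn_clm_apply.2 fun X => ?_
    refine contDiffOn_inverse_apply hG hpos (κ := fun z => koszul (fderiv ℝ G z) X) ?_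
    refine contDiffOn_clm_apply.2 fun Y => contDiffOn_clm_apply.2 fun W => ?_
    exact contDiffOn_const.mul (((hD3 X Y W).add (hD3 Y X W)).sub (hD3 W X Y))
  symm z hz X Y := by
    rw [leviCivita_apply, leviCivita_apply]
    congr 1
    ext W
    rw [koszul_apply, koszul_apply, fderiv_symm_of_symm hU hsymm hG hz W X Y]
    ring
  metric z hz X u v := by
    rw [hsymm z hz u, metric_leviCivita (hpos z hz), metric_leviCivita (hpos z hz),
      fderiv_symm_of_symm hU hsymm hG hz X u v]
    ring

end LocalLeviCivita

/-! ### The metric and Christoffel symbols in a chart -/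

section ChartMetric

variable {n : ℕ} {N : Type*} [TopologicalSpace N]
  [ChartedSpace (EuclideanSpace ℝ (Fin n)) N] [IsManifold (𝓡 n) ∞ N]

/-- The metric in the chart `e`. -/
def chartMetric (g : SmoothMetric n N) (e : OpenPartialHomeomorph N (EuclideanSpace ℝ (Fin n)))
    (z : EuclideanSpace ℝ (Fin n)) :
    EuclideanSpace ℝ (Fin n) →L[ℝ] EuclideanSpace ℝ (Fin n) →L[ℝ] ℝ :=
  let L : EuclideanSpace ℝ (Fin n) →L[ℝ] EuclideanSpace ℝ (Fin n) := chartDeriv e z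
  let B : EuclideanSpace ℝ (Fin n) →L[ℝ] EuclideanSpace ℝ (Fin n) →L[ℝ] ℝ :=
    g.inner ((e.extend (𝓡 n)).symm z)
  B.bilinearComp L L

theorem chartMetric_apply (g : SmoothMetric n N)
    (e : OpenPartialHomeomorph N (EuclideanSpace ℝ (Fin n))) (z u v : EuclideanSpace ℝ (Fin n)) :
    chartMetric g e z u v
      = g.inner ((e.extend (𝓡 n)).symm z) (chartDeriv e z u) (chartDeriv e z v) := rfl

theorem chartMetric_symm (g : SmoothMetric n N)
    (e : OpenPartialHomeomorph N (EuclideanSpace ℝ (Fin n))) (z u v : EuclideanSpace ℝ (Fin n)) :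
    chartMetric g e z u v = chartMetric g e z v u := by
  rw [chartMetric_apply, chartMetric_apply, g.symm]

variable {e : OpenPartialHomeomorph N (EuclideanSpace ℝ (Fin n))}

theorem chartMetric_pos (g : SmoothMetric n N) (he : e ∈ IsManifold.maximalAtlas (𝓡 n) ∞ N)
    {z : EuclideanSpace ℝ (Fin n)} (hz : z ∈ (e.extend (𝓡 n)).target) (u : EuclideanSpace ℝ (Fin n))
    (hu : u ≠ 0) : 0 < chartMetric g e z u u := by
  rw [chartMetric_apply]
  refine g.pos _ _ fun h => hu ?_
  exact (chartDeriv_bijective he hz).1 (h.trans (map_zero (chartDeriv e z)).symm)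

theorem contDiffOn_chartMetric (g : SmoothMetric n N)
    (he : e ∈ IsManifold.maximalAtlas (𝓡 n) ∞ N) :
    ContDiffOn ℝ ∞ (chartMetric g e) (e.extend (𝓡 n)).target := by
  refine contDiffOn_clm_apply.2 fun u => contDiffOn_clm_apply.2 fun v => fun z hz => ?_
  have h : ContMDiffAt 𝓘(ℝ, EuclideanSpace ℝ (Fin n)) ((𝓡 n).prod 𝓘(ℝ)) ∞
      (fun w => Bundle.TotalSpace.mk' ℝ (E := Bundle.Trivial N ℝ) ((e.extend (𝓡 n)).symm w)
        (g.inner ((e.extend (𝓡 n)).symm w) (chartDeriv e w u) (chartDeriv e w v))) z := by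
    apply ContMDiffAt.clm_bundle_apply₂ (F₁ := EuclideanSpace ℝ (Fin n))
      (F₂ := EuclideanSpace ℝ (Fin n))
    · exact g.contMDiff.contMDiffAt.comp z (contMDiffAt_extend_symm he hz)
    · exact contMDiffAt_chartDeriv he hz u
    · exact contMDiffAt_chartDeriv he hz v
  simp only [Bundle.contMDiffAt_totalSpace] at h
  exact (contMDiffAt_iff_contDiffAt.1 h.2).contDiffWithinAt

theorem isChristoffel_chartMetric (g : SmoothMetric n N)
    (he : e ∈ IsManifold.maximalAtlas (𝓡 n) ∞ N) :
    IsChristoffel (e.extend (𝓡 n)).target (chartMetric g e) (leviCivita (chartMetric g e)) :=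
  isChristoffel_leviCivita e.isOpen_extend_target (contDiffOn_chartMetric g he)
    (fun _ hz u hu => chartMetric_pos g he hz u hu) fun z _ u v => chartMetric_symm g e z u v

theorem sum_coord_single (v : EuclideanSpace ℝ (Fin n)) :
    ∑ i, v i • EuclideanSpace.single i (1 : ℝ) = v := by
  ext j
  simp [Finset.sum_apply, Pi.single_apply]

/-- Multiplied by the Gram matrix, both sides become the Koszul expression, and positivity makes the
Gram matrix invertible. -/
theorem christoffel_eq_leviCivita (g : SmoothMetric n N)
    (he : e ∈ IsManifold.maximalAtlas (𝓡 n) ∞ N) {z : EuclideanSpace ℝ (Fin n)}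
    (hz : z ∈ (e.extend (𝓡 n)).target) (k i j : Fin n) :
    christoffel g e k i j z = leviCivita (chartMetric g e) z (EuclideanSpace.single i 1)
      (EuclideanSpace.single j 1) k := by
  set G := chartMetric g e with hGdef
  have hgram : ∀ w a b, gram g e w a b
      = G w (EuclideanSpace.single a 1) (EuclideanSpace.single b 1) := fun _ _ _ => rfl
  have hd : DifferentiableAt ℝ G z :=
    differentiableAt_of_smoothOn e.isOpen_extend_target (contDiffOn_chartMetric g he) hz
  have hpd : ∀ a b c, pd a (fun w => gram g e w b c) z
      = fderiv ℝ G z (EuclideanSpace.single a 1) (EuclideanSpace.single b 1)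
        (EuclideanSpace.single c 1) := fun a b c => by
    have := ((hd.hasFDerivAt.clm_apply (hasFDerivAt_const
      (EuclideanSpace.single b (1 : ℝ)) z)).clm_apply
      (hasFDerivAt_const (EuclideanSpace.single c (1 : ℝ)) z))
    rw [pd, show (fun w => gram g e w b c) = fun w => G w (EuclideanSpace.single b 1)
      (EuclideanSpace.single c 1) from rfl, this.fderiv]
    simp
  have hmul : ∀ (v : EuclideanSpace ℝ (Fin n)) (l : Fin n),
      (gram g e z).mulVec v l = G z v (EuclideanSpace.single l 1) := fun v l => by
    conv_rhs => rw [← sum_coord_single v]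
    rw [map_sum, sum_apply]
    simp only [Matrix.mulVec, dotProduct, hgram, map_smul, smul_apply,
      smul_eq_mul]
    refine Finset.sum_congr rfl fun m _ => ?_
    rw [chartMetric_symm g e z, mul_comm]
  have hunit : IsUnit (gram g e z) := by
    rw [← Matrix.mulVec_injective_iff_isUnit, ← Matrix.coe_mulVecLin, ← LinearMap.ker_eq_bot,
      LinearMap.ker_eq_bot']
    intro v hv
    by_contra hne
    have hv' : (WithLp.toLp 2 v : EuclideanSpace ℝ (Fin n)) ≠ 0 := fun h => hne (by
      simpa using h)
    refine (chartMetric_pos g he hz _ hv').ne' ?_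
    change G z (WithLp.toLp 2 v) (WithLp.toLp 2 v) = 0
    conv_lhs =>
      arg 2
      rw [← sum_coord_single (WithLp.toLp 2 v)]
    rw [map_sum]
    refine Finset.sum_eq_zero fun l _ => ?_
    rw [map_smul, ← hmul]
    have := congrFun hv l
    simp only [Matrix.mulVecLin_apply] at this
    rw [show ((gram g e z).mulVec (WithLp.toLp 2 v : EuclideanSpace ℝ (Fin n)) l) = 0 from this]
    simp
  set Γ := leviCivita G z (EuclideanSpace.single i 1) (EuclideanSpace.single j 1) with hΓ
  have key : (gram g e z).mulVec Γ = fun l => (1 / 2) *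
      (pd i (fun z => gram g e z j l) z + pd j (fun z => gram g e z i l) z
      - pd l (fun z => gram g e z i j) z) := by
    funext l
    rw [hmul, hpd, hpd, hpd, hΓ, metric_leviCivita fun u hu => chartMetric_pos g he hz u hu]
  have h2 := congrArg ((gram g e z)⁻¹.mulVec) key
  rw [Matrix.mulVec_mulVec, Matrix.nonsing_inv_mul _ ((Matrix.isUnit_iff_isUnit_det _).1 hunit),
    Matrix.one_mulVec] at h2
  rw [h2, christoffel, Finset.mul_sum]
  simp only [Matrix.mulVec, dotProduct]
  refine Finset.sum_congr rfl fun l _ => ?_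
  ring

end ChartMetric

section Derivatives

variable {V : Type*} [NormedAddCommGroup V] [NormedSpace ℝ V]
  {F : Type*} [NormedAddCommGroup F] [NormedSpace ℝ F]

theorem fderiv_apply_two {B : V → V →L[ℝ] V →L[ℝ] F} {z : V} (hB : DifferentiableAt ℝ B z)
    (X u v : V) : fderiv ℝ (fun z => B z u v) z X = fderiv ℝ B z X u v := by
  rw [((hB.hasFDerivAt.clm_apply (hasFDerivAt_const u z)).clm_apply
    (hasFDerivAt_const v z)).fderiv]
  simp

theorem fderiv_apply_three {B : V → V →L[ℝ] V →L[ℝ] V →L[ℝ] F} {z : V}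
    (hB : DifferentiableAt ℝ B z) (X u v w : V) :
    fderiv ℝ (fun z => B z u v w) z X = fderiv ℝ B z X u v w := by
  rw [(((hB.hasFDerivAt.clm_apply (hasFDerivAt_const u z)).clm_apply
    (hasFDerivAt_const v z)).clm_apply (hasFDerivAt_const w z)).fderiv]
  simp

theorem fderiv_re {f : V → ℂ} {z : V} (hf : DifferentiableAt ℝ f z) (X : V) :
    fderiv ℝ (fun z => (f z).re) z X = (fderiv ℝ f z X).re := by
  have := Complex.reCLM.hasFDerivAt.comp z hf.hasFDerivAt
  exact congrArg (fun T => T X) this.fderiv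

theorem fderiv_im {f : V → ℂ} {z : V} (hf : DifferentiableAt ℝ f z) (X : V) :
    fderiv ℝ (fun z => (f z).im) z X = (fderiv ℝ f z X).im := by
  have := Complex.imCLM.hasFDerivAt.comp z hf.hasFDerivAt
  exact congrArg (fun T => T X) this.fderiv

end Derivatives

theorem wedge_compContinuousLinearMap {V W : Type*} [AddCommGroup V] [Module ℝ V]
    [TopologicalSpace V] [AddCommGroup W] [Module ℝ W] [TopologicalSpace W] {k l : ℕ}
    (a : W [⋀^Fin k]→L[ℝ] ℝ) (b : W [⋀^Fin l]→L[ℝ] ℝ) (L : V →L[ℝ] W) :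
    (wedge a b).compContinuousLinearMap L
      = wedge (a.compContinuousLinearMap L) (b.compContinuousLinearMap L) := by
  ext v
  rw [wedge_apply]
  exact wedge_apply a b (L ∘ v)

/-! ### The SU(3)-structure in a chart -/

namespace SU3Structure

variable {N : Type*} [TopologicalSpace N]
  [ChartedSpace (EuclideanSpace ℝ (Fin 6)) N] [IsManifold (𝓡 6) ∞ N] (S : SU3Structure N)
  (e : OpenPartialHomeomorph N (EuclideanSpace ℝ (Fin 6)))

/-- The fundamental form in the chart `e`. -/
def chartOmega (z : EuclideanSpace ℝ (Fin 6)) :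
    EuclideanSpace ℝ (Fin 6) →L[ℝ] EuclideanSpace ℝ (Fin 6) →L[ℝ] ℝ :=
  curryTwo (S.omega.inChart (𝓡 6) e z)

/-- The almost complex structure in the chart `e`. -/
def chartJ (z : EuclideanSpace ℝ (Fin 6)) :
    EuclideanSpace ℝ (Fin 6) →L[ℝ] EuclideanSpace ℝ (Fin 6) :=
  (chartMetric S.g e z).inverse.comp (S.chartOmega e z)

/-- The complex volume form in the chart `e`. -/
def chartPsi (z : EuclideanSpace ℝ (Fin 6)) : EuclideanSpace ℝ (Fin 6) →L[ℝ]
    EuclideanSpace ℝ (Fin 6) →L[ℝ] EuclideanSpace ℝ (Fin 6) →L[ℝ] ℂ :=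
  curryThree (S.psi.inChart (𝓡 6) e z)

theorem chartOmega_apply (z u v : EuclideanSpace ℝ (Fin 6)) :
    S.chartOmega e z u v = S.g.inner ((e.extend (𝓡 6)).symm z)
      (S.J ((e.extend (𝓡 6)).symm z) (chartDeriv e z u)) (chartDeriv e z v) := rfl

theorem chartPsi_apply (z u v w : EuclideanSpace ℝ (Fin 6)) :
    S.chartPsi e z u v w = S.psi ((e.extend (𝓡 6)).symm z)
      ![chartDeriv e z u, chartDeriv e z v, chartDeriv e z w] := by
  change S.psi _ _ = S.psi _ _
  congr 1
  ext1 i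
  fin_cases i <;> rfl

variable {e}

theorem chartMetric_chartJ (he : e ∈ IsManifold.maximalAtlas (𝓡 6) ∞ N)
    {z : EuclideanSpace ℝ (Fin 6)} (hz : z ∈ (e.extend (𝓡 6)).target)
    (u v : EuclideanSpace ℝ (Fin 6)) :
    chartMetric S.g e z (S.chartJ e z u) v = S.chartOmega e z u v := by
  rw [chartJ, ContinuousLinearMap.comp_apply,
    (isInvertible_of_pos fun u hu => chartMetric_pos S.g he hz u hu).self_apply_inverse]

/-- Defining `chartJ` as the inverse metric composed with ω makes its smoothness a matter of
components. Nondegeneracy of the metric identifies it with the transport of `J` by the chart. -/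
theorem chartDeriv_chartJ (he : e ∈ IsManifold.maximalAtlas (𝓡 6) ∞ N)
    {z : EuclideanSpace ℝ (Fin 6)} (hz : z ∈ (e.extend (𝓡 6)).target)
    (u : EuclideanSpace ℝ (Fin 6)) :
    chartDeriv e z (S.chartJ e z u) = S.J ((e.extend (𝓡 6)).symm z) (chartDeriv e z u) := by
  obtain ⟨a, ha⟩ := (chartDeriv_bijective he hz).2
    (S.J ((e.extend (𝓡 6)).symm z) (chartDeriv e z u))
  rw [← ha]
  congr 1
  have : S.chartOmega e z u = chartMetric S.g e z a := by
    ext v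
    rw [chartOmega_apply, chartMetric_apply, ha]
  rw [chartJ, ContinuousLinearMap.comp_apply, this,
    (isInvertible_of_pos fun u hu => chartMetric_pos S.g he hz u hu).inverse_apply_self]

theorem contDiffOn_chartOmega (he : e ∈ IsManifold.maximalAtlas (𝓡 6) ∞ N) :
    ContDiffOn ℝ ∞ (S.chartOmega e) (e.extend (𝓡 6)).target := by
  refine contDiffOn_clm_apply.2 fun u => contDiffOn_clm_apply.2 fun v => fun z hz => ?_
  have hJ : ContMDiffAt 𝓘(ℝ, EuclideanSpace ℝ (Fin 6))
      ((𝓡 6).prod 𝓘(ℝ, EuclideanSpace ℝ (Fin 6))) ∞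
      (fun w => (Bundle.TotalSpace.mk' (EuclideanSpace ℝ (Fin 6)) ((e.extend (𝓡 6)).symm w)
        (S.J ((e.extend (𝓡 6)).symm w) (chartDeriv e w u)) : TangentBundle (𝓡 6) N)) z := by
    apply ContMDiffAt.clm_bundle_apply (F₁ := EuclideanSpace ℝ (Fin 6))
      (F₂ := EuclideanSpace ℝ (Fin 6))
    · exact S.smooth_J.contMDiffAt.comp z (contMDiffAt_extend_symm he hz)
    · exact contMDiffAt_chartDeriv he hz u
  have h : ContMDiffAt 𝓘(ℝ, EuclideanSpace ℝ (Fin 6)) ((𝓡 6).prod 𝓘(ℝ)) ∞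
      (fun w => Bundle.TotalSpace.mk' ℝ (E := Bundle.Trivial N ℝ) ((e.extend (𝓡 6)).symm w)
        (S.g.inner ((e.extend (𝓡 6)).symm w) (S.J ((e.extend (𝓡 6)).symm w) (chartDeriv e w u))
          (chartDeriv e w v))) z := by
    apply ContMDiffAt.clm_bundle_apply₂ (F₁ := EuclideanSpace ℝ (Fin 6))
      (F₂ := EuclideanSpace ℝ (Fin 6))
    · exact S.g.contMDiff.contMDiffAt.comp z (contMDiffAt_extend_symm he hz)
    · exact hJ
    · exact contMDiffAt_chartDeriv he hz v
  simp only [Bundle.contMDiffAt_totalSpace] at h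
  exact (contMDiffAt_iff_contDiffAt.1 h.2).contDiffWithinAt

theorem isLocalSU3_chart (he : e ∈ IsManifold.maximalAtlas (𝓡 6) ∞ N) :
    IsLocalSU3 (e.extend (𝓡 6)).target (chartMetric S.g e) (S.chartJ e) (S.chartPsi e) where
  isOpen := e.isOpen_extend_target
  smooth_g := contDiffOn_chartMetric S.g he
  smooth_J := contDiffOn_inverse_apply (contDiffOn_chartMetric S.g he)
    (fun _ hz u hu => chartMetric_pos S.g he hz u hu) (S.contDiffOn_chartOmega he)
  smooth_psi := contDiffOn_curryThree (S.smooth_psi e he)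
  linear z hz :=
    { self_left := fun u w =>
        (S.psi.inChart (𝓡 6) e z).map_eq_zero_of_eq ![u, u, w] (i := 0) (j := 1) rfl (by decide)
      self_right := fun u w =>
        (S.psi.inChart (𝓡 6) e z).map_eq_zero_of_eq ![u, w, w] (i := 1) (j := 2) rfl (by decide)
      J_left := fun u v w => by
        rw [chartPsi_apply, S.chartDeriv_chartJ he hz, S.psi_J, chartPsi_apply]
      symm := chartMetric_symm S.g e z
      pos := chartMetric_pos S.g he hz
      J_J := fun u => (chartDeriv_bijective he hz).1 (by
        rw [S.chartDeriv_chartJ he hz, S.chartDeriv_chartJ he hz, S.J_J]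
        exact (map_neg (chartDeriv e z) u).symm)
      g_J_J := fun u v => by
        rw [chartMetric_apply, S.chartDeriv_chartJ he hz, S.chartDeriv_chartJ he hz, S.inner_J_J,
          chartMetric_apply]
      norm_frame := fun u v w => by
        simp only [chartMetric_apply, S.chartDeriv_chartJ he hz, chartPsi_apply]
        exact S.norm_psi _ _ _ _ }

variable {S}

theorem differentiableAt_omega_inChart (he : e ∈ IsManifold.maximalAtlas (𝓡 6) ∞ N)
    {z : EuclideanSpace ℝ (Fin 6)} (hz : z ∈ (e.extend (𝓡 6)).target) :
    DifferentiableAt ℝ (S.omega.inChart (𝓡 6) e) z :=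
  differentiableAt_form fun v => by
    have h := differentiableAt_of_smoothOn e.isOpen_extend_target (S.contDiffOn_chartOmega he) hz
    exact (h.clm_apply (differentiableAt_const (v 0))).clm_apply (differentiableAt_const (v 1))

theorem fderiv_omega (he : e ∈ IsManifold.maximalAtlas (𝓡 6) ∞ N)
    {z : EuclideanSpace ℝ (Fin 6)} (hz : z ∈ (e.extend (𝓡 6)).target)
    (X Y Z : EuclideanSpace ℝ (Fin 6)) :
    fderiv ℝ (fun z => S.omega.inChart (𝓡 6) e z ![Y, Z]) z X
      = fderiv ℝ (chartMetric S.g e) z X (S.chartJ e z Y) Z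
        + chartMetric S.g e z (fderiv ℝ (S.chartJ e) z X Y) Z := by
  have h := S.isLocalSU3_chart he
  have heq : (fun z => S.omega.inChart (𝓡 6) e z ![Y, Z])
      =ᶠ[nhds z] fun z => chartMetric S.g e z (S.chartJ e z Y) Z := by
    filter_upwards [h.isOpen.mem_nhds hz] with w hw
    rw [S.chartMetric_chartJ he hw]
    rfl
  have hG := (differentiableAt_of_smoothOn h.isOpen h.smooth_g hz).hasFDerivAt
  have hJ := (differentiableAt_of_smoothOn h.isOpen h.smooth_J hz).hasFDerivAt
  rw [heq.fderiv_eq, ((hG.clm_apply (hJ.clm_apply (hasFDerivAt_const Y z))).clm_apply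
    (hasFDerivAt_const Z z)).fderiv]
  simp
  ring

theorem fderiv_omega_cyclic (hω : S.omega.IsClosed (𝓡 6))
    (he : e ∈ IsManifold.maximalAtlas (𝓡 6) ∞ N)
    {z : EuclideanSpace ℝ (Fin 6)} (hz : z ∈ (e.extend (𝓡 6)).target)
    (X Y Z : EuclideanSpace ℝ (Fin 6)) :
    fderiv ℝ (chartMetric S.g e) z X (S.chartJ e z Y) Z
      + chartMetric S.g e z (fderiv ℝ (S.chartJ e) z X Y) Z
      + (fderiv ℝ (chartMetric S.g e) z Y (S.chartJ e z Z) X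
        + chartMetric S.g e z (fderiv ℝ (S.chartJ e) z Y Z) X)
      + (fderiv ℝ (chartMetric S.g e) z Z (S.chartJ e z X) Y
        + chartMetric S.g e z (fderiv ℝ (S.chartJ e) z Z X) Y) = 0 := by
  rw [← fderiv_omega he hz, ← fderiv_omega he hz, ← fderiv_omega he hz,
    ← extDeriv_two_apply_cyclic (differentiableAt_omega_inChart he hz), hω e he z hz]
  rfl

theorem differentiableAt_psi_inChart (he : e ∈ IsManifold.maximalAtlas (𝓡 6) ∞ N)
    {z : EuclideanSpace ℝ (Fin 6)} (hz : z ∈ (e.extend (𝓡 6)).target) :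
    DifferentiableAt ℝ (S.psi.inChart (𝓡 6) e) z :=
  differentiableAt_of_smoothOn e.isOpen_extend_target (S.smooth_psi e he) hz

/-- The alternating sum of the derivatives of `ψ` in the chart, in terms of `dψ₊` and `dψ₋`. -/
theorem fderiv_psi_alternating {π₂ : DForm (𝓡 6) N 2 ℝ} (hS : S.IsClassW2Plus π₂)
    (he : e ∈ IsManifold.maximalAtlas (𝓡 6) ∞ N)
    {z : EuclideanSpace ℝ (Fin 6)} (hz : z ∈ (e.extend (𝓡 6)).target)
    (X Y Z W : EuclideanSpace ℝ (Fin 6)) :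
    fderiv ℝ (S.chartPsi e) z X Y Z W - fderiv ℝ (S.chartPsi e) z Y X Z W
      + fderiv ℝ (S.chartPsi e) z Z X Y W - fderiv ℝ (S.chartPsi e) z W X Y Z
    = ((-SU3Geometry.wedge (π₂.inChart (𝓡 6) e z) (S.omega.inChart (𝓡 6) e z) ![X, Y, Z, W] : ℝ)
      : ℂ) := by
  have hψ := differentiableAt_psi_inChart (S := S) he hz
  have hψc : DifferentiableAt ℝ (S.chartPsi e) z := differentiableAt_of_smoothOn
    e.isOpen_extend_target (S.isLocalSU3_chart he).smooth_psi hz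
  have hp : DifferentiableAt ℝ (S.psiPlus.inChart (𝓡 6) e) z :=
    DifferentiableAt.comp (g := ContinuousLinearMap.compContinuousAlternatingMapCLM ℝ
      (EuclideanSpace ℝ (Fin 6)) ℂ ℝ (Fin 3) Complex.reCLM) z
      (ContinuousLinearMap.differentiableAt _) hψ
  have hm : DifferentiableAt ℝ (S.psiMinus.inChart (𝓡 6) e) z :=
    DifferentiableAt.comp (g := ContinuousLinearMap.compContinuousAlternatingMapCLM ℝ
      (EuclideanSpace ℝ (Fin 6)) ℂ ℝ (Fin 3) Complex.imCLM) z
      (ContinuousLinearMap.differentiableAt _) hψ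
  have hv : ∀ v, DifferentiableAt ℝ (fun z => S.psi.inChart (𝓡 6) e z v) z := fun v =>
    (ContinuousAlternatingMap.apply ℝ _ ℂ v).differentiableAt.comp z hψ
  have hre : ∀ X v, fderiv ℝ (fun z => S.psiPlus.inChart (𝓡 6) e z v) z X
      = (fderiv ℝ (fun z => S.psi.inChart (𝓡 6) e z v) z X).re := fun X v => fderiv_re (hv v) X
  have him : ∀ X v, fderiv ℝ (fun z => S.psiMinus.inChart (𝓡 6) e z v) z X
      = (fderiv ℝ (fun z => S.psi.inChart (𝓡 6) e z v) z X).im := fun X v => fderiv_im (hv v) X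
  have dp := congrArg (fun T => T ![X, Y, Z, W]) (hS.d_psiPlus e he z hz)
  have dm := congrArg (fun T => T ![X, Y, Z, W]) (hS.d_psiMinus e he z hz)
  simp only [extDeriv_three_apply hp, extDeriv_three_apply hm, hre, him] at dp dm
  have hR : (-(π₂.wedge S.omega) : DForm (𝓡 6) N 4 ℝ).inChart (𝓡 6) e z
      = -SU3Geometry.wedge (π₂.inChart (𝓡 6) e z) (S.omega.inChart (𝓡 6) e z) :=
    congrArg Neg.neg (wedge_compContinuousLinearMap (π₂ ((e.extend (𝓡 6)).symm z))
      (S.omega ((e.extend (𝓡 6)).symm z)) (chartDeriv e z))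
  have e3 : ∀ X u v w, fderiv ℝ (S.chartPsi e) z X u v w
      = fderiv ℝ (fun z => S.psi.inChart (𝓡 6) e z ![u, v, w]) z X := fun X u v w =>
    (fderiv_apply_three hψc X u v w).symm
  simp only [e3]
  apply Complex.ext
  · simp only [Complex.sub_re, Complex.add_re, Complex.ofReal_re]
    rw [dp]
    exact congrArg (fun T => T ![X, Y, Z, W]) hR
  · simp only [Complex.sub_im, Complex.add_im, Complex.ofReal_im]
    rw [dm]
    rfl

end SU3Structure

/-! ### Index formulas for ∇ and curvature in invariant form -/

section Components

variable {n : ℕ} {N : Type*} [TopologicalSpace N]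
  [ChartedSpace (EuclideanSpace ℝ (Fin n)) N] [IsManifold (𝓡 n) ∞ N]
  {F : Type*} [NormedAddCommGroup F] [NormedSpace ℝ F]
  {e : OpenPartialHomeomorph N (EuclideanSpace ℝ (Fin n))}

/-- The sum over l of Christoffel symbols is the expansion of Γ(∂ᵢ, ∂ₐ) in coordinate vectors,
reassembled by linearity of the form in the slot s. -/
theorem covDeriv_eq (g : SmoothMetric n N) {k : ℕ} (η : DForm (𝓡 n) N k F)
    (he : e ∈ IsManifold.maximalAtlas (𝓡 n) ∞ N) (i : Fin n) (a : Fin k → Fin n)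
    {z : EuclideanSpace ℝ (Fin n)} (hz : z ∈ (e.extend (𝓡 n)).target) :
    covDeriv g η e i a z
      = fderiv ℝ (fun z => η.inChart (𝓡 n) e z fun s => EuclideanSpace.single (a s) 1) z
          (EuclideanSpace.single i 1)
        - ∑ s, η.inChart (𝓡 n) e z (Function.update (fun s => EuclideanSpace.single (a s) 1) s
            (leviCivita (chartMetric g e) z (EuclideanSpace.single i 1)
              (EuclideanSpace.single (a s) 1))) := by
  rw [covDeriv]
  refine congrArg₂ _ rfl (Finset.sum_congr rfl fun s _ => ?_)
  set v : Fin k → EuclideanSpace ℝ (Fin n) := fun s => EuclideanSpace.single (a s) 1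
  let T := (η.inChart (𝓡 n) e z).toMultilinearMap.toLinearMap v s
  change _ = T _
  conv_rhs => rw [← sum_coord_single (leviCivita (chartMetric g e) z (EuclideanSpace.single i 1)
              (EuclideanSpace.single (a s) 1))]
  rw [map_sum]
  refine Finset.sum_congr rfl fun l _ => ?_
  rw [map_smul, christoffel_eq_leviCivita g he hz]
  congr 1
  change η _ _ = η.inChart (𝓡 n) e z (Function.update v s (EuclideanSpace.single l 1))
  have : Function.update v s (EuclideanSpace.single l 1)
      = fun t => EuclideanSpace.single (Function.update a s l t) 1 := by
    funext t
    by_cases h : t = s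
    · subst h; simp
    · simp [h, v]
  rw [this]
  rfl

theorem riemann_eq_curv (g : SmoothMetric n N) (he : e ∈ IsManifold.maximalAtlas (𝓡 n) ∞ N)
    {z : EuclideanSpace ℝ (Fin n)} (hz : z ∈ (e.extend (𝓡 n)).target) (l i j k : Fin n) :
    riemann g e l i j k z = curv (leviCivita (chartMetric g e)) z (EuclideanSpace.single i 1)
      (EuclideanSpace.single j 1) (EuclideanSpace.single k 1) l := by
  have hΓ := isChristoffel_chartMetric g he
  set Γ := leviCivita (chartMetric g e) with hΓdef
  have hU : IsOpen (e.extend (𝓡 n)).target := e.isOpen_extend_target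
  have hd : DifferentiableAt ℝ Γ z := differentiableAt_of_smoothOn hU hΓ.smooth hz
  have hpd : ∀ i j k, pd i (christoffel g e l j k) z = fderiv ℝ Γ z (EuclideanSpace.single i 1)
      (EuclideanSpace.single j 1) (EuclideanSpace.single k 1) l := fun i j k => by
    have heq : christoffel g e l j k =ᶠ[nhds z] fun w => EuclideanSpace.proj (𝕜 := ℝ) l
        (Γ w (EuclideanSpace.single j 1) (EuclideanSpace.single k 1)) := by
      filter_upwards [hU.mem_nhds hz] with w hw
      exact christoffel_eq_leviCivita g he hw l j k
    rw [pd, heq.fderiv_eq, ← fderiv_apply_two hd]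
    have h2 : DifferentiableAt ℝ (fun w => Γ w (EuclideanSpace.single j 1)
        (EuclideanSpace.single k 1)) z :=
      (hd.clm_apply (differentiableAt_const _)).clm_apply (differentiableAt_const _)
    have := (EuclideanSpace.proj (𝕜 := ℝ) l : EuclideanSpace ℝ (Fin n) →L[ℝ] ℝ).hasFDerivAt.comp z
      h2.hasFDerivAt
    exact congrArg (fun T => T (EuclideanSpace.single i 1)) this.fderiv
  have hsum : ∀ i j, ∑ p, christoffel g e l i p z * christoffel g e p j k z
      = Γ z (EuclideanSpace.single i 1) (Γ z (EuclideanSpace.single j 1)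
        (EuclideanSpace.single k 1)) l := fun i j => by
    conv_rhs => rw [← sum_coord_single (Γ z (EuclideanSpace.single j 1)
      (EuclideanSpace.single k 1)), map_sum]
    simp only [christoffel_eq_leviCivita g he hz, map_smul, ← hΓdef]
    rw [WithLp.ofLp_sum, Finset.sum_apply]
    refine Finset.sum_congr rfl fun p _ => ?_
    simp [mul_comm]
  rw [riemann, hpd, hpd, Finset.sum_sub_distrib, hsum, hsum, curv_apply]
  simp
  ring

theorem ricci_eq_trace_curv (g : SmoothMetric n N) (he : e ∈ IsManifold.maximalAtlas (𝓡 n) ∞ N)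
    {z : EuclideanSpace ℝ (Fin n)} (hz : z ∈ (e.extend (𝓡 n)).target) (j k : Fin n) :
    ricci g e j k z = LinearMap.trace ℝ (EuclideanSpace ℝ (Fin n))
      (((curv (leviCivita (chartMetric g e)) z).flip (EuclideanSpace.single j 1)).flip
        (EuclideanSpace.single k 1)) := by
  rw [LinearMap.trace_eq_matrix_trace ℝ (EuclideanSpace.basisFun (Fin n) ℝ).toBasis, Matrix.trace,
    ricci]
  refine Finset.sum_congr rfl fun i _ => ?_
  rw [riemann_eq_curv g he hz, Matrix.diag_apply, LinearMap.toMatrix_apply]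
  simp

end Components

/-! ### Vanishing torsion form, parallelism and Ricci-flatness on the manifold -/

namespace SU3Structure

variable {N : Type*} [TopologicalSpace N]
  [ChartedSpace (EuclideanSpace ℝ (Fin 6)) N] [IsManifold (𝓡 6) ∞ N] {S : SU3Structure N}
  {e : OpenPartialHomeomorph N (EuclideanSpace ℝ (Fin 6))} {π₂ : DForm (𝓡 6) N 2 ℝ}

theorem omega_adaptedFrame {V : Type*} [NormedAddCommGroup V] [NormedSpace ℝ V]
    {g : V →L[ℝ] V →L[ℝ] ℝ} {J : V →L[ℝ] V} {ψ : V →L[ℝ] V →L[ℝ] V →L[ℝ] ℂ}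
    (h : IsLinearSU3 g J ψ) {f : Fin 3 → V} (hf : IsAdaptedFrame g J ψ f) (i j : Fin 6) :
    g (J (![f 0, J (f 0), f 1, J (f 1), f 2, J (f 2)] i))
      (![f 0, J (f 0), f 1, J (f 1), f 2, J (f 2)] j) = symplecticMatrix i j := by
  have A := hf.g_Je_e
  have B : ∀ i j, g (J (f i)) (J (f j)) = if i = j then 1 else 0 := fun i j => by
    rw [h.g_J_J, hf.g_e_e]
  have C : ∀ i j, g (J (J (f i))) (f j) = -(if i = j then 1 else 0) := fun i j => by
    rw [h.J_J, map_neg, neg_apply, hf.g_e_e]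
  have D : ∀ i j, g (J (J (f i))) (J (f j)) = 0 := fun i j => by
    rw [h.g_J_J, A]
  fin_cases i <;> fin_cases j <;> simp [A, B, C, D, symplecticMatrix]

/-- Closedness is needed only at z, whereas the type (1,1) condition enters on a neighbourhood
because it is differentiated. -/
theorem torsion_eq_zero_of_extDeriv (hS : S.IsClassW2Plus π₂)
    (he : e ∈ IsManifold.maximalAtlas (𝓡 6) ∞ N)
    {z : EuclideanSpace ℝ (Fin 6)} (hz : z ∈ (e.extend (𝓡 6)).target)
    (hd : extDeriv (π₂.inChart (𝓡 6) e) z = 0) : π₂.inChart (𝓡 6) e z = 0 := by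
  have h := S.isLocalSU3_chart he
  obtain ⟨f, hf⟩ := (h.linear z hz).exists_adaptedFrame (by simp)
  have hπ := hS.smooth e he
  have hdπ := differentiableAt_of_smoothOn h.isOpen hπ hz
  have hB := contDiffOn_curryTwo hπ
  have hdB := differentiableAt_of_smoothOn h.isOpen hB hz
  have key : curryTwo (π₂.inChart (𝓡 6) e z) = 0 := by
    refine h.torsionForm_eq_zero (B := fun z => curryTwo (π₂.inChart (𝓡 6) e z)) hB
      (fun w hw u v => ?_) hz (two_form_swap (π₂.inChart (𝓡 6) e z)) hf ?_ (fun X Y Z => ?_)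
      (fun X Y Z W => ?_)
    · rw [curryTwo_inChart_apply, curryTwo_inChart_apply, S.chartDeriv_chartJ he hw,
        S.chartDeriv_chartJ he hw, hS.J_invariant]
    -- Evaluated on f₀, Jf₀, f₁, Jf₁, f₂, Jf₂, primitivity becomes the trace condition required by
    -- the pointwise lemma.
    · have hw := wedge_wedge_frame (π₂.inChart (𝓡 6) e z) (S.omega.inChart (𝓡 6) e z)
        ![f 0, S.chartJ e z (f 0), f 1, S.chartJ e z (f 1), f 2, S.chartJ e z (f 2)]
        (fun i j => by
          rw [← omega_adaptedFrame (h.linear z hz) hf i j, S.chartMetric_chartJ he hz]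
          rfl)
      have hp : SU3Geometry.wedge (π₂.inChart (𝓡 6) e z) (SU3Geometry.wedge
          (S.omega.inChart (𝓡 6) e z) (S.omega.inChart (𝓡 6) e z)) = 0 := by
        have h1 := wedge_compContinuousLinearMap (S.omega ((e.extend (𝓡 6)).symm z))
          (S.omega ((e.extend (𝓡 6)).symm z)) (chartDeriv e z)
        have h2 := wedge_compContinuousLinearMap (π₂ ((e.extend (𝓡 6)).symm z))
          (SU3Geometry.wedge (S.omega ((e.extend (𝓡 6)).symm z))
          (S.omega ((e.extend (𝓡 6)).symm z))) (chartDeriv e z)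
        rw [h1] at h2
        refine h2.symm.trans ?_
        have h3 : SU3Geometry.wedge (π₂ ((e.extend (𝓡 6)).symm z))
          (SU3Geometry.wedge (S.omega ((e.extend (𝓡 6)).symm z))
          (S.omega ((e.extend (𝓡 6)).symm z))) = 0 :=
          congrFun hS.primitive ((e.extend (𝓡 6)).symm z)
        rw [h3]
        rfl
      rw [hp] at hw
      have hw' : (0 : ℝ) = 2 * (curryTwo (π₂.inChart (𝓡 6) e z) (f 0) (S.chartJ e z (f 0))
        + curryTwo (π₂.inChart (𝓡 6) e z) (f 1) (S.chartJ e z (f 1))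
        + curryTwo (π₂.inChart (𝓡 6) e z) (f 2) (S.chartJ e z (f 2))) := hw
      linarith
    · have hx := congrArg (fun T => T ![X, Y, Z]) hd
      simp only [extDeriv_two_apply_cyclic hdπ] at hx
      rw [← fderiv_apply_two hdB, ← fderiv_apply_two hdB, ← fderiv_apply_two hdB]
      exact hx
    · rw [fderiv_psi_alternating hS he hz, wedge_two_two_apply]
      simp only [S.chartMetric_chartJ he hz]
      rfl
  ext v
  refine Eq.trans ?_ (congrArg (fun T => T (v 0) (v 1)) key)
  change π₂.inChart (𝓡 6) e z v = π₂.inChart (𝓡 6) e z ![v 0, v 1]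
  congr 1
  ext1 i
  fin_cases i <;> rfl

theorem torsion_eq_zero (hS : S.IsClassW2Plus π₂)
    (hd : ∀ x : N, extDeriv (π₂.inChart (𝓡 6) (chartAt (EuclideanSpace ℝ (Fin 6)) x))
      (extChartAt (𝓡 6) x x) = 0) : π₂ = 0 :=
  eq_zero_of_inChart π₂ fun x => torsion_eq_zero_of_extDeriv hS
    (IsManifold.chart_mem_maximalAtlas x) (mem_extChartAt_target (I := 𝓡 6) x) (hd x)

theorem fderiv_psi_alternating_eq_zero (hS : S.IsClassW2Plus 0)
    (he : e ∈ IsManifold.maximalAtlas (𝓡 6) ∞ N)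
    {z : EuclideanSpace ℝ (Fin 6)} (hz : z ∈ (e.extend (𝓡 6)).target)
    (X Y Z W : EuclideanSpace ℝ (Fin 6)) :
    fderiv ℝ (S.chartPsi e) z X Y Z W - fderiv ℝ (S.chartPsi e) z Y X Z W
      + fderiv ℝ (S.chartPsi e) z Z X Y W - fderiv ℝ (S.chartPsi e) z W X Y Z = 0 := by
  rw [fderiv_psi_alternating hS he hz, wedge_two_two_apply]
  have : ∀ v, (0 : DForm (𝓡 6) N 2 ℝ).inChart (𝓡 6) e z v = 0 := fun _ => rfl
  simp [this]

theorem fderiv_chartJ (hS : S.IsClassW2Plus 0) (he : e ∈ IsManifold.maximalAtlas (𝓡 6) ∞ N)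
    {z : EuclideanSpace ℝ (Fin 6)} (hz : z ∈ (e.extend (𝓡 6)).target)
    (X u : EuclideanSpace ℝ (Fin 6)) :
    fderiv ℝ (S.chartJ e) z X u = S.chartJ e z (leviCivita (chartMetric S.g e) z X u)
      - leviCivita (chartMetric S.g e) z X (S.chartJ e z u) :=
  (S.isLocalSU3_chart he).fderiv_J_eq (isChristoffel_chartMetric S.g he) (by simp) hz
    (fderiv_omega_cyclic hS.d_omega he hz) (fderiv_psi_alternating_eq_zero hS he hz) X u

theorem fderiv_chartPsi (hS : S.IsClassW2Plus 0) (he : e ∈ IsManifold.maximalAtlas (𝓡 6) ∞ N)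
    {z : EuclideanSpace ℝ (Fin 6)} (hz : z ∈ (e.extend (𝓡 6)).target)
    (X : EuclideanSpace ℝ (Fin 6)) :
    fderiv ℝ (S.chartPsi e) z X
      = trilinAct (S.chartPsi e z) (leviCivita (chartMetric S.g e) z X) :=
  (S.isLocalSU3_chart he).fderiv_psi_eq (isChristoffel_chartMetric S.g he) (by simp) hz
    (fderiv_chartJ hS he hz) (fderiv_psi_alternating_eq_zero hS he hz) X

theorem isParallel_omega (hS : S.IsClassW2Plus 0) : IsParallel S.g S.omega := by
  intro e he z hz i a
  have hl := (S.isLocalSU3_chart he).linear z hz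
  have hv : ∀ (w : EuclideanSpace ℝ (Fin 6)) (v : Fin 2 → EuclideanSpace ℝ (Fin 6)),
      S.omega.inChart (𝓡 6) e w v = S.omega.inChart (𝓡 6) e w ![v 0, v 1] := fun w v => by
    congr 1
    ext1 i
    fin_cases i <;> rfl
  rw [covDeriv_eq S.g S.omega he i a hz, Fin.sum_univ_two]
  simp only [hv _ (fun s => EuclideanSpace.single (a s) 1), hv _ (Function.update _ _ _)]
  simp only [Function.update_self, Function.update_of_ne, ne_eq, zero_ne_one, one_ne_zero,
    not_false_eq_true]
  rw [fderiv_omega he hz, fderiv_chartJ hS he hz, (isChristoffel_chartMetric S.g he).metric z hz,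
    ← curryTwo_apply, ← curryTwo_apply]
  change _ - (S.chartOmega e z _ _ + S.chartOmega e z _ _) = 0
  rw [← S.chartMetric_chartJ he hz, ← S.chartMetric_chartJ he hz, map_sub, sub_apply]
  ring

theorem isParallel_psi (hS : S.IsClassW2Plus 0) : IsParallel S.g S.psi := by
  intro e he z hz i a
  have hv : ∀ (w : EuclideanSpace ℝ (Fin 6)) (v : Fin 3 → EuclideanSpace ℝ (Fin 6)),
      S.psi.inChart (𝓡 6) e w v = S.chartPsi e w (v 0) (v 1) (v 2) := fun w v => by
    change _ = S.psi.inChart (𝓡 6) e w ![v 0, v 1, v 2]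
    congr 1
    ext1 i
    fin_cases i <;> rfl
  have hd := differentiableAt_of_smoothOn e.isOpen_extend_target
    (S.isLocalSU3_chart he).smooth_psi hz
  rw [covDeriv_eq S.g S.psi he i a hz, Fin.sum_univ_three]
  simp only [hv]
  rw [fderiv_apply_three hd, fderiv_chartPsi hS he hz, trilinAct_apply]
  simp [Function.update]

theorem isRicciFlat (hS : S.IsClassW2Plus 0) : IsRicciFlat S.g := by
  intro e he z hz j k
  rw [ricci_eq_trace_curv S.g he hz]
  exact (S.isLocalSU3_chart he).ricci_eq_zero (isChristoffel_chartMetric S.g he) (by simp)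
    (fun z hz => fderiv_chartJ hS he hz) (fun z hz => fderiv_chartPsi hS he hz) hz _ _

end SU3Structure

/-! ### The flux form on the product with a circle -/

theorem wedge_two_one_apply {V : Type*} [AddCommGroup V] [Module ℝ V] [TopologicalSpace V]
    (a : V [⋀^Fin 2]→L[ℝ] ℝ) (b : V [⋀^Fin 1]→L[ℝ] ℝ) (v : Fin 3 → V) :
    wedge a b v = a ![v 0, v 1] * b ![v 2] - a ![v 0, v 2] * b ![v 1]
      + a ![v 1, v 2] * b ![v 0] := by
  have hw : wedge a b v = 1 / 2 * ∑ p : Fin 3, (if p = 0 then (1 : ℝ) else -1) *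
      ∑ q : Fin 2, (if q = 0 then (1 : ℝ) else -1) * (a ![v p, v (Equiv.swap 0 p q.succ)] *
        b (fun i : Fin 1 => v (Equiv.swap 0 p (Equiv.swap 0 q i.succ).succ))) := by
    have := wedge_two_apply_of_eq (l := 1) (m := 2) (n := 3) rfl rfl rfl a b v v fun _ => rfl
    simp only [Fin.cast_eq_self] at this
    exact this
  have hb : ∀ f : Fin 1 → V, b f = b ![f 0] := fun f => by
    congr 1; ext i; fin_cases i; rfl
  rw [hw, show (b : (Fin 1 → V) → ℝ) = fun f => b ![f 0] from funext hb]
  simp only [Fin.sum_univ_three, Fin.sum_univ_two]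
  simp [Equiv.swap_apply_def]
  rw [two_form_swap a (v 1) (v 0), two_form_swap a (v 2) (v 0), two_form_swap a (v 2) (v 1)]
  ring

section Product

variable {N : Type*} [TopologicalSpace N] [ChartedSpace (EuclideanSpace ℝ (Fin 6)) N]
  [IsManifold (𝓡 6) ∞ N]
  {e : OpenPartialHomeomorph N (EuclideanSpace ℝ (Fin 6))}
  {f : OpenPartialHomeomorph Circle (EuclideanSpace ℝ (Fin 1))}
  {p : EuclideanSpace ℝ (Fin 6) × EuclideanSpace ℝ (Fin 1)}

theorem mdifferentiableAt_prod_extend_symm (he : e ∈ IsManifold.maximalAtlas (𝓡 6) ∞ N)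
    (hf : f ∈ IsManifold.maximalAtlas (𝓡 1) ∞ Circle)
    (hp : p ∈ ((e.prod f).extend ((𝓡 6).prod (𝓡 1))).target) :
    MDifferentiableAt 𝓘(ℝ, EuclideanSpace ℝ (Fin 6) × EuclideanSpace ℝ (Fin 1))
      ((𝓡 6).prod (𝓡 1)) ((e.prod f).extend ((𝓡 6).prod (𝓡 1))).symm p := by
  have := contMDiffOn_extend_symm (IsManifold.mem_maximalAtlas_prod he hf)
  rw [← OpenPartialHomeomorph.extend_target'] at this
  have ho : IsOpen ((e.prod f).extend ((𝓡 6).prod (𝓡 1))).target := by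
    rw [OpenPartialHomeomorph.extend_prod]
    exact e.isOpen_extend_target.prod f.isOpen_extend_target
  exact (this.contMDiffAt (ho.mem_nhds hp)).mdifferentiableAt (by simp)

theorem mfderiv_fst_comp_symm (he : e ∈ IsManifold.maximalAtlas (𝓡 6) ∞ N)
    (hf : f ∈ IsManifold.maximalAtlas (𝓡 1) ∞ Circle)
    (hp1 : p.1 ∈ (e.extend (𝓡 6)).target) (hp2 : p.2 ∈ (f.extend (𝓡 1)).target)
    (w : EuclideanSpace ℝ (Fin 6) × EuclideanSpace ℝ (Fin 1)) :
    mfderiv ((𝓡 6).prod (𝓡 1)) (𝓡 6) (Prod.fst : N × Circle → N)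
      (((e.prod f).extend ((𝓡 6).prod (𝓡 1))).symm p)
      (mfderiv 𝓘(ℝ, EuclideanSpace ℝ (Fin 6) × EuclideanSpace ℝ (Fin 1)) ((𝓡 6).prod (𝓡 1))
        ((e.prod f).extend ((𝓡 6).prod (𝓡 1))).symm p w)
      = chartDeriv e p.1 w.1 := by
  have hp : p ∈ ((e.prod f).extend ((𝓡 6).prod (𝓡 1))).target := by
    rw [OpenPartialHomeomorph.extend_prod]
    exact ⟨hp1, hp2⟩
  have h1 := mfderiv_comp p
    (mdifferentiableAt_fst (I := 𝓡 6) (I' := 𝓡 1) (M := N) (M' := Circle))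
    (mdifferentiableAt_prod_extend_symm he hf hp)
  have hfst : MDifferentiableAt 𝓘(ℝ, EuclideanSpace ℝ (Fin 6) × EuclideanSpace ℝ (Fin 1))
      𝓘(ℝ, EuclideanSpace ℝ (Fin 6)) Prod.fst p := differentiableAt_fst.mdifferentiableAt
  have h2 := mfderiv_comp p ((contMDiffAt_extend_symm he hp1).mdifferentiableAt (by simp)) hfst
  have h3 : mfderiv 𝓘(ℝ, EuclideanSpace ℝ (Fin 6) × EuclideanSpace ℝ (Fin 1))
      𝓘(ℝ, EuclideanSpace ℝ (Fin 6)) Prod.fst p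
      = ContinuousLinearMap.fst ℝ (EuclideanSpace ℝ (Fin 6)) (EuclideanSpace ℝ (Fin 1)) := by
    rw [mfderiv_eq_fderiv]
    exact fderiv_fst
  rw [h3] at h2
  exact congrArg (fun T => T w) (h1.symm.trans h2)

theorem mfderiv_snd_comp_symm (he : e ∈ IsManifold.maximalAtlas (𝓡 6) ∞ N)
    (hf : f ∈ IsManifold.maximalAtlas (𝓡 1) ∞ Circle)
    (hp1 : p.1 ∈ (e.extend (𝓡 6)).target) (hp2 : p.2 ∈ (f.extend (𝓡 1)).target)
    (w : EuclideanSpace ℝ (Fin 6) × EuclideanSpace ℝ (Fin 1)) :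
    mfderiv ((𝓡 6).prod (𝓡 1)) (𝓡 1) (Prod.snd : N × Circle → Circle)
      (((e.prod f).extend ((𝓡 6).prod (𝓡 1))).symm p)
      (mfderiv 𝓘(ℝ, EuclideanSpace ℝ (Fin 6) × EuclideanSpace ℝ (Fin 1)) ((𝓡 6).prod (𝓡 1))
        ((e.prod f).extend ((𝓡 6).prod (𝓡 1))).symm p w)
      = chartDeriv f p.2 w.2 := by
  have hp : p ∈ ((e.prod f).extend ((𝓡 6).prod (𝓡 1))).target := by
    rw [OpenPartialHomeomorph.extend_prod]
    exact ⟨hp1, hp2⟩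
  have h1 := mfderiv_comp p
    (mdifferentiableAt_snd (I := 𝓡 6) (I' := 𝓡 1) (M := N) (M' := Circle))
    (mdifferentiableAt_prod_extend_symm he hf hp)
  have hsnd : MDifferentiableAt 𝓘(ℝ, EuclideanSpace ℝ (Fin 6) × EuclideanSpace ℝ (Fin 1))
      𝓘(ℝ, EuclideanSpace ℝ (Fin 1)) Prod.snd p := differentiableAt_snd.mdifferentiableAt
  have h2 := mfderiv_comp p ((contMDiffAt_extend_symm hf hp2).mdifferentiableAt (by simp)) hsnd
  have h3 : mfderiv 𝓘(ℝ, EuclideanSpace ℝ (Fin 6) × EuclideanSpace ℝ (Fin 1))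
      𝓘(ℝ, EuclideanSpace ℝ (Fin 1)) Prod.snd p
      = ContinuousLinearMap.snd ℝ (EuclideanSpace ℝ (Fin 6)) (EuclideanSpace ℝ (Fin 1)) := by
    rw [mfderiv_eq_fderiv]
    exact fderiv_snd
  rw [h3] at h2
  exact congrArg (fun T => T w) (h1.symm.trans h2)

variable {π : DForm (𝓡 6) N 2 ℝ} {α : DForm (𝓡 1) Circle 1 ℝ}

theorem fluxForm_inChart_apply (he : e ∈ IsManifold.maximalAtlas (𝓡 6) ∞ N)
    (hf : f ∈ IsManifold.maximalAtlas (𝓡 1) ∞ Circle)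
    (hp1 : p.1 ∈ (e.extend (𝓡 6)).target) (hp2 : p.2 ∈ (f.extend (𝓡 1)).target)
    (v : Fin 3 → EuclideanSpace ℝ (Fin 6) × EuclideanSpace ℝ (Fin 1)) :
    (fluxForm π α).inChart ((𝓡 6).prod (𝓡 1)) (e.prod f) p v
      = π.inChart (𝓡 6) e p.1 ![(v 0).1, (v 1).1] * α.inChart (𝓡 1) f p.2 ![(v 2).2]
        - π.inChart (𝓡 6) e p.1 ![(v 0).1, (v 2).1] * α.inChart (𝓡 1) f p.2 ![(v 1).2]
        + π.inChart (𝓡 6) e p.1 ![(v 1).1, (v 2).1] * α.inChart (𝓡 1) f p.2 ![(v 0).2] := by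
  have hw := wedge_two_one_apply
    (DForm.pullback ((𝓡 6).prod (𝓡 1)) (𝓡 6) (Prod.fst : N × Circle → N) π
      (((e.prod f).extend ((𝓡 6).prod (𝓡 1))).symm p))
    (DForm.pullback ((𝓡 6).prod (𝓡 1)) (𝓡 1) (Prod.snd : N × Circle → Circle) α
      (((e.prod f).extend ((𝓡 6).prod (𝓡 1))).symm p))
    (fun i => mfderiv 𝓘(ℝ, EuclideanSpace ℝ (Fin 6) × EuclideanSpace ℝ (Fin 1))
      ((𝓡 6).prod (𝓡 1)) ((e.prod f).extend ((𝓡 6).prod (𝓡 1))).symm p (v i))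
  have hA : ∀ u w : EuclideanSpace ℝ (Fin 6) × EuclideanSpace ℝ (Fin 1),
      DForm.pullback ((𝓡 6).prod (𝓡 1)) (𝓡 6) (Prod.fst : N × Circle → N) π
        (((e.prod f).extend ((𝓡 6).prod (𝓡 1))).symm p)
        ![mfderiv 𝓘(ℝ, EuclideanSpace ℝ (Fin 6) × EuclideanSpace ℝ (Fin 1)) ((𝓡 6).prod (𝓡 1))
          ((e.prod f).extend ((𝓡 6).prod (𝓡 1))).symm p u,
          mfderiv 𝓘(ℝ, EuclideanSpace ℝ (Fin 6) × EuclideanSpace ℝ (Fin 1)) ((𝓡 6).prod (𝓡 1))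
          ((e.prod f).extend ((𝓡 6).prod (𝓡 1))).symm p w]
      = π.inChart (𝓡 6) e p.1 ![u.1, w.1] := fun u w => by
    change π ((e.extend (𝓡 6)).symm p.1) _ = π ((e.extend (𝓡 6)).symm p.1) _
    congr 1
    ext1 i
    fin_cases i
    · exact mfderiv_fst_comp_symm he hf hp1 hp2 u
    · exact mfderiv_fst_comp_symm he hf hp1 hp2 w
  have hB : ∀ u : EuclideanSpace ℝ (Fin 6) × EuclideanSpace ℝ (Fin 1),
      DForm.pullback ((𝓡 6).prod (𝓡 1)) (𝓡 1) (Prod.snd : N × Circle → Circle) α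
        (((e.prod f).extend ((𝓡 6).prod (𝓡 1))).symm p)
        ![mfderiv 𝓘(ℝ, EuclideanSpace ℝ (Fin 6) × EuclideanSpace ℝ (Fin 1)) ((𝓡 6).prod (𝓡 1))
          ((e.prod f).extend ((𝓡 6).prod (𝓡 1))).symm p u]
      = α.inChart (𝓡 1) f p.2 ![u.2] := fun u => by
    change α ((f.extend (𝓡 1)).symm p.2) _ = α ((f.extend (𝓡 1)).symm p.2) _
    congr 1
    ext1 i
    fin_cases i
    exact mfderiv_snd_comp_symm he hf hp1 hp2 u
  rw [hA, hA, hA, hB, hB, hB] at hw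
  exact hw

theorem differentiableAt_fluxForm_inChart (he : e ∈ IsManifold.maximalAtlas (𝓡 6) ∞ N)
    (hf : f ∈ IsManifold.maximalAtlas (𝓡 1) ∞ Circle)
    (hp1 : p.1 ∈ (e.extend (𝓡 6)).target) (hp2 : p.2 ∈ (f.extend (𝓡 1)).target)
    (hπ : DifferentiableAt ℝ (π.inChart (𝓡 6) e) p.1)
    (hα : DifferentiableAt ℝ (α.inChart (𝓡 1) f) p.2) :
    DifferentiableAt ℝ ((fluxForm π α).inChart ((𝓡 6).prod (𝓡 1)) (e.prod f)) p := by
  refine differentiableAt_form fun v => ?_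
  have hU : ∀ᶠ q in nhds p, q.1 ∈ (e.extend (𝓡 6)).target ∧ q.2 ∈ (f.extend (𝓡 1)).target :=
    (continuousAt_fst.eventually_mem (e.isOpen_extend_target.mem_nhds hp1)).and
      (continuousAt_snd.eventually_mem (f.isOpen_extend_target.mem_nhds hp2))
  have hA : ∀ v, DifferentiableAt ℝ (fun q : EuclideanSpace ℝ (Fin 6) × EuclideanSpace ℝ (Fin 1) =>
      π.inChart (𝓡 6) e q.1 v) p := fun v =>
    (ContinuousAlternatingMap.apply ℝ _ ℝ v).differentiableAt.comp p
      (hπ.comp p differentiableAt_fst)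
  have hB : ∀ v, DifferentiableAt ℝ (fun q : EuclideanSpace ℝ (Fin 6) × EuclideanSpace ℝ (Fin 1) =>
      α.inChart (𝓡 1) f q.2 v) p := fun v =>
    (ContinuousAlternatingMap.apply ℝ _ ℝ v).differentiableAt.comp p
      (hα.comp p differentiableAt_snd)
  refine ((((hA ![(v 0).1, (v 1).1]).mul (hB ![(v 2).2])).sub ((hA ![(v 0).1, (v 2).1]).mul
    (hB ![(v 1).2]))).add ((hA ![(v 1).1, (v 2).1]).mul (hB ![(v 0).2]))).congr_of_eventuallyEq ?_
  filter_upwards [hU] with q hq using fluxForm_inChart_apply he hf hq.1 hq.2 v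

/-- With these arguments α is never differentiated: in the directions tangent to N its coefficient
is constant, and in the direction τ the derivative falls on H evaluated on three vectors tangent to
N, which is zero. No closedness of α enters. -/
theorem extDeriv_fluxForm_apply (he : e ∈ IsManifold.maximalAtlas (𝓡 6) ∞ N)
    (hf : f ∈ IsManifold.maximalAtlas (𝓡 1) ∞ Circle)
    (hp1 : p.1 ∈ (e.extend (𝓡 6)).target) (hp2 : p.2 ∈ (f.extend (𝓡 1)).target)
    (hπ : DifferentiableAt ℝ (π.inChart (𝓡 6) e) p.1)
    (hα : DifferentiableAt ℝ (α.inChart (𝓡 1) f) p.2)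
    (u v w : EuclideanSpace ℝ (Fin 6)) (τ : EuclideanSpace ℝ (Fin 1)) :
    extDeriv ((fluxForm π α).inChart ((𝓡 6).prod (𝓡 1)) (e.prod f)) p
      ![(u, 0), (v, 0), (w, 0), (0, τ)]
      = extDeriv (π.inChart (𝓡 6) e) p.1 ![u, v, w] * α.inChart (𝓡 1) f p.2 ![τ] := by
  have hU : ∀ᶠ q in nhds p, q.1 ∈ (e.extend (𝓡 6)).target ∧ q.2 ∈ (f.extend (𝓡 1)).target :=
    (continuousAt_fst.eventually_mem (e.isOpen_extend_target.mem_nhds hp1)).and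
      (continuousAt_snd.eventually_mem (f.isOpen_extend_target.mem_nhds hp2))
  have h0 : ∀ (η : EuclideanSpace ℝ (Fin 1) [⋀^Fin 1]→L[ℝ] ℝ), η ![0] = 0 := fun η =>
    η.map_coord_zero 0 rfl
  have h3 : ∀ (a b c : EuclideanSpace ℝ (Fin 6)), fderiv ℝ
      (fun q => (fluxForm π α).inChart ((𝓡 6).prod (𝓡 1)) (e.prod f) q ![(a, 0), (b, 0), (0, τ)])
      p (c, 0) = fderiv ℝ (fun y => π.inChart (𝓡 6) e y ![a, b]) p.1 c
        * α.inChart (𝓡 1) f p.2 ![τ] := fun a b c => by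
    have heq : (fun q => (fluxForm π α).inChart ((𝓡 6).prod (𝓡 1)) (e.prod f) q
        ![(a, 0), (b, 0), (0, τ)]) =ᶠ[nhds p] fun q => π.inChart (𝓡 6) e q.1 ![a, b]
          * α.inChart (𝓡 1) f q.2 ![τ] := by
      filter_upwards [hU] with q hq
      rw [fluxForm_inChart_apply he hf hq.1 hq.2]
      simp [h0]
    have hA : DifferentiableAt ℝ (fun y => π.inChart (𝓡 6) e y ![a, b]) p.1 :=
      (ContinuousAlternatingMap.apply ℝ _ ℝ ![a, b]).differentiableAt.comp p.1 hπ
    have hB : DifferentiableAt ℝ (fun y => α.inChart (𝓡 1) f y ![τ]) p.2 :=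
      (ContinuousAlternatingMap.apply ℝ _ ℝ ![τ]).differentiableAt.comp p.2 hα
    have := (hA.hasFDerivAt.comp p hasFDerivAt_fst).mul (hB.hasFDerivAt.comp p hasFDerivAt_snd)
    rw [heq.fderiv_eq]
    refine (congrArg (fun T => T (c, 0)) this.fderiv).trans ?_
    simp [mul_comm]
  have h4 : (fun q => (fluxForm π α).inChart ((𝓡 6).prod (𝓡 1)) (e.prod f) q
      ![(u, 0), (v, 0), (w, 0)]) =ᶠ[nhds p] fun _ => 0 := by
    filter_upwards [hU] with q hq
    rw [fluxForm_inChart_apply he hf hq.1 hq.2]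
    simp [h0]
  rw [extDeriv_three_apply (differentiableAt_fluxForm_inChart he hf hp1 hp2 hπ hα),
    extDeriv_two_apply hπ, h3, h3, h3, h4.fderiv_eq]
  simp
  ring

theorem extDeriv_eq_zero_of_isClosed_fluxForm (hπ : π.IsSmooth (𝓡 6)) (hα : α.IsSmooth (𝓡 1))
    (hα0 : α ≠ 0) (hH : (fluxForm π α).IsClosed ((𝓡 6).prod (𝓡 1)))
    (he : e ∈ IsManifold.maximalAtlas (𝓡 6) ∞ N) {y : EuclideanSpace ℝ (Fin 6)}
    (hy : y ∈ (e.extend (𝓡 6)).target) : extDeriv (π.inChart (𝓡 6) e) y = 0 := by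
  -- One point of the circle with α ≠ 0 serves for every point of N, since dH = 0 holds on the whole
  -- product.
  obtain ⟨t, ht⟩ : ∃ t : Circle, α.inChart (𝓡 1) (chartAt (EuclideanSpace ℝ (Fin 1)) t)
      (extChartAt (𝓡 1) t t) ≠ 0 := by
    by_contra! h
    exact hα0 (eq_zero_of_inChart α h)
  have hf := IsManifold.chart_mem_maximalAtlas (I := 𝓡 1) (n := ∞) t
  set f := chartAt (EuclideanSpace ℝ (Fin 1)) t
  have hs : extChartAt (𝓡 1) t t ∈ (f.extend (𝓡 1)).target := mem_extChartAt_target t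
  set s := extChartAt (𝓡 1) t t
  obtain ⟨τ, hτ⟩ : ∃ τ, α.inChart (𝓡 1) f s ![τ] ≠ 0 := by
    by_contra! h
    refine ht ?_
    ext v
    refine Eq.trans ?_ (h (v 0))
    congr 1
    ext1 i
    fin_cases i
    rfl
  ext v
  have hd := extDeriv_fluxForm_apply (p := (y, s)) he hf hy hs
    (differentiableAt_of_smoothOn e.isOpen_extend_target (hπ e he) hy)
    (differentiableAt_of_smoothOn f.isOpen_extend_target (hα f hf) hs) (v 0) (v 1) (v 2) τ
  have hp : (y, s) ∈ ((e.prod f).extend ((𝓡 6).prod (𝓡 1))).target := by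
    rw [OpenPartialHomeomorph.extend_prod]
    exact ⟨hy, hs⟩
  rw [hH _ (IsManifold.mem_maximalAtlas_prod he hf) _ hp] at hd
  have h0 := (mul_eq_zero.1 hd.symm).resolve_right hτ
  refine Eq.trans ?_ h0
  congr 1
  ext1 i
  fin_cases i <;> rfl

end Product

end SU3Geometry

end

/-! ### Conclusion -/

theorem proposition5p2 {N : Type*} [TopologicalSpace N]
    [ChartedSpace (EuclideanSpace ℝ (Fin 6)) N] [IsManifold (𝓡 6) ∞ N]
    (S : SU3Geometry.SU3Structure N) (π₂ : SU3Geometry.DForm (𝓡 6) N 2 ℝ)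
    (hS : S.IsClassW2Plus π₂) :
    (π₂.IsClosed (𝓡 6) → π₂ = 0 ∧ S.IsIntegrable ∧ SU3Geometry.IsRicciFlat S.g) ∧
    (∀ α : SU3Geometry.DForm (𝓡 1) Circle 1 ℝ, α.IsSmooth (𝓡 1) → α ≠ 0 →
      (SU3Geometry.fluxForm π₂ α).IsClosed ((𝓡 6).prod (𝓡 1)) → S.IsIntegrable) := by
  -- Since the vanishing of π₂ is a pointwise argument, both parts need dπ₂ = 0 only at each x in
  -- its preferred chart.
  have key : (∀ x : N, extDeriv (π₂.inChart (𝓡 6) (chartAt (EuclideanSpace ℝ (Fin 6)) x))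
      (extChartAt (𝓡 6) x x) = 0) →
      π₂ = 0 ∧ S.IsIntegrable ∧ SU3Geometry.IsRicciFlat S.g := fun hd => by
    have h0 := SU3Geometry.SU3Structure.torsion_eq_zero hS hd
    subst h0
    exact ⟨rfl, ⟨SU3Geometry.SU3Structure.isParallel_omega hS,
      SU3Geometry.SU3Structure.isParallel_psi hS⟩, SU3Geometry.SU3Structure.isRicciFlat hS⟩
  refine ⟨fun hc => key fun x => ?_, fun α hα hα0 hH => (key fun x => ?_).2.1⟩
  · exact (hc _ (IsManifold.chart_mem_maximalAtlas x) _ (mem_extChartAt_target (I := 𝓡 6) x)).trans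
      rfl
  · exact SU3Geometry.extDeriv_eq_zero_of_isClosed_fluxForm hS.smooth hα hα0 hH
      (IsManifold.chart_mem_maximalAtlas x) (mem_extChartAt_target (I := 𝓡 6) x)
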